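/- Fix $\mu>1$. For an integer $N\ge 1$ let $$V(x)=\sum_{k=1}^N\Big(\tfrac14x_k^4-\tfrac12x_k^2\Big)+\mu\sum_{k=1}^N\frac{(x_k-x_{k+1})^2}{8\sin^2(\pi/N)}+\frac N4,\qquad x\in\mathbb R^N,\quad x_{N+1}:=x_1$$ (for $N=1$ the second sum is understood to be $0$), and for $h>0$ let $m_{h,N}$ be the probability measure on $\mathbb R^N$ with density proportional to $e^{-V/(hN)}$. Let $\lambda(h,N)$ and $\rho(h,N)$ be the largest constants such that, for every $\varphi$ in the weighted Sobolev space $H^1(\mathbb R^N,m_{h,N})$, $$\lambda(h,N)\,\mathrm{Var}_{m_{h,N}}(\varphi)\le hN\int|\nabla\varphi|^2\,dm_{h,N},\qquad \rho(h,N)\,\mathrm{Ent}_{m_{h,N}}(\varphi^2)\le 2hN\int|\nabla\varphi|^2\,dm_{h,N},$$ where $\mathrm{Ent}_m(f)=\int f\log f\,dm-\int f\,dm\,\log\int f\,dm$. Let $$p(N)=\frac1\pi\left|\frac{\det\mathrm{Hess}\,V(-1,\dots,-1)}{\det\mathrm{Hess}\,V(0)}\right|^{1/2}.$$ Then these largest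 constants exist, and there are real numbers $\varepsilon(h,N)$ and a constant $C>0$ with $|\varepsilon(h,N)|\le Ch$ for all $h\in(0,1]$ and all $N\ge1$, such that for every $\delta>0$ there is $C_\delta>0$ for which, for all $h>0$ and all $N\ge1$, $$C_\delta\,e^{-\frac{3+2\sqrt2+\delta}{24h}}\,e^{-\frac1{4h}}\le\rho(h,N)\le\lambda(h,N)\le p(N)\,e^{-\frac1{4h}}\,\big(1+\varepsilon(h,N)\big).$$ Moreover $$p(N)\longrightarrow\frac{\sinh\big(\pi\sqrt{2/\mu}\big)}{\pi\,\sin\big(\pi/\sqrt\mu\big)}\qquad(N\to\infty).$$ (The constants $C$ and $C_\delta$ may depend on $\mu$.) -/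

import Mathlib

open MeasureTheory ProbabilityTheory Filter Topology
open scoped ContDiff

namespace AllenCahn

/-- The Euclidean space `ℝ^N`. -/
abbrev Space (N : ℕ) : Type := EuclideanSpace ℝ (Fin N)

/-- The energy
`V(x) = ∑ (x_k^4/4 - x_k^2/2) + μ ∑ (x_k - x_{k+1})^2 / (8 sin^2(π/N)) + N/4`
with periodic boundary conditions (`finRotate N k` is `k + 1` modulo `N`).
For `N = 1` one has `x_{k+1} = x_k`, and the interaction term vanishes. -/
noncomputable def V (μ : ℝ) (N : ℕ) (x : Space N) : ℝ :=
  ∑ k : Fin N, (x k ^ 4 / 4 - x k ^ 2 / 2)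
    + μ * ∑ k : Fin N, (x k - x (finRotate N k)) ^ 2 / (8 * Real.sin (Real.pi / N) ^ 2)
    + N / 4

/-- The equilibrium probability measure on `ℝ^N`: it has density
`exp (-V / (h N)) / ∫ exp (-V / (h N))` with respect to Lebesgue measure. -/
noncomputable def gibbs (μ h : ℝ) (N : ℕ) : Measure (Space N) :=
  (volume : Measure (Space N)).tilted (fun x => -(V μ N x / (h * N)))

/-- `G` is the weak (distributional) gradient of `φ` on `ℝ^N`. -/
def IsWeakGradient {N : ℕ} (φ : Space N → ℝ) (G : Space N → Space N) : Prop :=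
  LocallyIntegrable φ ∧ LocallyIntegrable G ∧
    ∀ g : Space N → ℝ, ContDiff ℝ ∞ g → HasCompactSupport g → ∀ i : Fin N,
      ∫ x, φ x * fderiv ℝ g x (EuclideanSpace.single i 1) = - ∫ x, G x i * g x

/-- `φ` belongs to the weighted Sobolev space `H^1(ℝ^N, m)` and has weak gradient `G`. -/
def MemH1 {N : ℕ} (m : Measure (Space N)) (φ : Space N → ℝ) (G : Space N → Space N) : Prop :=
  IsWeakGradient φ G ∧ MemLp φ 2 m ∧ MemLp G 2 m

/-- The entropy `Ent_m(f) = ∫ f log f dm - ∫ f dm log (∫ f dm)` of a nonnegative function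
(with `0 log 0 = 0`). -/
noncomputable def entropy {N : ℕ} (m : Measure (Space N)) (f : Space N → ℝ) : ℝ :=
  ∫ x, f x * Real.log (f x) ∂m - (∫ x, f x ∂m) * Real.log (∫ x, f x ∂m)

/-- The constants `c` for which the Poincaré inequality
`c Var_m(φ) ≤ h N ∫ |∇φ|² dm` holds for all `φ ∈ H^1(ℝ^N, m)`, `m` the equilibrium measure. -/
def poincareConstants (μ h : ℝ) (N : ℕ) : Set ℝ :=
  {c | ∀ (φ : Space N → ℝ) (G : Space N → Space N), MemH1 (gibbs μ h N) φ G →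
    c * variance φ (gibbs μ h N) ≤ h * N * ∫ x, ‖G x‖ ^ 2 ∂(gibbs μ h N)}

/-- The constants `c` for which the logarithmic Sobolev inequality
`c Ent_m(φ²) ≤ 2 h N ∫ |∇φ|² dm` holds for all `φ ∈ H^1(ℝ^N, m)`, `m` the equilibrium measure.
The integrability clause says that the entropy of `φ²` is finite, which the inequality includes
for `c > 0`. -/
def logSobolevConstants (μ h : ℝ) (N : ℕ) : Set ℝ :=
  {c | ∀ (φ : Space N → ℝ) (G : Space N → Space N), MemH1 (gibbs μ h N) φ G →
    Integrable (fun x => φ x ^ 2 * Real.log (φ x ^ 2)) (gibbs μ h N) ∧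
    c * entropy (gibbs μ h N) (fun x => φ x ^ 2)
      ≤ 2 * (h * N) * ∫ x, ‖G x‖ ^ 2 ∂(gibbs μ h N)}

/-- The Poincaré constant `λ(h, N)`: the largest constant in the Poincaré inequality. -/
noncomputable def poincareConstant (μ h : ℝ) (N : ℕ) : ℝ := sSup (poincareConstants μ h N)

/-- The logarithmic Sobolev constant `ρ(h, N)`: the largest constant in the logarithmic
Sobolev inequality. -/
noncomputable def logSobolevConstant (μ h : ℝ) (N : ℕ) : ℝ := sSup (logSobolevConstants μ h N)

/-- The Hessian matrix `(∂_i ∂_j f (x))_{i,j}`. -/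
noncomputable def hessian {N : ℕ} (f : Space N → ℝ) (x : Space N) : Matrix (Fin N) (Fin N) ℝ :=
  Matrix.of fun i j =>
    fderiv ℝ (fun y => fderiv ℝ f y (EuclideanSpace.single j 1)) x (EuclideanSpace.single i 1)

/-- The constant state `(-1, …, -1)`, a minimum of `V`. -/
noncomputable def Iminus (N : ℕ) : Space N := WithLp.toLp 2 (fun _ => -1)

/-- The prefactor `p(N) = (1/π) |det Hess V(I₋) / det Hess V(0)|^(1/2)`. -/
noncomputable def prefactor (μ : ℝ) (N : ℕ) : ℝ :=
  1 / Real.pi *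
    Real.sqrt |(hessian (V μ N) (Iminus N)).det / (hessian (V μ N) 0).det|

end AllenCahn

/-! Write `M_c` for `c` times the identity plus `coupling μ N` times the periodic Laplacian. The
Hessian of `V` is `M_2` at the minima and `M_{-1}` at the saddle 0.

Lower bound on `ρ`. Each site potential is replaced by a larger one with convexity modulus 1/3, at
distance at most 4/9 from it; the interaction is convex already. The new energy divided by `hN` is
strongly convex with modulus `1/(3hN)` and differs from `V/(hN)` by at most `4/(9h)`, whatever `N`.
Bakry–Émery (`tilted_logSobolev`) followed by Holley–Stroock (`holleyStroock`) gives `ρ ≥ (1/3)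
exp(-4/(9h))`, which suffices because `4/9 < (3 + 2√2)/24 + 1/4`. Bakry–Émery is derived from the
Prékopa–Leindler inequality by comparing first-order terms as one weight tends to 0. The inequality
is obtained for test functions and passes to the weighted Sobolev space by mollification, cutoff and
lower semicontinuity of the entropy.

Comparison `ρ ≤ λ`. Linearize the logarithmic Sobolev inequality at `1 + εφ`
(`variance_le_of_entropy_le`). Since each defining condition is linear in the constant, the suprema
are attained.

Upper bound on `λ`. The test function is `∫₀^m exp(-s²/(2h)) ds`, with `m` the mean of the
coordinates. It is odd while `V` is even, so it has mean zero. Its Dirichlet form carries the weight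
`exp(-(V + N m²)/(hN))`, and `V + N m²` is bounded below by `N/4` plus half the quadratic form of
`saddleMatrix`, without any error term (`saddle_le_V`). The variance is bounded below by the mass of
the two wells (`le_integral_well`): the cubic term there is odd and integrates to zero, and the
quartic term is `O(h)` uniformly in `N` by the discrete Sobolev inequality `sq_apply_le`. The
quotient of the two Gaussian integrals is `√(det M_2 / |det M_{-1}|) = π p(N)`.

Prefactor. The cyclic shift has characteristic polynomial `X^N - 1`, so the determinants are
explicit: `4 sinh²(Nα)` and `-4 sin²(Nα)` up to a common factor. This yields the limit, and also,
through the discrete Wirtinger inequality, the positivity of `saddleMatrix`, where `μ > 1` enters.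
-/

namespace AllenCahn

/-! ### Brunn–Minkowski on the line and Prékopa–Leindler in all dimensions. -/

section

open scoped ENNReal Pointwise

/-- One-dimensional Brunn–Minkowski inequality. -/
theorem volume_add_volume_le {A B C : Set ℝ} (hA : MeasurableSet A) (hB : MeasurableSet B)
    (hA0 : A.Nonempty) (hB0 : B.Nonempty) (h : ∀ a ∈ A, ∀ b ∈ B, a + b ∈ C) :
    volume A + volume B ≤ volume C := by
  have compact_case : ∀ K L : Set ℝ, IsCompact K → IsCompact L → K.Nonempty → L.Nonempty →
      K ⊆ A → L ⊆ B → volume K + volume L ≤ volume C := by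
    intro K L hK hL hK0 hL0 hKA hLB
    obtain ⟨k, hk⟩ := hK.exists_isGreatest hK0
    obtain ⟨l, hl⟩ := hL.exists_isLeast hL0
    have h1 : volume ((fun x => x + l) '' K) = volume K := by simp
    have h2 : volume ((fun x => k + x) '' L) = volume L := by simp
    -- With `k = max K` and `l = min L`, the translates `K + l` and `k + L` lie on either side of `k
    -- + l` and both lie in `C`.
    have hd : AEDisjoint volume ((fun x => x + l) '' K) ((fun x => k + x) '' L) := by
      refine measure_mono_null (t := {k + l}) ?_ (by simp)
      rintro _ ⟨⟨x, hx, rfl⟩, ⟨y, hy, hxy⟩⟩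
      have h3 := hk.2 hx
      have h4 := hl.2 hy
      simp only [Set.mem_singleton_iff] at *
      linarith
    have hm : MeasurableSet ((fun x => k + x) '' L) :=
      (hL.image (by fun_prop)).measurableSet
    rw [← h1, ← h2, ← measure_union₀ hm.nullMeasurableSet hd]
    refine measure_mono ?_
    rintro _ (⟨x, hx, rfl⟩ | ⟨x, hx, rfl⟩)
    · exact h _ (hKA hx) _ (hLB hl.1)
    · exact h _ (hKA hk.1) _ (hLB hx)
  obtain ⟨a, ha⟩ := hA0
  obtain ⟨b, hb⟩ := hB0
  rw [hA.measure_eq_iSup_isCompact, hB.measure_eq_iSup_isCompact]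
  simp only [iSup_and']
  refine ENNReal.biSup_add_biSup_le' ⟨∅, by simp⟩ ⟨∅, by simp⟩ ?_
  rintro K ⟨hKA, hK⟩ L ⟨hLB, hL⟩
  -- Inner approximations may be empty; inserting a fixed point of `A` and of `B` makes them
  -- nonempty.
  refine le_trans (add_le_add (measure_mono (Set.subset_insert a K))
    (measure_mono (Set.subset_insert b L))) ?_
  exact compact_case _ _ (hK.insert a) (hL.insert b) ⟨a, by simp⟩ ⟨b, by simp⟩
    (Set.insert_subset ha hKA) (Set.insert_subset hb hLB)

/-- Layer-cake formula plus Brunn–Minkowski for superlevel sets. Both suprema equal 1, so at each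
level `l < 1` both superlevel sets are nonempty and above 1 both are empty. The resulting
arithmetic-mean form implies the geometric-mean one. -/
theorem prekopaLeindler_normalized {t s : ℝ} (ht : 0 < t) (hs : 0 < s) (hts : t + s = 1)
    {u v w : ℝ → ℝ} (hu : Measurable u) (hv : Measurable v) (hw : Measurable w)
    (hu0 : ∀ x, 0 ≤ u x) (hv0 : ∀ x, 0 ≤ v x) (hw0 : ∀ x, 0 ≤ w x)
    (hu1 : ∀ x, u x ≤ 1) (hv1 : ∀ x, v x ≤ 1)
    (hu2 : ∀ l < 1, ∃ x, l < u x) (hv2 : ∀ l < 1, ∃ x, l < v x)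
    (h : ∀ x y, u x ^ t * v y ^ s ≤ w (t * x + s * y)) :
    ENNReal.ofReal t * (∫⁻ x, ENNReal.ofReal (u x)) +
        ENNReal.ofReal s * (∫⁻ x, ENNReal.ofReal (v x))
      ≤ ∫⁻ x, ENNReal.ofReal (w x) := by
  rw [lintegral_eq_lintegral_meas_lt _ (Eventually.of_forall hu0) hu.aemeasurable,
    lintegral_eq_lintegral_meas_lt _ (Eventually.of_forall hv0) hv.aemeasurable,
    lintegral_eq_lintegral_meas_lt _ (Eventually.of_forall hw0) hw.aemeasurable,
    ← lintegral_const_mul' _ _ ENNReal.ofReal_ne_top,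
    ← lintegral_const_mul' _ _ ENNReal.ofReal_ne_top]
  have hanti : Antitone fun l : ℝ => volume {a : ℝ | l < u a} := fun l l' hl =>
    measure_mono fun x (hx : l' < u x) => lt_of_le_of_lt hl hx
  rw [← lintegral_add_left (hanti.measurable.const_mul _)]
  refine setLIntegral_mono' measurableSet_Ioi fun l (hl : 0 < l) => ?_
  rcases lt_or_ge l 1 with hl1 | hl1
  · have e1 : ENNReal.ofReal t * volume {a : ℝ | l < u a} = volume (t • {a : ℝ | l < u a}) := by
      simp [Measure.addHaar_smul, abs_of_pos ht]
    have e2 : ENNReal.ofReal s * volume {a : ℝ | l < v a} = volume (s • {a : ℝ | l < v a}) := by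
      simp [Measure.addHaar_smul, abs_of_pos hs]
    rw [e1, e2]
    refine volume_add_volume_le ((measurableSet_lt measurable_const hu).const_smul₀ t)
      ((measurableSet_lt measurable_const hv).const_smul₀ s)
      (Set.Nonempty.smul_set (hu2 l hl1)) (Set.Nonempty.smul_set (hv2 l hl1)) ?_
    rintro _ ⟨x, hx, rfl⟩ _ ⟨y, hy, rfl⟩
    refine lt_of_lt_of_le ?_ (h x y)
    have hx' : l < u x := hx
    have hy' : l < v y := hy
    calc l = l ^ t * l ^ s := by rw [← Real.rpow_add hl, hts, Real.rpow_one]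
      _ < u x ^ t * v y ^ s :=
        mul_lt_mul'' (Real.rpow_lt_rpow hl.le hx' ht) (Real.rpow_lt_rpow hl.le hy' hs)
          (by positivity) (by positivity)
  · have e1 : {a : ℝ | l < u a} = ∅ := by
      ext x; simpa using (hu1 x).trans hl1
    have e2 : {a : ℝ | l < v a} = ∅ := by
      ext x; simpa using (hv1 x).trans hl1
    simp [e1, e2]

theorem ennreal_geom_mean_le {t s : ℝ} (ht : 0 < t) (hs : 0 < s) (hts : t + s = 1) (a b : ℝ≥0∞) :
    a ^ t * b ^ s ≤ ENNReal.ofReal t * a + ENNReal.ofReal s * b := by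
  have ht' : ENNReal.ofReal t ≠ 0 := by simpa using ht
  have hs' : ENNReal.ofReal s ≠ 0 := by simpa using hs
  rcases eq_or_ne a ⊤ with rfl | ha
  · simp [ENNReal.mul_top ht']
  rcases eq_or_ne b ⊤ with rfl | hb
  · simp [ENNReal.mul_top hs']
  lift a to NNReal using ha
  lift b to NNReal using hb
  have := NNReal.geom_mean_le_arith_mean2_weighted t.toNNReal s.toNNReal a b
    (by rw [← Real.toNNReal_add ht.le hs.le, hts, Real.toNNReal_one])
  rw [Real.coe_toNNReal _ ht.le, Real.coe_toNNReal _ hs.le] at this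
  rw [← ENNReal.coe_rpow_of_nonneg _ ht.le, ← ENNReal.coe_rpow_of_nonneg _ hs.le]
  rw [ENNReal.ofReal, ENNReal.ofReal]
  exact_mod_cast this

theorem ennreal_div_mul_div {a b c d : ℝ≥0∞} (hb : b ≠ ⊤) (hb0 : b ≠ 0) :
    a / b * (c / d) = a * c / (b * d) := by
  simp only [div_eq_mul_inv]
  rw [ENNReal.mul_inv (Or.inl hb0) (Or.inl hb), mul_mul_mul_comm]

/-- The Prékopa–Leindler inequality with weights `t, s`, as a property of a measure. -/
def PrekopaLeindler {E : Type*} [MeasurableSpace E] [AddCommGroup E] [Module ℝ E]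
    (m : Measure E) (t s : ℝ) : Prop :=
  ∀ u v w : E → ℝ≥0∞, Measurable u → Measurable v → Measurable w →
    (∀ x y, u x ^ t * v y ^ s ≤ w (t • x + s • y)) →
    (∫⁻ x, u x ∂m) ^ t * (∫⁻ x, v x ∂m) ^ s ≤ ∫⁻ x, w x ∂m

/-- Dividing `u`, `v`, `w` by `a`, `b`, `a^t b^s` reduces to suprema equal to 1, and the weighted
arithmetic–geometric mean inequality returns to products. Truncating `w` at `a^t b^s` keeps the
quotient finite and preserves the hypothesis. -/
theorem prekopaLeindler_of_bounded {t s : ℝ} (ht : 0 < t) (hs : 0 < s) (hts : t + s = 1)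
    {u v w : ℝ → ℝ≥0∞} (hu : Measurable u) (hv : Measurable v) (hw : Measurable w)
    {a b : ℝ≥0∞} (ha : ⨆ x, u x = a) (hb : ⨆ x, v x = b) (hat : a ≠ ⊤) (hbt : b ≠ ⊤)
    (h : ∀ x y, u x ^ t * v y ^ s ≤ w (t * x + s * y)) :
    (∫⁻ x, u x) ^ t * (∫⁻ x, v x) ^ s ≤ ∫⁻ x, w x := by
  rcases eq_or_ne a 0 with rfl | ha0
  · have : ∀ x, u x = 0 := by simpa using ha
    simp [this, ht]
  rcases eq_or_ne b 0 with rfl | hb0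
  · have : ∀ x, v x = 0 := by simpa using hb
    simp [this, hs]
  have hua : ∀ x, u x ≤ a := fun x => ha ▸ le_iSup u x
  have hvb : ∀ x, v x ≤ b := fun x => hb ▸ le_iSup v x
  set c := a ^ t * b ^ s with hc
  have hat' : a ^ t ≠ ⊤ := ENNReal.rpow_ne_top_of_nonneg ht.le hat
  have hbt' : b ^ s ≠ ⊤ := ENNReal.rpow_ne_top_of_nonneg hs.le hbt
  have hat0 : a ^ t ≠ 0 := by simp [ENNReal.rpow_eq_zero_iff, ha0, hat]
  have hbt0 : b ^ s ≠ 0 := by simp [ENNReal.rpow_eq_zero_iff, hb0, hbt]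
  have hct : c ≠ ⊤ := ENNReal.mul_ne_top hat' hbt'
  have hc0 : c ≠ 0 := mul_ne_zero hat0 hbt0
  have hle1 : ∀ {p q : ℝ≥0∞}, p ≤ q → p / q ≤ 1 := fun hpq =>
    ENNReal.div_le_of_le_mul (by simpa using hpq)
  have hnt : ∀ {p q : ℝ≥0∞}, p ≤ q → p / q ≠ ⊤ := fun hpq =>
    ne_top_of_le_ne_top ENNReal.one_ne_top (hle1 hpq)
  have hsup : ∀ (f : ℝ → ℝ≥0∞) (d : ℝ≥0∞), ⨆ x, f x = d → d ≠ 0 → d ≠ ⊤ →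
      ∀ l < (1 : ℝ), ∃ x, l < (f x / d).toReal := by
    intro f d hd hd0 hdt l hl
    have hfd : ∀ x, f x ≤ d := fun x => hd ▸ le_iSup f x
    have : ENNReal.ofReal l * d < ⨆ x, f x := by
      rw [hd]
      calc ENNReal.ofReal l * d < 1 * d :=
            ENNReal.mul_lt_mul_left hd0 hdt (by simpa using hl)
        _ = d := one_mul d
    obtain ⟨x, hx⟩ := lt_iSup_iff.1 this
    refine ⟨x, ?_⟩
    have h2 : ENNReal.ofReal l < f x / d := by
      rwa [ENNReal.lt_div_iff_mul_lt (Or.inl hd0) (Or.inl hdt)]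
    by_contra! h3
    refine absurd h2 (not_lt.2 ?_)
    rw [← ENNReal.ofReal_toReal (hnt (hfd x))]
    exact ENNReal.ofReal_le_ofReal h3
  have key := prekopaLeindler_normalized ht hs hts
    (u := fun x => (u x / a).toReal) (v := fun x => (v x / b).toReal)
    (w := fun x => (min (w x) c / c).toReal)
    (hu.div_const a).ennreal_toReal (hv.div_const b).ennreal_toReal
    ((hw.min measurable_const).div_const c).ennreal_toReal
    (fun _ => ENNReal.toReal_nonneg) (fun _ => ENNReal.toReal_nonneg)
    (fun _ => ENNReal.toReal_nonneg)
    (fun x => by simpa using ENNReal.toReal_mono ENNReal.one_ne_top (hle1 (hua x)))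
    (fun x => by simpa using ENNReal.toReal_mono ENNReal.one_ne_top (hle1 (hvb x)))
    (hsup u a ha ha0 hat) (hsup v b hb hb0 hbt) (fun x y => by
      rw [ENNReal.toReal_rpow, ENNReal.toReal_rpow, ← ENNReal.toReal_mul]
      refine ENNReal.toReal_mono (hnt (min_le_right _ _)) ?_
      rw [ENNReal.div_rpow_of_nonneg _ _ ht.le, ENNReal.div_rpow_of_nonneg _ _ hs.le,
        ennreal_div_mul_div hat' hat0]
      refine ENNReal.div_le_div_right (le_min (h x y) ?_) _
      exact mul_le_mul' (ENNReal.rpow_le_rpow (hua x) ht.le) (ENNReal.rpow_le_rpow (hvb y) hs.le))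
  simp only [ENNReal.ofReal_toReal (hnt (hua _)), ENNReal.ofReal_toReal (hnt (hvb _)),
    ENNReal.ofReal_toReal (hnt (min_le_right _ _))] at key
  have h3 := (ennreal_geom_mean_le ht hs hts _ _).trans key
  simp only [div_eq_mul_inv] at h3
  rw [lintegral_mul_const _ hu, lintegral_mul_const _ hv,
    lintegral_mul_const _ (hw.min measurable_const), ← div_eq_mul_inv, ← div_eq_mul_inv,
    ← div_eq_mul_inv, ENNReal.div_rpow_of_nonneg _ _ ht.le, ENNReal.div_rpow_of_nonneg _ _ hs.le,
    ennreal_div_mul_div hat' hat0] at h3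
  have h4 := (ENNReal.div_le_iff hc0 hct).1 h3
  rw [ENNReal.div_mul_cancel hc0 hct] at h4
  exact h4.trans (lintegral_mono fun x => min_le_left _ _)

theorem prekopaLeindler_real {t s : ℝ} (ht : 0 < t) (hs : 0 < s) (hts : t + s = 1) :
    PrekopaLeindler (volume : Measure ℝ) t s := by
  intro u v w hu hv hw h
  -- Monotone truncation `min f n` reduces to bounded functions.
  have lim : ∀ f : ℝ → ℝ≥0∞, Measurable f →
      ∫⁻ x, f x = ⨆ n : ℕ, ∫⁻ x, min (f x) n := by
    intro f hf
    rw [← lintegral_iSup (fun n => hf.min measurable_const)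
      (fun n m hnm x => min_le_min le_rfl (by exact_mod_cast hnm))]
    congr with x
    rw [← inf_iSup_eq, ENNReal.iSup_natCast]
    simp
  have pow_iSup : ∀ (f : ℕ → ℝ≥0∞) (r : ℝ), 0 < r → (⨆ n, f n) ^ r = ⨆ n, f n ^ r :=
    fun f r hr => (ENNReal.orderIsoRpow r hr).map_iSup f
  rw [lim u hu, lim v hv, pow_iSup _ _ ht, pow_iSup _ _ hs]
  simp only [ENNReal.iSup_mul, ENNReal.mul_iSup]
  refine iSup_le fun n => iSup_le fun k => ?_
  refine prekopaLeindler_of_bounded ht hs hts (hu.min measurable_const) (hv.min measurable_const)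
    hw rfl rfl
    (ne_top_of_le_ne_top (ENNReal.natCast_ne_top _) (iSup_le fun x => min_le_right _ _))
    (ne_top_of_le_ne_top (ENNReal.natCast_ne_top _) (iSup_le fun x => min_le_right _ _)) ?_
  intro x y
  refine le_trans ?_ (h x y)
  exact mul_le_mul' (ENNReal.rpow_le_rpow (min_le_left _ _) ht.le)
    (ENNReal.rpow_le_rpow (min_le_left _ _) hs.le)

/-- The inequality on the fibres is exactly the hypothesis of the inequality for the partial
integrals on the base. -/
theorem PrekopaLeindler.prod {E F : Type*} [MeasurableSpace E] [AddCommGroup E] [Module ℝ E]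
    [MeasurableSpace F] [AddCommGroup F] [Module ℝ F] {m : Measure E} {n : Measure F} [SFinite n]
    {t s : ℝ} (hm : PrekopaLeindler m t s) (hn : PrekopaLeindler n t s) :
    PrekopaLeindler (m.prod n) t s := by
  intro u v w hu hv hw h
  rw [lintegral_prod _ hu.aemeasurable, lintegral_prod _ hv.aemeasurable,
    lintegral_prod _ hw.aemeasurable]
  refine hm _ _ _ hu.lintegral_prod_right' hv.lintegral_prod_right' hw.lintegral_prod_right' ?_
  intro x y
  refine hn _ _ _ (hu.comp measurable_prodMk_left) (hv.comp measurable_prodMk_left)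
    (hw.comp measurable_prodMk_left) ?_
  intro x' y'
  exact h (x, x') (y, y')

theorem PrekopaLeindler.of_measurePreserving {E F : Type*} [MeasurableSpace E] [AddCommGroup E]
    [Module ℝ E] [MeasurableSpace F] [AddCommGroup F] [Module ℝ F] {m : Measure E} {n : Measure F}
    {t s : ℝ} (hm : PrekopaLeindler m t s) (e : E → F) (he : MeasurePreserving e m n)
    (hlin : ∀ x y, e (t • x + s • y) = t • e x + s • e y) :
    PrekopaLeindler n t s := by
  intro u v w hu hv hw h
  rw [← he.lintegral_comp hu, ← he.lintegral_comp hv, ← he.lintegral_comp hw]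
  refine hm _ _ _ (hu.comp he.measurable) (hv.comp he.measurable) (hw.comp he.measurable) ?_
  intro x y
  simpa only [Function.comp, hlin] using h (e x) (e y)

theorem prekopaLeindler_pi {t s : ℝ} (ht : 0 < t) (hs : 0 < s) (hts : t + s = 1) (n : ℕ) :
    PrekopaLeindler (volume : Measure (Fin n → ℝ)) t s := by
  induction n with
  | zero =>
    intro u v w hu hv hw h
    have e : ∀ f : (Fin 0 → ℝ) → ℝ≥0∞, ∫⁻ x, f x = f 0 := by
      intro f
      rw [volume_pi, Measure.pi_of_empty _ 0, lintegral_dirac]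
    rw [e, e, e]
    simpa using h 0 0
  | succ n ih =>
    refine ((prekopaLeindler_real ht hs hts).prod ih).of_measurePreserving
      (MeasurableEquiv.piFinSuccAbove (fun _ => ℝ) 0).symm
      (volume_preserving_piFinSuccAbove (fun _ => ℝ) 0).symm ?_
    intro x y
    ext i
    refine Fin.cases ?_ (fun j => ?_) i <;> simp [MeasurableEquiv.piFinSuccAbove]

/-- The Prékopa–Leindler inequality on `ℝ^N`. -/
theorem prekopaLeindler_space {t s : ℝ} (ht : 0 < t) (hs : 0 < s) (hts : t + s = 1) (N : ℕ) :
    PrekopaLeindler (volume : Measure (Space N)) t s :=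
  (prekopaLeindler_pi ht hs hts N).of_measurePreserving _ (PiLp.volume_preserving_toLp (Fin N))
    fun _ _ => rfl

end

/-! ### Logarithmic Sobolev inequality for strongly log-concave measures. -/

/-- Prékopa–Leindler is applied to the densities `e^{A-U}`, `e^{-U}`, `e^{W-U}`, normalized by the
same constant. Strong convexity of `U` pays for the quadratic term in the hypothesis, and the middle
density has integral 1. -/
theorem tilted_prekopaLeindler {N : ℕ} {U : Space N → ℝ} {κ : ℝ} (hU : Continuous U)
    (hint : Integrable fun x => Real.exp (-U x)) (hconv : StrongConvexOn Set.univ κ U)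
    {A W : Space N → ℝ} (hA : Continuous A) (hW : Continuous W) {t s : ℝ} (ht : 0 < t) (hs : 0 < s)
    (hts : t + s = 1)
    (h : ∀ x y, t * A x ≤ W (t • x + s • y) + t * s * (κ / 2 * ‖x - y‖ ^ 2)) :
    (∫⁻ x, ENNReal.ofReal (Real.exp (A x)) ∂(volume.tilted fun x => -U x)) ^ t
      ≤ ∫⁻ x, ENNReal.ofReal (Real.exp (W x)) ∂(volume.tilted fun x => -U x) := by
  set Z := ∫ x, Real.exp (-U x) with hZ
  have hZ0 : 0 < Z := integral_exp_pos hint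
  have e : ∀ B : Space N → ℝ,
      ∫⁻ x, ENNReal.ofReal (Real.exp (B x)) ∂(volume.tilted fun x => -U x)
        = ∫⁻ x, ENNReal.ofReal (Real.exp (B x - U x - Real.log Z)) := by
    intro B
    rw [lintegral_tilted]
    refine lintegral_congr fun x => ?_
    rw [← ENNReal.ofReal_mul (by positivity), Real.exp_sub, Real.exp_sub, Real.exp_log hZ0,
      Real.exp_neg, ← hZ]
    congr 1
    field_simp
  have hv : ∫⁻ x, ENNReal.ofReal (Real.exp ((0 : ℝ) - U x - Real.log Z)) = 1 := by
    have := isProbabilityMeasure_tilted (μ := (volume : Measure (Space N))) hint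
    rw [← e fun _ => 0]
    simp
  have pl := prekopaLeindler_space ht hs hts N
    (fun x => ENNReal.ofReal (Real.exp (A x - U x - Real.log Z)))
    (fun x => ENNReal.ofReal (Real.exp ((0 : ℝ) - U x - Real.log Z)))
    (fun x => ENNReal.ofReal (Real.exp (W x - U x - Real.log Z)))
    (by fun_prop) (by fun_prop) (by fun_prop) (by
      intro x y
      rw [ENNReal.ofReal_rpow_of_nonneg (by positivity) ht.le,
        ENNReal.ofReal_rpow_of_nonneg (by positivity) hs.le, ← ENNReal.ofReal_mul (by positivity),
        ← Real.exp_mul, ← Real.exp_mul, ← Real.exp_add]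
      refine ENNReal.ofReal_le_ofReal (Real.exp_le_exp.2 ?_)
      have h1 := hconv.2 (Set.mem_univ x) (Set.mem_univ y) ht.le hs.le hts
      have h2 := h x y
      simp only [smul_eq_mul] at h1
      have : (1 : ℝ) * Real.log Z = (t + s) * Real.log Z := by rw [hts]
      nlinarith)
  rw [hv, ENNReal.one_rpow, mul_one] at pl
  rw [e, e]
  exact pl

/-- Entropy bound for exponentials under a strongly log-concave measure. -/
theorem tilted_entropy_exp_le {N : ℕ} {U : Space N → ℝ} {κ : ℝ} (hκ : 0 < κ) (hU : Continuous U)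
    (hint : Integrable fun x => Real.exp (-U x)) (hconv : StrongConvexOn Set.univ κ U)
    {g D : Space N → ℝ} (hg : Continuous g) (hD : Continuous D) {B M : ℝ}
    (hgB : ∀ x, |g x| ≤ B) (hD0 : ∀ x, 0 ≤ D x) (hDB : ∀ x, D x ≤ B)
    (hgD : ∀ x y, g (x + y) ≤ g x + D x * ‖y‖ + M * ‖y‖ ^ 2) :
    (∫ x, Real.exp (g x) * g x ∂(volume.tilted fun x => -U x))
      - (∫ x, Real.exp (g x) ∂(volume.tilted fun x => -U x))
        * Real.log (∫ x, Real.exp (g x) ∂(volume.tilted fun x => -U x))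
      ≤ 1 / (2 * κ) * ∫ x, D x ^ 2 * Real.exp (g x) ∂(volume.tilted fun x => -U x) := by
  set m := volume.tilted fun x => -U x with hm
  have : IsProbabilityMeasure m := isProbabilityMeasure_tilted hint
  have hB : 0 ≤ B := (abs_nonneg _).trans (hgB 0)
  have ibdd : ∀ {f : Space N → ℝ} (C : ℝ), Continuous f → (∀ x, |f x| ≤ C) → Integrable f m :=
    fun C hf hC => Integrable.of_bound hf.aestronglyMeasurable C (Eventually.of_forall hC)
  have hexpB : ∀ x, |Real.exp (g x)| ≤ Real.exp B := fun x => by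
    rw [abs_of_pos (Real.exp_pos _)]
    exact Real.exp_le_exp.2 ((le_abs_self _).trans (hgB x))
  have i1 : Integrable (fun x => Real.exp (g x)) m := ibdd _ (by fun_prop) hexpB
  have i2 : Integrable (fun x => Real.exp (g x) * g x) m :=
    ibdd (Real.exp B * B) (by fun_prop) fun x => by
      rw [abs_mul]; exact mul_le_mul (hexpB x) (hgB x) (abs_nonneg _) (by positivity)
  have hD2 : ∀ x, D x ^ 2 ≤ B ^ 2 := fun x => pow_le_pow_left₀ (hD0 x) (hDB x) 2
  have i3 : Integrable (fun x => D x ^ 2 * Real.exp (g x)) m :=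
    ibdd (B ^ 2 * Real.exp B) (by fun_prop) fun x => by
      rw [abs_mul, abs_of_nonneg (sq_nonneg _)]
      exact mul_le_mul (hD2 x) (hexpB x) (abs_nonneg _) (by positivity)
  set Z := ∫ x, Real.exp (g x) ∂m with hZ
  have hZ0 : 0 < Z := integral_exp_pos i1
  set I := ∫ x, Real.exp (g x) * g x ∂m with hI
  set J := ∫ x, D x ^ 2 * Real.exp (g x) ∂m with hJ
  -- The weights are `1 - s` and `s`; the excess over `Z` of both sides of Prékopa–Leindler is of
  -- order `s`, and the entropy is the coefficient on the left.
  have key : ∀ s : ℝ, 0 < s → s < 1 → 0 < κ * (1 - s) - 2 * M * s →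
      I - Z * Real.log Z ≤ Real.exp (s * (B ^ 2 / (2 * (κ * (1 - s) - 2 * M * s))))
        / (2 * (κ * (1 - s) - 2 * M * s)) * J := by
    intro s hs hs1 hden
    set t := 1 - s with ht
    have ht0 : 0 < t := by linarith
    set d := κ * t - 2 * M * s with hd
    -- Jensen's inequality for the probability density `e^g / Z`, in the form of the tangent-line
    -- bound `1 + y ≤ e^y`.
    have hlow : Z * Real.exp (s * (I / Z - Real.log Z)) ≤
        (∫ x, Real.exp (g x / t) ∂m) ^ t := by
      have h1 : Real.exp ((1 / t - 1) * (I / Z)) * Z ≤ ∫ x, Real.exp (g x / t) ∂m := by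
        have i4 : Integrable (fun x =>
            (1 / t - 1) * (Real.exp (g x) * g x - I / Z * Real.exp (g x))) m :=
          (i2.sub (i1.const_mul _)).const_mul _
        have e1 : Real.exp ((1 / t - 1) * (I / Z)) * Z = ∫ x, Real.exp ((1 / t - 1) * (I / Z)) *
            (Real.exp (g x) + (1 / t - 1) * (Real.exp (g x) * g x - I / Z * Real.exp (g x))) ∂m := by
          rw [integral_const_mul, integral_add i1 i4,
            integral_const_mul, integral_sub i2 (i1.const_mul _), integral_const_mul, ← hZ, ← hI]
          field_simp
          ring
        rw [e1]
        refine integral_mono ?_ ?_ fun x => ?_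
        · exact (i1.add i4).const_mul _
        · refine ibdd (Real.exp (B / t)) (by fun_prop) fun x => ?_
          rw [abs_of_pos (Real.exp_pos _)]
          refine Real.exp_le_exp.2 ?_
          gcongr
          exact (le_abs_self _).trans (hgB x)
        · have e2 : g x / t = (1 / t - 1) * (I / Z) + g x + (1 / t - 1) * (g x - I / Z) := by
            field_simp
            ring
          simp only
          rw [e2, Real.exp_add, Real.exp_add]
          have h3 := Real.add_one_le_exp ((1 / t - 1) * (g x - I / Z))
          calc Real.exp ((1 / t - 1) * (I / Z)) *
            (Real.exp (g x) + (1 / t - 1) * (Real.exp (g x) * g x - I / Z * Real.exp (g x)))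
              = Real.exp ((1 / t - 1) * (I / Z)) * Real.exp (g x) *
                ((1 / t - 1) * (g x - I / Z) + 1) := by ring
            _ ≤ _ := by gcongr
      have h2 := Real.rpow_le_rpow (by positivity) h1 ht0.le
      refine le_trans (le_of_eq ?_) h2
      rw [Real.mul_rpow (by positivity) hZ0.le, ← Real.exp_mul, Real.rpow_def_of_pos hZ0]
      nth_rewrite 1 [← Real.exp_log hZ0]
      rw [← Real.exp_add, ← Real.exp_add]
      congr 1
      field_simp
      rw [ht]
      ring
    -- With `n = ‖x - y‖`, the excess `s D n + M s² n²` must be at most `s k + t s κ n²/2`. The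
    -- choice `d = κ t - 2 M s` makes this the inequality `D n ≤ D²/(2d) + d n²/2`.
    set k : Space N → ℝ := fun x => D x ^ 2 / (2 * d) with hk
    have hk0 : ∀ x, 0 ≤ k x := fun x => by positivity
    have hkB : ∀ x, k x ≤ B ^ 2 / (2 * d) := fun x => by
      exact div_le_div_of_nonneg_right (hD2 x) (by positivity)
    have hkc : Continuous k := by fun_prop
    have hW : Continuous fun x => g x + s * k x := by fun_prop
    have iW : Integrable (fun x => Real.exp (g x + s * k x)) m := by
      refine ibdd (Real.exp (B + s * (B ^ 2 / (2 * d)))) (by fun_prop) fun x => ?_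
      rw [abs_of_pos (Real.exp_pos _)]
      refine Real.exp_le_exp.2 (add_le_add ((le_abs_self _).trans (hgB x)) ?_)
      exact mul_le_mul_of_nonneg_left (hkB x) hs.le
    have iA : Integrable (fun x => Real.exp (g x / t)) m := by
      refine ibdd (Real.exp (B / t)) (by fun_prop) fun x => ?_
      rw [abs_of_pos (Real.exp_pos _)]
      refine Real.exp_le_exp.2 ?_
      gcongr
      exact (le_abs_self _).trans (hgB x)
    have hPL : (∫ x, Real.exp (g x / t) ∂m) ^ t ≤ ∫ x, Real.exp (g x + s * k x) ∂m := by
      have := tilted_prekopaLeindler hU hint hconv (A := fun x => g x / t)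
        (W := fun x => g x + s * k x) (by fun_prop) hW ht0 hs (by simp [ht]) (by
          intro x y
          have hx : x = (t • x + s • y) + s • (x - y) := by
            rw [ht]; module
          have h1 := hgD (t • x + s • y) (s • (x - y))
          rw [← hx, norm_smul, Real.norm_of_nonneg hs.le] at h1
          rw [mul_div_cancel₀ _ ht0.ne']
          refine h1.trans ?_
          simp only [hk]
          set n := ‖x - y‖
          set q := D (t • x + s • y)
          have h2 : 0 ≤ (q - d * n) ^ 2 / (2 * d) * s := by positivity
          have h3 : (q - d * n) ^ 2 / (2 * d) * s = s * (q ^ 2 / (2 * d)) - q * (s * n)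
              + d * n ^ 2 / 2 * s := by
            field_simp
            ring
          rw [h3, hd] at h2
          rw [hd]
          nlinarith)
      rw [← ofReal_integral_eq_lintegral_ofReal iA (Eventually.of_forall fun x => (Real.exp_pos _).le),
        ← ofReal_integral_eq_lintegral_ofReal iW (Eventually.of_forall fun x => (Real.exp_pos _).le),
        ENNReal.ofReal_rpow_of_nonneg (integral_exp_pos iA).le ht0.le] at this
      exact (ENNReal.ofReal_le_ofReal_iff (integral_exp_pos iW).le).1 this
    have hup : ∫ x, Real.exp (g x + s * k x) ∂m
        ≤ Z + s * (Real.exp (s * (B ^ 2 / (2 * d))) / (2 * d) * J) := by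
      have : Z + s * (Real.exp (s * (B ^ 2 / (2 * d))) / (2 * d) * J) = ∫ x, (Real.exp (g x) +
          s * (Real.exp (s * (B ^ 2 / (2 * d))) / (2 * d)) * (D x ^ 2 * Real.exp (g x))) ∂m := by
        rw [integral_add i1 (i3.const_mul _), integral_const_mul]
        ring
      rw [this]
      refine integral_mono iW (i1.add (i3.const_mul _)) fun x => ?_
      have h1 : Real.exp (s * k x) ≤ 1 + s * k x * Real.exp (s * k x) := by
        have := Real.add_one_le_exp (-(s * k x))
        have h2 : Real.exp (-(s * k x)) * Real.exp (s * k x) = 1 := by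
          rw [← Real.exp_add]; simp
        nlinarith [Real.exp_pos (s * k x)]
      have h2 : Real.exp (s * k x) ≤ Real.exp (s * (B ^ 2 / (2 * d))) :=
        Real.exp_le_exp.2 (mul_le_mul_of_nonneg_left (hkB x) hs.le)
      calc Real.exp (g x + s * k x) = Real.exp (g x) * Real.exp (s * k x) := Real.exp_add _ _
        _ ≤ Real.exp (g x) * (1 + s * k x * Real.exp (s * k x)) := by gcongr
        _ ≤ Real.exp (g x) * (1 + s * k x * Real.exp (s * (B ^ 2 / (2 * d)))) := by
          have := hk0 x
          gcongr
        _ = _ := by simp only [hk]; ring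
    have h5 := (hlow.trans hPL).trans hup
    have h6 := Real.add_one_le_exp (s * (I / Z - Real.log Z))
    have h7 : Z * (s * (I / Z - Real.log Z) + 1) ≤ Z * Real.exp (s * (I / Z - Real.log Z)) := by
      gcongr
    have h8 : Z * (s * (I / Z - Real.log Z) + 1) = s * (I - Z * Real.log Z) + Z := by
      field_simp
    have h9 : s * (I - Z * Real.log Z) ≤ s * (Real.exp (s * (B ^ 2 / (2 * d))) / (2 * d) * J) := by
      linarith
    exact le_of_mul_le_mul_left h9 hs
  -- As `s → 0` the Taylor remainder `M` disappears and the sharp constant `1/(2κ)` remains.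
  have lim : Tendsto (fun s : ℝ => Real.exp (s * (B ^ 2 / (2 * (κ * (1 - s) - 2 * M * s))))
        / (2 * (κ * (1 - s) - 2 * M * s)) * J) (𝓝[>] 0) (𝓝 (1 / (2 * κ) * J)) := by
    have hc : ContinuousAt (fun s : ℝ => Real.exp (s * (B ^ 2 / (2 * (κ * (1 - s) - 2 * M * s))))
        / (2 * (κ * (1 - s) - 2 * M * s)) * J) 0 := by
      have : 2 * (κ * (1 - (0 : ℝ)) - 2 * M * 0) ≠ 0 := by simp [hκ.ne']
      fun_prop (disch := assumption)
    have := hc.tendsto.mono_left (nhdsWithin_le_nhds (s := Set.Ioi 0))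
    simpa using this
  refine ge_of_tendsto lim ?_
  have hden : ∀ᶠ s : ℝ in 𝓝[>] 0, 0 < κ * (1 - s) - 2 * M * s := by
    have hc : ContinuousAt (fun s : ℝ => κ * (1 - s) - 2 * M * s) 0 := by fun_prop
    exact (hc.eventually_const_lt (by simpa using hκ)).filter_mono nhdsWithin_le_nhds
  have h1 : ∀ᶠ s : ℝ in 𝓝[>] 0, s < 1 :=
    (eventually_lt_nhds one_pos).filter_mono nhdsWithin_le_nhds
  filter_upwards [hden, h1, self_mem_nhdsWithin] with s h2 h3 h4
  exact key s h4 h3 h2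

/-- Compact support of the derivative makes it globally Lipschitz; the mean value inequality on the
segment then gives the remainder. -/
theorem exists_quadratic_bound {N : ℕ} {g : Space N → ℝ} (hg : ContDiff ℝ ∞ g)
    (hc : HasCompactSupport (fderiv ℝ g)) :
    ∃ M : ℝ, ∀ x y, g (x + y) ≤ g x + ‖fderiv ℝ g x‖ * ‖y‖ + M * ‖y‖ ^ 2 := by
  obtain ⟨C, hC⟩ := ((hg.of_le (ENat.LEInfty.out : (2 : WithTop ℕ∞) ≤ ∞)).fderiv_right (m := 1)
    (by norm_num)).lipschitzWith_of_hasCompactSupport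
    hc one_ne_zero
  refine ⟨C, fun x y => ?_⟩
  have h1 : ‖g (x + y) - g x - fderiv ℝ g x (x + y - x)‖ ≤ C * ‖y‖ * ‖x + y - x‖ := by
    refine Convex.norm_image_sub_le_of_norm_fderiv_le' (𝕜 := ℝ) (s := segment ℝ x (x + y))
      (fun z _ => (hg.differentiable (by simp)) z) (fun z hz => ?_) (convex_segment _ _)
      (left_mem_segment ..) (right_mem_segment ..)
    refine (hC.norm_sub_le z x).trans ?_
    gcongr
    have := norm_sub_le_of_mem_segment hz
    simpa using this
  rw [add_sub_cancel_left] at h1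
  have h2 := (le_abs_self _).trans h1
  have h3 := (le_abs_self _).trans ((fderiv ℝ g x).le_opNorm y)
  nlinarith

/-- Bakry–Émery: a strongly log-concave probability measure satisfies the logarithmic Sobolev
inequality on test functions. -/
theorem tilted_logSobolev {N : ℕ} {U : Space N → ℝ} {κ : ℝ} (hκ : 0 < κ) (hU : Continuous U)
    (hint : Integrable fun x => Real.exp (-U x)) (hconv : StrongConvexOn Set.univ κ U)
    {f : Space N → ℝ} (hf : ContDiff ℝ ∞ f) (hfc : HasCompactSupport f) :
    entropy (volume.tilted fun x => -U x) (fun x => f x ^ 2)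
      ≤ 2 / κ * ∫ x, ‖fderiv ℝ f x‖ ^ 2 ∂(volume.tilted fun x => -U x) := by
  set m := volume.tilted fun x => -U x with hm
  have : IsProbabilityMeasure m := isProbabilityMeasure_tilted hint
  obtain ⟨C, hC⟩ := hfc.exists_bound_of_continuous hf.continuous
  obtain ⟨C', hC'⟩ := (hfc.fderiv ℝ).exists_bound_of_continuous (hf.continuous_fderiv (by simp))
  have hfcont := hf.continuous
  have hC0 : 0 ≤ C := (norm_nonneg _).trans (hC 0)
  have hfdc : Continuous (fderiv ℝ f) := hf.continuous_fderiv (by simp)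
  have step : ∀ η : ℝ, 0 < η →
      entropy m (fun x => f x ^ 2 + η) ≤ 2 / κ * ∫ x, ‖fderiv ℝ f x‖ ^ 2 ∂m := by
    intro η hη
    have hpos : ∀ x, 0 < f x ^ 2 + η := fun x => by positivity
    -- The regularization `η` keeps the logarithm smooth and bounded. Then `‖∇g‖² e^g = 4 f²
    -- ‖∇f‖²/(f² + η) ≤ 4 ‖∇f‖²`, which turns `1/(2κ)` into `2/κ`.
    set g : Space N → ℝ := fun x => Real.log (f x ^ 2 + η) with hg
    have hgs : ContDiff ℝ ∞ g := ((hf.pow 2).add contDiff_const).log fun x => (hpos x).ne'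
    have hfd : ∀ x, fderiv ℝ g x = (2 * f x / (f x ^ 2 + η)) • fderiv ℝ f x := by
      intro x
      have h1 : HasFDerivAt f (fderiv ℝ f x) x := (hf.differentiable (by simp) x).hasFDerivAt
      have h2 := (((h1.pow 2).add_const η).log (hpos x).ne').fderiv
      simp only [hg]
      rw [h2]
      ext v
      simp
      ring
    have hgc : HasCompactSupport (fderiv ℝ g) := by
      refine HasCompactSupport.mono hfc ?_
      intro x hx
      simp only [Function.mem_support, hfd] at hx ⊢
      rintro h0
      simp [h0] at hx
    obtain ⟨M, hquad⟩ := exists_quadratic_bound hgs hgc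
    obtain ⟨B1, hB1⟩ := hgc.exists_bound_of_continuous (hgs.continuous_fderiv (by simp))
    set B2 := |Real.log η| + |Real.log (C ^ 2 + η)| with hB2
    have hgB : ∀ x, |g x| ≤ B2 := by
      intro x
      have h1 : Real.log η ≤ g x := Real.log_le_log hη (by nlinarith [sq_nonneg (f x)])
      have h2 : g x ≤ Real.log (C ^ 2 + η) := by
        refine Real.log_le_log (hpos x) ?_
        have := sq_le_sq' (neg_le_of_abs_le (hC x)) (le_of_abs_le (hC x))
        linarith
      rw [abs_le]
      constructor
      · linarith [neg_abs_le (Real.log η), abs_nonneg (Real.log (C ^ 2 + η))]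
      · linarith [le_abs_self (Real.log (C ^ 2 + η)), abs_nonneg (Real.log η)]
    have key := tilted_entropy_exp_le (B := max B1 B2) hκ hU hint hconv hgs.continuous
      (D := fun x => ‖fderiv ℝ g x‖) (hgs.continuous_fderiv (by simp)).norm
      (fun x => (hgB x).trans (le_max_right _ _)) (fun _ => norm_nonneg _)
      (fun x => (hB1 x).trans (le_max_left _ _)) hquad
    rw [← hm] at key
    have eexp : ∀ x, Real.exp (g x) = f x ^ 2 + η := fun x => Real.exp_log (hpos x)
    simp only [eexp] at key
    unfold entropy
    refine key.trans ?_
    rw [← integral_const_mul, ← integral_const_mul]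
    refine integral_mono_of_nonneg (Eventually.of_forall fun x => ?_) ?_
      (Eventually.of_forall fun x => ?_)
    · have := (hpos x).le
      exact mul_nonneg (by positivity) (mul_nonneg (sq_nonneg _) this)
    · refine (Integrable.of_bound (hfdc.norm.pow 2).aestronglyMeasurable (C' ^ 2)
        (Eventually.of_forall fun x => ?_)).const_mul _
      rw [Pi.pow_apply, norm_pow, norm_norm]
      exact pow_le_pow_left₀ (norm_nonneg _) (hC' x) 2
    · simp only
      rw [hfd, norm_smul, Real.norm_eq_abs, mul_pow, sq_abs]
      have h1 := hpos x
      have h2 : (2 * f x / (f x ^ 2 + η)) ^ 2 * (f x ^ 2 + η) ≤ 4 := by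
        have : (2 * f x / (f x ^ 2 + η)) ^ 2 * (f x ^ 2 + η) = 4 * f x ^ 2 / (f x ^ 2 + η) := by
          field_simp
          ring
        rw [this, div_le_iff₀ h1]
        nlinarith
      calc 1 / (2 * κ) * ((2 * f x / (f x ^ 2 + η)) ^ 2 * ‖fderiv ℝ f x‖ ^ 2 * (f x ^ 2 + η))
          = 1 / (2 * κ) * ((2 * f x / (f x ^ 2 + η)) ^ 2 * (f x ^ 2 + η)) * ‖fderiv ℝ f x‖ ^ 2 := by
            ring
        _ ≤ 1 / (2 * κ) * 4 * ‖fderiv ℝ f x‖ ^ 2 := by gcongr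
        _ = _ := by field_simp; ring
  have hlim : Tendsto (fun η : ℝ => entropy m (fun x => f x ^ 2 + η)) (𝓝[>] 0)
      (𝓝 (entropy m (fun x => f x ^ 2))) := by
    have hbd : ∀ᶠ η : ℝ in 𝓝[>] 0, ∀ x, f x ^ 2 + η ∈ Set.Icc 0 (C ^ 2 + 1) := by
      have h1 : ∀ᶠ η : ℝ in 𝓝[>] 0, η < 1 :=
        (eventually_lt_nhds one_pos).filter_mono nhdsWithin_le_nhds
      filter_upwards [h1, self_mem_nhdsWithin] with η h2 (h3 : 0 < η) x
      have := sq_le_sq' (neg_le_of_abs_le (hC x)) (le_of_abs_le (hC x))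
      exact ⟨by positivity, by linarith⟩
    have l0 : ∀ x, Tendsto (fun η : ℝ => f x ^ 2 + η) (𝓝[>] 0) (𝓝 (f x ^ 2)) := fun x => by
      have : Tendsto (fun η : ℝ => f x ^ 2 + η) (𝓝 0) (𝓝 (f x ^ 2 + 0)) :=
        tendsto_const_nhds.add tendsto_id
      rw [add_zero] at this
      exact this.mono_left nhdsWithin_le_nhds
    have l1 : Tendsto (fun η : ℝ => ∫ x, (f x ^ 2 + η) ∂m) (𝓝[>] 0) (𝓝 (∫ x, f x ^ 2 ∂m)) := by
      refine tendsto_integral_filter_of_dominated_convergence (fun _ => C ^ 2 + 1)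
        (Eventually.of_forall fun η => by fun_prop) ?_ (integrable_const _)
        (Eventually.of_forall l0)
      filter_upwards [hbd] with η h1
      refine Eventually.of_forall fun x => ?_
      rw [Real.norm_of_nonneg (h1 x).1]
      exact (h1 x).2
    obtain ⟨K, hK⟩ := isCompact_Icc.exists_bound_of_continuousOn
      (s := Set.Icc 0 (C ^ 2 + 1)) Real.continuous_mul_log.continuousOn
    have l2 : Tendsto (fun η : ℝ => ∫ x, (f x ^ 2 + η) * Real.log (f x ^ 2 + η) ∂m) (𝓝[>] 0)
        (𝓝 (∫ x, f x ^ 2 * Real.log (f x ^ 2) ∂m)) := by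
      refine tendsto_integral_filter_of_dominated_convergence (fun _ => K)
        (Eventually.of_forall fun η => ?_) ?_ (integrable_const _)
        (Eventually.of_forall fun x => (Real.continuous_mul_log.tendsto _).comp (l0 x))
      · exact (Real.continuous_mul_log.comp
          ((hfcont.pow 2).add continuous_const)).aestronglyMeasurable
      filter_upwards [hbd] with η h1
      exact Eventually.of_forall fun x => hK _ (h1 x)
    unfold entropy
    exact l2.sub ((Real.continuous_mul_log.tendsto _).comp l1)
  refine le_of_tendsto hlim ?_
  filter_upwards [self_mem_nhdsWithin] with η hη
  exact step η hη

/-! ### Variational formula and lower semicontinuity of the entropy; Holley–Stroock perturbation. -/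

section

/-- The nonnegative integrand `y log (y / t) - y + t` whose integral computes the entropy. -/
noncomputable def entropyIntegrand (t y : ℝ) : ℝ := y * Real.log y - y * Real.log t - y + t

theorem entropyIntegrand_nonneg {t y : ℝ} (ht : 0 < t) (hy : 0 ≤ y) : 0 ≤ entropyIntegrand t y := by
  rcases hy.eq_or_lt with rfl | hy
  · simpa [entropyIntegrand] using ht.le
  · have h1 := Real.log_le_sub_one_of_pos (div_pos ht hy)
    rw [Real.log_div ht.ne' hy.ne'] at h1
    have h2 := mul_le_mul_of_nonneg_left h1 hy.le
    have h3 : y * (t / y - 1) = t - y := by field_simp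
    unfold entropyIntegrand
    nlinarith

theorem continuous_entropyIntegrand (t : ℝ) : Continuous (entropyIntegrand t) := by
  unfold entropyIntegrand
  have := Real.continuous_mul_log
  fun_prop

theorem tendsto_entropyIntegrand {t : ℝ} (ht : 0 < t) {u v : ℕ → ℝ} {y : ℝ}
    (hu : Tendsto u atTop (𝓝 t)) (hv : Tendsto v atTop (𝓝 y)) :
    Tendsto (fun n => entropyIntegrand (u n) (v n)) atTop (𝓝 (entropyIntegrand t y)) := by
  unfold entropyIntegrand
  exact ((((Real.continuous_mul_log.tendsto y).comp hv).sub
    (hv.mul (hu.log ht.ne'))).sub hv).add hu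

variable {N : ℕ} {m : Measure (Space N)}

theorem integrable_entropyIntegrand [IsFiniteMeasure m] {g : Space N → ℝ} (hg : Integrable g m)
    (hgl : Integrable (fun x => g x * Real.log (g x)) m) (t : ℝ) :
    Integrable (fun x => entropyIntegrand t (g x)) m :=
  ((hgl.sub (hg.mul_const _)).sub hg).add (integrable_const t)

/-- The extra term is nonnegative for nonnegative `g` and `t > 0`, and vanishes when `t` is the
mean. Hence the entropy is a minimum over trial values `t > 0` of integrals of nonnegative functions
when the mean is positive; this is what makes Fatou and comparison of measures applicable. -/
theorem integral_entropyIntegrand [IsProbabilityMeasure m] {g : Space N → ℝ} (hg : Integrable g m)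
    (hgl : Integrable (fun x => g x * Real.log (g x)) m) (t : ℝ) :
    ∫ x, entropyIntegrand t (g x) ∂m = entropy m g + entropyIntegrand t (∫ x, g x ∂m) := by
  have i1 : Integrable (fun x => g x * Real.log (g x) - g x * Real.log t) m :=
    hgl.sub (hg.mul_const _)
  have i2 : Integrable (fun x => g x * Real.log (g x) - g x * Real.log t - g x) m := i1.sub hg
  unfold entropyIntegrand entropy
  rw [integral_add i2 (integrable_const t), integral_sub i1 hg, integral_sub hgl (hg.mul_const _),
    integral_mul_const]
  simp
  ring

theorem entropy_eq_integral [IsProbabilityMeasure m] {g : Space N → ℝ} (hg : Integrable g m)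
    (hgl : Integrable (fun x => g x * Real.log (g x)) m) :
    entropy m g = ∫ x, entropyIntegrand (∫ x, g x ∂m) (g x) ∂m := by
  rw [integral_entropyIntegrand hg hgl]
  simp [entropyIntegrand]

theorem entropy_le_integral [IsProbabilityMeasure m] {g : Space N → ℝ} (hg0 : ∀ x, 0 ≤ g x)
    (hg : Integrable g m) (hgl : Integrable (fun x => g x * Real.log (g x)) m) {t : ℝ}
    (ht : 0 < t) : entropy m g ≤ ∫ x, entropyIntegrand t (g x) ∂m := by
  rw [integral_entropyIntegrand hg hgl]
  linarith [entropyIntegrand_nonneg ht (integral_nonneg (μ := m) hg0)]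

theorem entropy_eq_zero {g : Space N → ℝ} (hg0 : ∀ x, 0 ≤ g x) (hg : Integrable g m)
    (h : ∫ x, g x ∂m = 0) :
    Integrable (fun x => g x * Real.log (g x)) m ∧ entropy m g = 0 := by
  have h1 := (integral_eq_zero_iff_of_nonneg hg0 hg).1 h
  have h2 : (fun x => g x * Real.log (g x)) =ᵐ[m] fun _ => 0 := by
    filter_upwards [h1] with x hx
    simp [hx]
  refine ⟨(integrable_congr h2).2 (integrable_zero _ _ _), ?_⟩
  unfold entropy
  rw [integral_congr_ae h2, h]
  simp

theorem entropy_nonneg [IsProbabilityMeasure m] {g : Space N → ℝ} (hg0 : ∀ x, 0 ≤ g x)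
    (hg : Integrable g m) (hgl : Integrable (fun x => g x * Real.log (g x)) m) :
    0 ≤ entropy m g := by
  have h0 : 0 ≤ ∫ x, g x ∂m := integral_nonneg hg0
  rcases h0.eq_or_lt with h | h
  · exact (entropy_eq_zero hg0 hg h.symm).2.ge
  · rw [entropy_eq_integral hg hgl]
    exact integral_nonneg fun x => entropyIntegrand_nonneg h (hg0 x)

theorem integrable_mul_log_of_entropyIntegrand [IsFiniteMeasure m] {g : Space N → ℝ}
    (hg : Integrable g m) {t : ℝ} (h : Integrable (fun x => entropyIntegrand t (g x)) m) :
    Integrable (fun x => g x * Real.log (g x)) m := by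
  have := ((h.sub (integrable_const t)).add hg).add (hg.mul_const (Real.log t))
  refine this.congr (Eventually.of_forall fun x => ?_)
  simp only [Pi.add_apply, Pi.sub_apply, entropyIntegrand]
  ring

/-- A Fatou lemma for real integrals of nonnegative functions. -/
theorem integrable_and_integral_le_of_tendsto {α : Type*} [MeasurableSpace α] {ν : Measure α}
    {F : ℕ → α → ℝ} {f : α → ℝ}
    (hF : ∀ᶠ n in atTop, Integrable (F n) ν ∧ ∀ x, 0 ≤ F n x)
    (hf0 : ∀ x, 0 ≤ f x) (hfm : AEStronglyMeasurable f ν)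
    (hlim : ∀ᵐ x ∂ν, Tendsto (fun n => F n x) atTop (𝓝 (f x))) {K : ℕ → ℝ} {k : ℝ}
    (hK : ∀ᶠ n in atTop, ∫ x, F n x ∂ν ≤ K n) (hKk : Tendsto K atTop (𝓝 k)) :
    Integrable f ν ∧ ∫ x, f x ∂ν ≤ k := by
  have hk0 : 0 ≤ k := by
    refine ge_of_tendsto hKk ?_
    filter_upwards [hF, hK] with n h1 h2
    exact (integral_nonneg h1.2).trans h2
  obtain ⟨n0, hn0⟩ := eventually_atTop.1 (hF.and hK)
  have hle : ∫⁻ x, ENNReal.ofReal (f x) ∂ν ≤ ENNReal.ofReal k := by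
    calc ∫⁻ x, ENNReal.ofReal (f x) ∂ν
        = ∫⁻ x, liminf (fun n => ENNReal.ofReal (F (n + n0) x)) atTop ∂ν := by
          refine lintegral_congr_ae ?_
          filter_upwards [hlim] with x hx
          exact ((ENNReal.continuous_ofReal.tendsto _).comp
            (hx.comp (tendsto_add_atTop_nat n0))).liminf_eq.symm
      _ ≤ liminf (fun n => ∫⁻ x, ENNReal.ofReal (F (n + n0) x) ∂ν) atTop :=
          lintegral_liminf_le' fun n =>
            (hn0 (n + n0) (by omega)).1.1.aestronglyMeasurable.aemeasurable.ennreal_ofReal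
      _ ≤ liminf (fun n => ENNReal.ofReal (K (n + n0))) atTop := by
          refine liminf_le_liminf (Eventually.of_forall fun n => ?_)
          have h := hn0 (n + n0) (by omega)
          rw [← ofReal_integral_eq_lintegral_ofReal h.1.1 (Eventually.of_forall h.1.2)]
          exact ENNReal.ofReal_le_ofReal h.2
      _ = ENNReal.ofReal k := ((ENNReal.continuous_ofReal.tendsto _).comp
            (hKk.comp (tendsto_add_atTop_nat n0))).liminf_eq
  have hint : Integrable f ν := by
    refine ⟨hfm, ?_⟩
    rw [hasFiniteIntegral_iff_ofReal (Eventually.of_forall hf0)]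
    exact hle.trans_lt ENNReal.ofReal_lt_top
  refine ⟨hint, ?_⟩
  rw [← ofReal_integral_eq_lintegral_ofReal hint (Eventually.of_forall hf0)] at hle
  exact (ENNReal.ofReal_le_ofReal_iff hk0).1 hle

/-- Lower semicontinuity of the entropy. -/
theorem entropy_le_of_tendsto [IsProbabilityMeasure m] {F : ℕ → Space N → ℝ} {f : Space N → ℝ}
    (hF : ∀ n, MemLp (F n) 2 m) (hf : MemLp f 2 m)
    (hlim : ∀ᵐ x ∂m, Tendsto (fun n => F n x) atTop (𝓝 (f x)))
    {T : ℕ → ℝ} (hT : ∀ n, ∫ x, F n x ^ 2 ∂m ≤ T n) (hTlim : Tendsto T atTop (𝓝 (∫ x, f x ^ 2 ∂m)))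
    (hlog : ∀ n, Integrable (fun x => F n x ^ 2 * Real.log (F n x ^ 2)) m)
    {K : ℕ → ℝ} {k : ℝ} (hK : ∀ n, entropy m (fun x => F n x ^ 2) ≤ K n)
    (hKk : Tendsto K atTop (𝓝 k)) :
    Integrable (fun x => f x ^ 2 * Real.log (f x ^ 2)) m ∧ entropy m (fun x => f x ^ 2) ≤ k := by
  have hk0 : 0 ≤ k := ge_of_tendsto' hKk fun n =>
    (entropy_nonneg (fun _ => sq_nonneg _) (hF n).integrable_sq (hlog n)).trans (hK n)
  have hsq : ∀ᵐ x ∂m, Tendsto (fun n => F n x ^ 2) atTop (𝓝 (f x ^ 2)) := by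
    filter_upwards [hlim] with x hx using hx.pow 2
  have h00 : 0 ≤ ∫ x, f x ^ 2 ∂m := integral_nonneg fun x => sq_nonneg (f x)
  rcases h00.eq_or_lt with h0 | h0
  -- A vanishing second moment is treated apart: the integrand needs `log t`.
  · obtain ⟨h1, h2⟩ := entropy_eq_zero (m := m) (fun x => sq_nonneg (f x)) hf.integrable_sq h0.symm
    exact ⟨h1, h2.le.trans hk0⟩
  set t := ∫ x, f x ^ 2 ∂m with ht
  set S : ℕ → ℝ := fun n => ∫ x, F n x ^ 2 ∂m with hS
  -- The second moments converge: Fatou along a subsequence excludes a drop below the limit, and the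
  -- bound by `T` excludes an excess.
  have hSlim : Tendsto S atTop (𝓝 t) := by
    refine tendsto_order.2 ⟨fun a ha => ?_, fun a ha => ?_⟩
    · by_contra hcon
      obtain ⟨ns, hns, hns2⟩ := extraction_of_frequently_atTop (not_eventually.1 hcon)
      have := (integrable_and_integral_le_of_tendsto (F := fun n x => F (ns n) x ^ 2)
        (f := fun x => f x ^ 2) (K := fun _ => a) (k := a)
        (Eventually.of_forall fun n => ⟨(hF _).integrable_sq, fun x => sq_nonneg _⟩)
        (fun x => sq_nonneg _) hf.integrable_sq.aestronglyMeasurable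
        (by filter_upwards [hsq] with x hx using hx.comp hns.tendsto_atTop)
        (Eventually.of_forall fun n => not_lt.1 (hns2 n)) tendsto_const_nhds).2
      exact absurd ha (not_lt.2 this)
    · filter_upwards [hTlim.eventually_lt_const ha] with n hn
      exact (hT n).trans_lt hn
  have hSpos : ∀ᶠ n in atTop, 0 < S n := hSlim.eventually_const_lt h0
  have key := integrable_and_integral_le_of_tendsto (ν := m)
    (F := fun n x => entropyIntegrand (S n) (F n x ^ 2))
    (f := fun x => entropyIntegrand t (f x ^ 2)) (K := K) (k := k) (by
      filter_upwards [hSpos] with n hn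
      exact ⟨integrable_entropyIntegrand (hF n).integrable_sq (hlog n) _,
        fun x => entropyIntegrand_nonneg hn (sq_nonneg _)⟩)
    (fun x => entropyIntegrand_nonneg h0 (sq_nonneg _))
    ((continuous_entropyIntegrand t).comp_aestronglyMeasurable
      hf.integrable_sq.aestronglyMeasurable)
    (by filter_upwards [hsq] with x hx using tendsto_entropyIntegrand h0 hSlim hx)
    (Eventually.of_forall fun n => by
      rw [← entropy_eq_integral (hF n).integrable_sq (hlog n)]
      exact hK n) hKk
  have hl := integrable_mul_log_of_entropyIntegrand hf.integrable_sq key.1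
  refine ⟨hl, ?_⟩
  rw [entropy_eq_integral hf.integrable_sq hl]
  exact key.2

theorem integral_tilted_neg (U g : Space N → ℝ) :
    ∫ x, g x ∂(volume.tilted fun x => -U x)
      = (∫ x, Real.exp (-U x) * g x) / ∫ x, Real.exp (-U x) := by
  rw [integral_tilted, div_eq_inv_mul, ← integral_const_mul]
  congr with x
  simp only [smul_eq_mul]
  ring

/-- Holley–Stroock perturbation of a logarithmic Sobolev inequality, on test functions. -/
theorem holleyStroock {U U' : Space N → ℝ} (hU : Continuous U) (hU' : Continuous U')
    (hint : Integrable fun x => Real.exp (-U x)) {d K : ℝ}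
    (hle : ∀ x, U x ≤ U' x) (hle' : ∀ x, U' x ≤ U x + d) {f : Space N → ℝ}
    (hf : ContDiff ℝ ∞ f) (hfc : HasCompactSupport f) (hK0 : 0 ≤ K)
    (hK : entropy (volume.tilted fun x => -U' x) (fun x => f x ^ 2)
      ≤ K * ∫ x, ‖fderiv ℝ f x‖ ^ 2 ∂(volume.tilted fun x => -U' x)) :
    entropy (volume.tilted fun x => -U x) (fun x => f x ^ 2)
      ≤ Real.exp d * K * ∫ x, ‖fderiv ℝ f x‖ ^ 2 ∂(volume.tilted fun x => -U x) := by
  have hint' : Integrable fun x => Real.exp (-U' x) := by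
    refine hint.mono' (by fun_prop) (Eventually.of_forall fun x => ?_)
    rw [Real.norm_of_nonneg (Real.exp_pos _).le]
    exact Real.exp_le_exp.2 (neg_le_neg (hle x))
  have p1 : IsProbabilityMeasure ((volume : Measure (Space N)).tilted fun x => -U x) :=
    isProbabilityMeasure_tilted hint
  have p2 : IsProbabilityMeasure ((volume : Measure (Space N)).tilted fun x => -U' x) :=
    isProbabilityMeasure_tilted hint'
  have hZ0 : 0 < ∫ x, Real.exp (-U x) := integral_exp_pos hint
  have hZ0' : 0 < ∫ x, Real.exp (-U' x) := integral_exp_pos hint'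
  have hfcont := hf.continuous
  have hfdc : Continuous (fderiv ℝ f) := hf.continuous_fderiv (by simp)
  obtain ⟨C, hC⟩ := hfc.exists_bound_of_continuous hfcont
  obtain ⟨C', hC'⟩ := (hfc.fderiv ℝ).exists_bound_of_continuous hfdc
  have bint : ∀ (W : Space N → ℝ), Continuous W → Integrable (fun x => Real.exp (-W x)) →
      ∀ (g : Space N → ℝ) (B : ℝ), Continuous g → (∀ x, |g x| ≤ B) →
      Integrable fun x => Real.exp (-W x) * g x := fun W hW hi g B hg hB =>
    hi.mul_bdd hg.aestronglyMeasurable (Eventually.of_forall hB)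
  have cmp1 : ∀ (g : Space N → ℝ) (B : ℝ), Continuous g → (∀ x, |g x| ≤ B) → (∀ x, 0 ≤ g x) →
      (∫ x, Real.exp (-U x) * g x) ≤ Real.exp d * ∫ x, Real.exp (-U' x) * g x := by
    intro g B hg hB hg0
    rw [← integral_const_mul]
    refine integral_mono (bint U hU hint g B hg hB) ((bint U' hU' hint' g B hg hB).const_mul _)
      fun x => ?_
    simp only
    rw [← mul_assoc, ← Real.exp_add]
    refine mul_le_mul_of_nonneg_right (Real.exp_le_exp.2 ?_) (hg0 x)
    linarith [hle' x]
  have cmp2 : ∀ (g : Space N → ℝ) (B : ℝ), Continuous g → (∀ x, |g x| ≤ B) → (∀ x, 0 ≤ g x) →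
      (∫ x, Real.exp (-U' x) * g x) ≤ ∫ x, Real.exp (-U x) * g x := by
    intro g B hg hB hg0
    refine integral_mono (bint U' hU' hint' g B hg hB) (bint U hU hint g B hg hB) fun x => ?_
    exact mul_le_mul_of_nonneg_right (Real.exp_le_exp.2 (neg_le_neg (hle x))) (hg0 x)
  have hf2 : ∀ x, f x ^ 2 ∈ Set.Icc 0 (C ^ 2) := fun x =>
    ⟨sq_nonneg _, sq_le_sq' (neg_le_of_abs_le (hC x)) (le_of_abs_le (hC x))⟩
  have i1 : ∀ (μ : Measure (Space N)) [IsProbabilityMeasure μ], Integrable (fun x => f x ^ 2) μ :=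
    fun μ _ => Integrable.of_bound (hfcont.pow 2).aestronglyMeasurable (C ^ 2)
      (Eventually.of_forall fun x => by
        rw [Real.norm_of_nonneg (hf2 x).1]; exact (hf2 x).2)
  obtain ⟨B, hB⟩ := isCompact_Icc.exists_bound_of_continuousOn
      (s := Set.Icc 0 (C ^ 2)) Real.continuous_mul_log.continuousOn
  have i2 : ∀ (μ : Measure (Space N)) [IsProbabilityMeasure μ],
      Integrable (fun x => f x ^ 2 * Real.log (f x ^ 2)) μ :=
    fun μ _ => Integrable.of_bound
      (Real.continuous_mul_log.comp (hfcont.pow 2)).aestronglyMeasurable B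
      (Eventually.of_forall fun x => hB _ (hf2 x))
  have hI0 : ∀ W : Space N → ℝ, 0 ≤ ∫ x, ‖fderiv ℝ f x‖ ^ 2 ∂(volume.tilted fun x => -W x) :=
    fun W => integral_nonneg fun x => sq_nonneg _
  have hnd : ∀ x, |‖fderiv ℝ f x‖ ^ 2| ≤ C' ^ 2 := fun x => by
    rw [abs_of_nonneg (sq_nonneg _)]
    exact pow_le_pow_left₀ (norm_nonneg _) (hC' x) 2
  -- The mean under the perturbed measure serves as trial value for the original one. Both sides of
  -- each inequality share a normalization, so comparing unnormalized weights costs only `exp d`.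
  set t := ∫ x, f x ^ 2 ∂(volume.tilted fun x => -U' x) with ht
  have h00 : 0 ≤ t := integral_nonneg fun x => sq_nonneg (f x)
  rcases h00.eq_or_lt with h0 | h0
  · have h1 : ∫ x, f x ^ 2 ∂(volume.tilted fun x => -U x) = 0 := by
      refine le_antisymm ?_ (integral_nonneg fun x => sq_nonneg (f x))
      rw [ht, integral_tilted_neg] at h0
      rw [integral_tilted_neg]
      have h2 : ∫ x, Real.exp (-U' x) * f x ^ 2 = 0 := by
        rcases div_eq_zero_iff.1 h0.symm with h | h
        · exact h
        · exact absurd h hZ0'.ne'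
      have h3 := cmp1 (fun x => f x ^ 2) (C ^ 2) (hfcont.pow 2)
        (fun x => by rw [abs_of_nonneg (hf2 x).1]; exact (hf2 x).2) (fun x => (hf2 x).1)
      rw [h2, mul_zero] at h3
      exact div_nonpos_of_nonpos_of_nonneg h3 hZ0.le
    rw [(entropy_eq_zero (fun x => sq_nonneg (f x)) (i1 _) h1).2]
    have := hI0 U
    positivity
  obtain ⟨B', hB'⟩ := isCompact_Icc.exists_bound_of_continuousOn
      (s := Set.Icc 0 (C ^ 2)) (continuous_entropyIntegrand t).continuousOn
  have e1 : entropy (volume.tilted fun x => -U x) (fun x => f x ^ 2) ≤ _ :=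
    entropy_le_integral (fun x => sq_nonneg _) (i1 _) (i2 _) h0
  refine e1.trans ?_
  have e2 := cmp1 (fun x => entropyIntegrand t (f x ^ 2)) B'
    ((continuous_entropyIntegrand t).comp (hfcont.pow 2)) (fun x => hB' _ (hf2 x))
    (fun x => entropyIntegrand_nonneg h0 (sq_nonneg _))
  have e3 := cmp2 (fun x => ‖fderiv ℝ f x‖ ^ 2) (C' ^ 2) (by fun_prop) hnd
    (fun x => sq_nonneg _)
  rw [entropy_eq_integral (i1 _) (i2 _), integral_tilted_neg, integral_tilted_neg _
    (fun x => ‖fderiv ℝ f x‖ ^ 2), ← mul_div_assoc, div_le_div_iff_of_pos_right hZ0'] at hK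
  rw [integral_tilted_neg, integral_tilted_neg _ (fun x => ‖fderiv ℝ f x‖ ^ 2), ← mul_div_assoc,
    div_le_div_iff_of_pos_right hZ0]
  calc _ ≤ _ := e2
    _ ≤ Real.exp d * (K * ∫ x, Real.exp (-U' x) * ‖fderiv ℝ f x‖ ^ 2) := by gcongr
    _ ≤ Real.exp d * (K * ∫ x, Real.exp (-U x) * ‖fderiv ℝ f x‖ ^ 2) := by gcongr
    _ = _ := by ring

end

/-! ### Mollification of compactly supported Sobolev functions. -/

section

open scoped ENNReal Convolution

variable {N : ℕ}

/-- Cauchy–Schwarz against the constant 1 for the probability measure with density `p`. -/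
theorem lintegral_mul_sq_le {α : Type*} [MeasurableSpace α] {ν : Measure α} {p q : α → ℝ≥0∞}
    (hp : Measurable p) (hq : AEMeasurable q ν) (h1 : ∫⁻ x, p x ∂ν = 1) :
    (∫⁻ x, p x * q x ∂ν) ^ 2 ≤ ∫⁻ x, p x * q x ^ 2 ∂ν := by
  have hq' : AEMeasurable q (ν.withDensity p) := hq.mono_ac (withDensity_absolutelyContinuous _ _)
  have e1 : ∫⁻ x, p x * q x ∂ν = ∫⁻ x, q x ∂(ν.withDensity p) := by
    rw [lintegral_withDensity_eq_lintegral_mul₀ hp.aemeasurable hq]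
    rfl
  have e2 : ∫⁻ x, p x * q x ^ 2 ∂ν = ∫⁻ x, q x ^ 2 ∂(ν.withDensity p) := by
    rw [lintegral_withDensity_eq_lintegral_mul₀ hp.aemeasurable (hq.pow_const 2)]
    rfl
  have h2 : (ν.withDensity p) Set.univ = 1 := by simp [h1]
  have h3 := ENNReal.lintegral_mul_le_Lp_mul_Lq (ν.withDensity p) Real.HolderConjugate.two_two hq'
    (aemeasurable_const (b := (1 : ℝ≥0∞)))
  simp only [Pi.mul_apply, mul_one, ENNReal.one_rpow, lintegral_const, h2, ENNReal.rpow_two,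
    one_pow] at h3
  rw [e1, e2]
  calc (∫⁻ x, q x ∂(ν.withDensity p)) ^ 2
      ≤ ((∫⁻ x, q x ^ 2 ∂(ν.withDensity p)) ^ (1 / (2 : ℝ))) ^ 2 := by gcongr
    _ = _ := by
      rw [← ENNReal.rpow_natCast, ← ENNReal.rpow_mul]
      norm_num

theorem ContDiffBump.lintegral_normed (b : ContDiffBump (0 : Space N)) :
    ∫⁻ x, ENNReal.ofReal (b.normed volume x) = 1 := by
  rw [← ofReal_integral_eq_lintegral_ofReal b.integrable_normed
    (Eventually.of_forall b.nonneg_normed), b.integral_normed, ENNReal.ofReal_one]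

/-- Mollification almost contracts the weighted `L²` norm, if the weight is nearly constant
at the scale of the mollifier. -/
theorem lintegral_mollify_sq_le {E : Type*} [NormedAddCommGroup E] [NormedSpace ℝ E]
    {U : Space N → ℝ} (hU : Continuous U) (b : ContDiffBump (0 : Space N)) {F : Space N → E}
    (hF : AEStronglyMeasurable F) {R c : ℝ} (hFR : ∀ x, R < ‖x‖ → F x = 0) (hc0 : 0 ≤ c)
    (hc : ∀ y, ‖y‖ ≤ R → ∀ x, dist x y ≤ b.rOut → Real.exp (-U x) ≤ c * Real.exp (-U y)) :
    ∫⁻ x, ‖∫ y, b.normed volume (x - y) • F y‖ₑ ^ 2 ∂(volume.tilted fun x => -U x)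
      ≤ ENNReal.ofReal c * ∫⁻ x, ‖F x‖ₑ ^ 2 ∂(volume.tilted fun x => -U x) := by
  set Z := ∫ x, Real.exp (-U x)
  have hZ0 : 0 ≤ Z := integral_nonneg fun _ => (Real.exp_pos _).le
  have hbc : Continuous (b.normed volume) := b.continuous_normed
  set p : Space N → ℝ≥0∞ := fun x => ENNReal.ofReal (b.normed volume x) with hp
  have hpm : Measurable p := hbc.measurable.ennreal_ofReal
  set w : Space N → ℝ≥0∞ := fun x => ENNReal.ofReal (Real.exp (-U x) / Z) with hw
  have hwm : Measurable w := by
    have := hU.measurable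
    fun_prop
  have jensen : ∀ x, ‖∫ y, b.normed volume (x - y) • F y‖ₑ ^ 2
      ≤ ∫⁻ y, p (x - y) * ‖F y‖ₑ ^ 2 := by
    intro x
    calc ‖∫ y, b.normed volume (x - y) • F y‖ₑ ^ 2
        ≤ (∫⁻ y, ‖b.normed volume (x - y) • F y‖ₑ) ^ 2 := by
          gcongr; exact enorm_integral_le_lintegral_enorm _
      _ = (∫⁻ y, p (x - y) * ‖F y‖ₑ) ^ 2 := by
          congr 1
          refine lintegral_congr fun y => ?_
          rw [enorm_smul, Real.enorm_eq_ofReal (b.nonneg_normed _)]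
      _ ≤ _ := lintegral_mul_sq_le (hpm.comp (measurable_const.sub measurable_id)) hF.enorm (by
          rw [lintegral_sub_left_eq_self p x]
          exact ContDiffBump.lintegral_normed b)
  have hFm : AEMeasurable (fun y => ‖F y‖ₑ ^ 2) := hF.enorm.pow_const 2
  rw [lintegral_tilted, lintegral_tilted]
  calc ∫⁻ x, w x * ‖∫ y, b.normed volume (x - y) • F y‖ₑ ^ 2
      ≤ ∫⁻ x, w x * ∫⁻ y, p (x - y) * ‖F y‖ₑ ^ 2 := by
        gcongr with x; exact jensen x
    _ = ∫⁻ x, ∫⁻ y, w x * (p (x - y) * ‖F y‖ₑ ^ 2) := by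
        refine lintegral_congr fun x => ?_
        rw [lintegral_const_mul' _ _ ENNReal.ofReal_ne_top]
    _ = ∫⁻ y, ∫⁻ x, w x * (p (x - y) * ‖F y‖ₑ ^ 2) := by
        refine lintegral_lintegral_swap ?_
        refine AEMeasurable.mul (hwm.comp measurable_fst).aemeasurable ?_
        refine AEMeasurable.mul (hpm.comp (measurable_fst.sub measurable_snd)).aemeasurable ?_
        exact hFm.comp_snd
    -- After Tonelli, only `x` within `b.rOut` of `y` contribute, where the weight at `x` is at most
    -- `c` times the weight at `y`; the mollifier then integrates to 1.
    _ ≤ ∫⁻ y, ENNReal.ofReal c * (w y * ‖F y‖ₑ ^ 2) := by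
        refine lintegral_mono fun y => ?_
        rcases lt_or_ge R ‖y‖ with hy | hy
        · simp [hFR y hy]
        calc ∫⁻ x, w x * (p (x - y) * ‖F y‖ₑ ^ 2)
            ≤ ∫⁻ x, (ENNReal.ofReal c * w y * ‖F y‖ₑ ^ 2) * p (x - y) := by
              refine lintegral_mono fun x => ?_
              by_cases hx : dist x y ≤ b.rOut
              · have h1 : w x ≤ ENNReal.ofReal c * w y := by
                  rw [hw, ← ENNReal.ofReal_mul hc0]
                  refine ENNReal.ofReal_le_ofReal ?_
                  rw [← mul_div_assoc]
                  exact div_le_div_of_nonneg_right (hc y hy x hx) hZ0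
                calc w x * (p (x - y) * ‖F y‖ₑ ^ 2)
                    ≤ (ENNReal.ofReal c * w y) * (p (x - y) * ‖F y‖ₑ ^ 2) := by gcongr
                  _ = _ := by ring
              · have h1 : b.normed volume (x - y) = 0 := by
                  rw [← Function.notMem_support, b.support_normed_eq]
                  simp only [Metric.mem_ball, dist_zero_right, not_lt]
                  rw [← dist_eq_norm]
                  exact (not_le.1 hx).le
                simp [hp, h1]
          _ = ENNReal.ofReal c * (w y * ‖F y‖ₑ ^ 2) := by
              have hpy : Measurable fun x => p (x - y) := hpm.comp (measurable_id.sub_const y)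
              rw [lintegral_const_mul _ hpy,
                lintegral_sub_right_eq_self p y, ContDiffBump.lintegral_normed b]
              ring
    _ = _ := lintegral_const_mul' _ _ ENNReal.ofReal_ne_top

theorem integral_norm_sq_eq {E : Type*} [NormedAddCommGroup E] {ν : Measure (Space N)}
    {F : Space N → E} (hF : AEStronglyMeasurable F ν) :
    ∫ x, ‖F x‖ ^ 2 ∂ν = (∫⁻ x, ‖F x‖ₑ ^ 2 ∂ν).toReal := by
  rw [integral_eq_lintegral_of_nonneg_ae (Eventually.of_forall fun _ => sq_nonneg _)
    (hF.norm.pow 2)]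
  congr 1
  refine lintegral_congr fun x => ?_
  rw [ENNReal.ofReal_pow (norm_nonneg _), ofReal_norm]

theorem integral_mollify_sq_le {E : Type*} [NormedAddCommGroup E] [NormedSpace ℝ E]
    {U : Space N → ℝ} (hU : Continuous U) (b : ContDiffBump (0 : Space N)) {F : Space N → E}
    (hF : AEStronglyMeasurable F) {R c : ℝ} (hFR : ∀ x, R < ‖x‖ → F x = 0) (hc0 : 0 ≤ c)
    (hc : ∀ y, ‖y‖ ≤ R → ∀ x, dist x y ≤ b.rOut → Real.exp (-U x) ≤ c * Real.exp (-U y))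
    (hFL : MemLp F 2 (volume.tilted fun x => -U x)) {H : Space N → ℝ} (hH : Continuous H)
    (hHF : ∀ x, |H x| ≤ ‖∫ y, b.normed volume (x - y) • F y‖) :
    ∫ x, H x ^ 2 ∂(volume.tilted fun x => -U x)
      ≤ c * ∫ x, ‖F x‖ ^ 2 ∂(volume.tilted fun x => -U x) := by
  have h1 := lintegral_mollify_sq_le hU b hF hFR hc0 hc
  have e : ∫ x, H x ^ 2 ∂(volume.tilted fun x => -U x)
      = ∫ x, ‖H x‖ ^ 2 ∂(volume.tilted fun x => -U x) := by simp
  rw [e, integral_norm_sq_eq hH.aestronglyMeasurable, integral_norm_sq_eq hFL.1]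
  have hfin : ∫⁻ x, ‖F x‖ₑ ^ 2 ∂(volume.tilted fun x => -U x) ≠ ⊤ := by
    have := (eLpNorm_lt_top_iff_lintegral_rpow_enorm_lt_top two_ne_zero ENNReal.ofNat_ne_top).1
      hFL.2
    simpa using this.ne
  calc _ ≤ (ENNReal.ofReal c * ∫⁻ x, ‖F x‖ₑ ^ 2 ∂(volume.tilted fun x => -U x)).toReal := by
        refine ENNReal.toReal_mono (ENNReal.mul_ne_top ENNReal.ofReal_ne_top hfin) ?_
        refine (lintegral_mono fun x => ?_).trans h1
        gcongr
        rw [Real.enorm_eq_ofReal_abs, ← ofReal_norm]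
        exact ENNReal.ofReal_le_ofReal (hHF x)
    _ = _ := by rw [ENNReal.toReal_mul, ENNReal.toReal_ofReal hc0]

theorem space_eq_sum (v : Space N) : v = ∑ i, v i • EuclideanSpace.single i (1 : ℝ) := by
  ext j
  simp [Finset.sum_apply, Pi.single_apply]

/-- The gradient of a mollification is the mollification of the weak gradient. -/
theorem norm_fderiv_mollify_le {φ : Space N → ℝ} {G : Space N → Space N}
    (h : IsWeakGradient φ G) (b : ContDiffBump (0 : Space N)) (x : Space N) :
    ‖fderiv ℝ (b.normed volume ⋆[ContinuousLinearMap.lsmul ℝ ℝ, volume] φ) x‖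
      ≤ ‖∫ y, b.normed volume (x - y) • G y‖ := by
  set η : Space N → ℝ := b.normed volume with hη
  have hηs : ContDiff ℝ ∞ η := b.contDiff_normed
  have hηc : HasCompactSupport η := b.hasCompactSupport_normed
  obtain ⟨hφ, hG, hw⟩ := h
  have hd := (hηc.hasFDerivAt_convolution_left (ContinuousLinearMap.lsmul ℝ ℝ)
    (hηs.of_le (by simp)) hφ x).fderiv
  set w := ∫ y, η (x - y) • G y with hwdef
  have gs : ContDiff ℝ ∞ fun y => η (x - y) := hηs.comp (contDiff_const.sub contDiff_id)
  have gc : HasCompactSupport fun y => η (x - y) := hηc.comp_homeomorph (Homeomorph.subLeft x)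
  have hGi : Integrable fun y => η (x - y) • G y :=
    hG.integrable_smul_left_of_hasCompactSupport gs.continuous gc
  have hcomp : ∀ i, fderiv ℝ (η ⋆[ContinuousLinearMap.lsmul ℝ ℝ, volume] φ) x
      (EuclideanSpace.single i 1) = w i := by
    intro i
    have hex := (hηc.fderiv ℝ).convolutionExists_left
      ((ContinuousLinearMap.lsmul ℝ ℝ).precompL (Space N))
      (hηs.continuous_fderiv (by simp)) hφ x
    rw [hd, convolution_eq_swap, ContinuousLinearMap.integral_apply hex.integrable_swap]
    -- The weak-gradient identity is tested on the reflected translate `y ↦ η (x - y)`; the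
    -- chain-rule sign cancels the sign of integration by parts.
    have h1 := hw (fun y => η (x - y)) gs gc i
    have h2 : ∀ y, fderiv ℝ (fun y => η (x - y)) y (EuclideanSpace.single i 1)
        = - fderiv ℝ η (x - y) (EuclideanSpace.single i 1) := by
      intro y
      have h3 : HasFDerivAt (fun y => η (x - y)) (-(fderiv ℝ η (x - y))) y := by
        have := ((hηs.differentiable (by simp)) (x - y)).hasFDerivAt.comp y
          ((hasFDerivAt_id y).const_sub x)
        exact this.congr_fderiv (by ext v; simp)
      rw [h3.fderiv]; rfl
    have h4 : ∫ y, G y i * η (x - y) = w i := by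
      have := (EuclideanSpace.proj (𝕜 := ℝ) i).integral_comp_comm hGi
      refine Eq.trans ?_ this
      refine integral_congr_ae (Eventually.of_forall fun y => ?_)
      simp [mul_comm]
    rw [h4] at h1
    simp only [h2, mul_neg, integral_neg, neg_inj] at h1
    rw [← h1]
    refine integral_congr_ae (Eventually.of_forall fun y => ?_)
    simp [ContinuousLinearMap.precompL_apply, mul_comm]
  have hinner : ∀ v, fderiv ℝ (η ⋆[ContinuousLinearMap.lsmul ℝ ℝ, volume] φ) x v
      = inner ℝ w v := by
    intro v
    rw [space_eq_sum v, map_sum, inner_sum]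
    refine Finset.sum_congr rfl fun i _ => ?_
    rw [map_smul, hcomp, inner_smul_right, EuclideanSpace.inner_single_right]
    simp
  refine ContinuousLinearMap.opNorm_le_bound _ (norm_nonneg _) fun v => ?_
  rw [hinner]
  exact norm_inner_le_norm _ _

/-- Uniform continuity of `U` on the ball of radius `R + 1`; radii at most 1 keep both points inside
it. The cap `d` lets the radius be sent to 0. -/
theorem exists_radius_exp_le {U : Space N → ℝ} (hU : Continuous U) (R : ℝ) {c : ℝ} (hc : 1 < c) {d : ℝ}
    (hd : 0 < d) : ∃ r, 0 < r ∧ r ≤ d ∧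
      ∀ y, ‖y‖ ≤ R → ∀ x, dist x y ≤ r → Real.exp (-U x) ≤ c * Real.exp (-U y) := by
  have huc := (isCompact_closedBall (0 : Space N) (R + 1)).uniformContinuousOn_of_continuous
    hU.continuousOn
  obtain ⟨δ, hδ, h⟩ := Metric.uniformContinuousOn_iff.1 huc (Real.log c) (Real.log_pos hc)
  refine ⟨min d (min 1 (δ / 2)), by positivity, min_le_left _ _, fun y hy x hx => ?_⟩
  have h1 : dist x y ≤ 1 := hx.trans ((min_le_right _ _).trans (min_le_left _ _))
  have h2 : dist x y < δ := (hx.trans ((min_le_right _ _).trans (min_le_right _ _))).trans_lt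
    (by linarith)
  have h3 := h x (by
    rw [mem_closedBall_zero_iff]
    have := norm_le_norm_add_norm_sub' x y
    rw [← dist_eq_norm] at this
    linarith) y (by rw [mem_closedBall_zero_iff]; linarith) h2
  rw [Real.dist_eq, abs_lt] at h3
  calc Real.exp (-U x) ≤ Real.exp (Real.log c + -U y) := Real.exp_le_exp.2 (by linarith [h3.1])
    _ = _ := by rw [Real.exp_add, Real.exp_log (by linarith)]

/-- A logarithmic Sobolev inequality on test functions extends to compactly supported
Sobolev functions. -/
theorem logSobolev_of_bounded_support {U : Space N → ℝ} (hU : Continuous U)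
    (hint : Integrable fun x => Real.exp (-U x)) {K : ℝ} (hK0 : 0 ≤ K)
    (hLS : ∀ f : Space N → ℝ, ContDiff ℝ ∞ f → HasCompactSupport f →
      entropy (volume.tilted fun x => -U x) (fun x => f x ^ 2)
        ≤ K * ∫ x, ‖fderiv ℝ f x‖ ^ 2 ∂(volume.tilted fun x => -U x))
    {φ : Space N → ℝ} {G : Space N → Space N}
    (h : MemH1 (volume.tilted fun x => -U x) φ G) {R : ℝ}
    (hφR : ∀ x, R < ‖x‖ → φ x = 0) (hGR : ∀ x, R < ‖x‖ → G x = 0) :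
    Integrable (fun x => φ x ^ 2 * Real.log (φ x ^ 2)) (volume.tilted fun x => -U x) ∧
    entropy (volume.tilted fun x => -U x) (fun x => φ x ^ 2)
      ≤ K * ∫ x, ‖G x‖ ^ 2 ∂(volume.tilted fun x => -U x) := by
  obtain ⟨hw, hφ, hG⟩ := h
  have hprob : IsProbabilityMeasure ((volume : Measure (Space N)).tilted fun x => -U x) :=
    isProbabilityMeasure_tilted hint
  have hc : ∀ n : ℕ, (1 : ℝ) < 1 + 1 / (n + 1) := fun n => by
    have : (0 : ℝ) < 1 / (n + 1) := by positivity
    linarith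
  choose r hr0 hr1 hr using fun n : ℕ => exists_radius_exp_le hU R (hc n)
    (d := 1 / ((n : ℝ) + 1)) (by positivity)
  -- The fixed ratio 2 of outer to inner radius is what Lebesgue differentiation requires for almost
  -- everywhere convergence of the convolutions.
  let b : ℕ → ContDiffBump (0 : Space N) := fun n =>
    ⟨r n / 2, r n, by have := hr0 n; positivity, by have := hr0 n; linarith⟩
  set F : ℕ → Space N → ℝ := fun n =>
    (b n).normed volume ⋆[ContinuousLinearMap.lsmul ℝ ℝ, volume] φ with hF
  have hFs : ∀ n, ContDiff ℝ ∞ (F n) := fun n =>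
    (b n).hasCompactSupport_normed.contDiff_convolution_left _ (b n).contDiff_normed hw.1
  have hφc : HasCompactSupport φ := HasCompactSupport.of_support_subset_isCompact
    (isCompact_closedBall (0 : Space N) R) fun x hx => by
      rw [mem_closedBall_zero_iff]
      by_contra hcon
      exact hx (hφR x (not_le.1 hcon))
  have hFc : ∀ n, HasCompactSupport (F n) := fun n =>
    (b n).hasCompactSupport_normed.convolution _ hφc
  have hrlim : Tendsto (fun n : ℕ => (1 : ℝ) / (n + 1)) atTop (𝓝 0) :=
    tendsto_one_div_add_atTop_nhds_zero_nat
  have hr0lim : Tendsto r atTop (𝓝 0) :=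
    squeeze_zero (fun n => (hr0 n).le) hr1 hrlim
  have hae : ∀ᵐ x, Tendsto (fun n => F n x) atTop (𝓝 (φ x)) :=
    ContDiffBump.ae_convolution_tendsto_right_of_locallyIntegrable (K := 2) hr0lim
      (Eventually.of_forall fun n => by simp only [b]; linarith) hw.1
  have hFφ : ∀ n x, F n x = ∫ y, (b n).normed volume (x - y) • φ y := fun n x =>
    convolution_eq_swap _
  have hsq : ∀ n, ∫ x, F n x ^ 2 ∂(volume.tilted fun x => -U x)
      ≤ (1 + 1 / ((n : ℝ) + 1)) * ∫ x, φ x ^ 2 ∂(volume.tilted fun x => -U x) := by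
    intro n
    have := integral_mollify_sq_le hU (b n) hw.1.aestronglyMeasurable hφR
      (zero_le_one.trans (hc n).le) (hr n) hφ (hFs n).continuous
      (fun x => by rw [hFφ]; exact le_rfl)
    simpa using this
  have hgr : ∀ n, ∫ x, ‖fderiv ℝ (F n) x‖ ^ 2 ∂(volume.tilted fun x => -U x)
      ≤ (1 + 1 / ((n : ℝ) + 1)) * ∫ x, ‖G x‖ ^ 2 ∂(volume.tilted fun x => -U x) := by
    intro n
    exact integral_mollify_sq_le hU (b n) hw.2.1.aestronglyMeasurable hGR
      (zero_le_one.trans (hc n).le) (hr n) hG ((hFs n).continuous_fderiv (by simp)).norm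
      (fun x => by rw [abs_norm]; exact norm_fderiv_mollify_le hw (b n) x)
  have clim : ∀ a : ℝ, Tendsto (fun n : ℕ => (1 + 1 / ((n : ℝ) + 1)) * a) atTop (𝓝 a) := by
    intro a
    have := (tendsto_const_nhds (x := (1 : ℝ))).add hrlim |>.mul_const a
    simpa using this
  refine entropy_le_of_tendsto (F := F) (fun n => ?_) hφ
    ((tilted_absolutelyContinuous volume fun x => -U x).ae_le hae) hsq (clim _) (fun n => ?_)
    (fun n => (hLS (F n) (hFs n) (hFc n)).trans (mul_le_mul_of_nonneg_left (hgr n) hK0))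
    ((clim _).const_mul K)
  · exact (hFs n).continuous.memLp_of_hasCompactSupport (hFc n)
  · have hcs : HasCompactSupport fun x => F n x ^ 2 * Real.log (F n x ^ 2) :=
      (hFc n).comp_left (g := fun y : ℝ => y ^ 2 * Real.log (y ^ 2)) (by simp)
    exact (Real.continuous_mul_log.comp ((hFs n).continuous.pow 2)).integrable_of_hasCompactSupport
      hcs

end

/-! ### Weak gradients, removal of the support condition, and linearization. -/

section

variable {N : ℕ}

theorem gradient_apply (f : Space N → ℝ) (x : Space N) (i : Fin N) :
    gradient f x i = fderiv ℝ f x (EuclideanSpace.single i 1) := by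
  have h : inner ℝ (gradient f x) (EuclideanSpace.single i (1 : ℝ))
      = fderiv ℝ f x (EuclideanSpace.single i 1) := by
    rw [gradient, InnerProductSpace.toDual_symm_apply]
  rw [EuclideanSpace.inner_single_right] at h
  simpa using h

theorem norm_gradient (f : Space N → ℝ) (x : Space N) : ‖gradient f x‖ = ‖fderiv ℝ f x‖ := by
  rw [gradient, LinearIsometryEquiv.norm_map]

theorem continuous_gradient {f : Space N → ℝ} (hf : ContDiff ℝ 1 f) : Continuous (gradient f) :=
  (LinearIsometryEquiv.continuous _).comp (hf.continuous_fderiv one_ne_zero)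

theorem continuous_fderiv_apply {f : Space N → ℝ} (hf : ContDiff ℝ 1 f) (v : Space N) :
    Continuous fun x => fderiv ℝ f x v :=
  (hf.continuous_fderiv one_ne_zero).clm_apply continuous_const

theorem hasCompactSupport_fderiv_apply {f : Space N → ℝ} (hf : HasCompactSupport f) (v : Space N) :
    HasCompactSupport fun x => fderiv ℝ f x v :=
  (hf.fderiv ℝ).comp_left (g := fun L : Space N →L[ℝ] ℝ => L v) (by simp)

theorem isWeakGradient_of_contDiff {f : Space N → ℝ} (hf : ContDiff ℝ 1 f) :
    IsWeakGradient f (gradient f) := by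
  refine ⟨hf.continuous.locallyIntegrable, (continuous_gradient hf).locallyIntegrable,
    fun g hg hgc i => ?_⟩
  simp only [gradient_apply]
  have hg1 : ContDiff ℝ 1 g := hg.of_le (by simp)
  have h1 := continuous_fderiv_apply hf (EuclideanSpace.single i 1)
  have h2 := continuous_fderiv_apply hg1 (EuclideanSpace.single i 1)
  refine integral_mul_fderiv_eq_neg_fderiv_mul_of_integrable ?_ ?_ ?_
    (fun x _ => hf.differentiable one_ne_zero x) (fun x _ => hg1.differentiable one_ne_zero x)
  · exact (h1.mul hg.continuous).integrable_of_hasCompactSupport hgc.mul_left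
  · exact (hf.continuous.mul h2).integrable_of_hasCompactSupport
      (hasCompactSupport_fderiv_apply hgc _).mul_left
  · exact (hf.continuous.mul hg.continuous).integrable_of_hasCompactSupport hgc.mul_left

theorem IsWeakGradient.affine {φ : Space N → ℝ} {G : Space N → Space N} (h : IsWeakGradient φ G)
    (a b : ℝ) : IsWeakGradient (fun x => a + b * φ x) (fun x => b • G x) := by
  obtain ⟨hφ, hG, hw⟩ := h
  refine ⟨?_, ?_, fun g hg hgc i => ?_⟩
  · exact (locallyIntegrable_const a).add (hφ.smul b)
  · exact hG.smul b
  have hg1 : ContDiff ℝ 1 g := hg.of_le (by simp)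
  have h2 := continuous_fderiv_apply hg1 (EuclideanSpace.single i 1)
  have h3 := hasCompactSupport_fderiv_apply hgc (EuclideanSpace.single i 1)
  have i1 : Integrable fun x => φ x * fderiv ℝ g x (EuclideanSpace.single i 1) :=
    hφ.integrable_smul_right_of_hasCompactSupport h2 h3
  have e0 : ∫ x, fderiv ℝ g x (EuclideanSpace.single i 1) = 0 := by
    have := (isWeakGradient_of_contDiff (f := fun _ : Space N => (1 : ℝ)) contDiff_const).2.2
      g hg hgc i
    simpa [gradient_apply] using this
  calc ∫ x, (a + b * φ x) * fderiv ℝ g x (EuclideanSpace.single i 1)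
      = ∫ x, (a * fderiv ℝ g x (EuclideanSpace.single i 1)
          + b * (φ x * fderiv ℝ g x (EuclideanSpace.single i 1))) := by
        congr with x; ring
    _ = b * ∫ x, φ x * fderiv ℝ g x (EuclideanSpace.single i 1) := by
        rw [integral_add ((h2.integrable_of_hasCompactSupport h3).const_mul _) (i1.const_mul _),
          integral_const_mul, integral_const_mul, e0, mul_zero, zero_add]
    _ = - ∫ x, b * (G x i * g x) := by
        rw [hw g hg hgc i, integral_const_mul]; ring
    _ = _ := by
        congr 2 with x
        simp only [PiLp.smul_apply, smul_eq_mul]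
        ring

theorem IsWeakGradient.mul_cutoff {φ χ : Space N → ℝ} {G : Space N → Space N}
    (h : IsWeakGradient φ G) (hχ : ContDiff ℝ ∞ χ) :
    IsWeakGradient (fun x => χ x * φ x) (fun x => χ x • G x + φ x • gradient χ x) := by
  obtain ⟨hφ, hG, hw⟩ := h
  have hχ1 : ContDiff ℝ 1 χ := hχ.of_le (by simp)
  refine ⟨hφ.continuous_mul hχ.continuous, (hG.continuous_smul hχ.continuous).add
    (hφ.smul_continuous (continuous_gradient hχ1)), fun g hg hgc i => ?_⟩
  set e := EuclideanSpace.single i (1 : ℝ) with he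
  have hg1 : ContDiff ℝ 1 g := hg.of_le (by simp)
  have h1 := hw (fun x => χ x * g x) (hχ.mul hg) hgc.mul_left i
  have hd : ∀ x, fderiv ℝ (fun x => χ x * g x) x e = χ x * fderiv ℝ g x e + g x * fderiv ℝ χ x e := by
    intro x
    rw [fderiv_fun_mul (hχ1.differentiable one_ne_zero x) (hg1.differentiable one_ne_zero x)]
    simp
  have c1 : Continuous fun x => χ x * fderiv ℝ g x e :=
    hχ.continuous.mul (continuous_fderiv_apply hg1 e)
  have s1 : HasCompactSupport fun x => χ x * fderiv ℝ g x e :=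
    (hasCompactSupport_fderiv_apply hgc e).mul_left
  have c2 : Continuous fun x => g x * fderiv ℝ χ x e :=
    hg.continuous.mul (continuous_fderiv_apply hχ1 e)
  have s2 : HasCompactSupport fun x => g x * fderiv ℝ χ x e := hgc.mul_right
  have i1 : Integrable fun x => φ x * (χ x * fderiv ℝ g x e) :=
    hφ.integrable_smul_right_of_hasCompactSupport c1 s1
  have i2 : Integrable fun x => φ x * (g x * fderiv ℝ χ x e) :=
    hφ.integrable_smul_right_of_hasCompactSupport c2 s2
  have i3 : Integrable fun x => G x i * (χ x * g x) := by
    have h3 := hG.integrable_smul_left_of_hasCompactSupport (hχ.continuous.mul hg.continuous)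
      (hgc.mul_left (f := χ))
    have h4 := (EuclideanSpace.proj (𝕜 := ℝ) i).integrable_comp h3
    refine h4.congr (Eventually.of_forall fun x => ?_)
    simp [mul_comm]
  have h1' : ∫ x, (φ x * (χ x * fderiv ℝ g x e) + φ x * (g x * fderiv ℝ χ x e))
      = -∫ x, G x i * (χ x * g x) := by
    rw [← h1]
    congr with x
    rw [hd]
    ring
  rw [integral_add i1 i2] at h1'
  have e1 : ∫ x, χ x * φ x * fderiv ℝ g x e = ∫ x, φ x * (χ x * fderiv ℝ g x e) := by
    congr with x; ring
  have e2 : ∫ x, (χ x • G x + φ x • gradient χ x) i * g x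
      = (∫ x, G x i * (χ x * g x)) + ∫ x, φ x * (g x * fderiv ℝ χ x e) := by
    rw [← integral_add i3 i2]
    congr with x
    simp only [PiLp.add_apply, PiLp.smul_apply, smul_eq_mul, gradient_apply]
    ring
  calc ∫ x, χ x * φ x * fderiv ℝ g x e = _ := e1
    _ = -∫ x, (χ x • G x + φ x • gradient χ x) i * g x := by rw [e2]; linarith

/-- A logarithmic Sobolev inequality on test functions extends to the weighted Sobolev space. -/
theorem logSobolev_of_memH1 {U : Space N → ℝ} (hU : Continuous U)
    (hint : Integrable fun x => Real.exp (-U x)) {K : ℝ} (hK0 : 0 ≤ K)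
    (hLS : ∀ f : Space N → ℝ, ContDiff ℝ ∞ f → HasCompactSupport f →
      entropy (volume.tilted fun x => -U x) (fun x => f x ^ 2)
        ≤ K * ∫ x, ‖fderiv ℝ f x‖ ^ 2 ∂(volume.tilted fun x => -U x))
    {φ : Space N → ℝ} {G : Space N → Space N}
    (h : MemH1 (volume.tilted fun x => -U x) φ G) :
    Integrable (fun x => φ x ^ 2 * Real.log (φ x ^ 2)) (volume.tilted fun x => -U x) ∧
    entropy (volume.tilted fun x => -U x) (fun x => φ x ^ 2)
      ≤ K * ∫ x, ‖G x‖ ^ 2 ∂(volume.tilted fun x => -U x) := by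
  obtain ⟨hw, hφ, hG⟩ := h
  have hprob : IsProbabilityMeasure ((volume : Measure (Space N)).tilted fun x => -U x) :=
    isProbabilityMeasure_tilted hint
  set m := (volume : Measure (Space N)).tilted fun x => -U x with hm
  let b : ContDiffBump (0 : Space N) := ⟨1, 2, one_pos, one_lt_two⟩
  have hbs : ContDiff ℝ ∞ b := b.contDiff
  have hbs1 : ContDiff ℝ 1 b := b.contDiff
  obtain ⟨C, hC⟩ := (b.hasCompactSupport.fderiv ℝ).exists_bound_of_continuous
    (hbs1.continuous_fderiv one_ne_zero)
  have hC0 : 0 ≤ C := (norm_nonneg _).trans (hC 0)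
  obtain ⟨a, ha0, ha1, halim⟩ : ∃ a : ℕ → ℝ, (∀ n, 0 < a n) ∧ (∀ n, a n ≤ 1) ∧
      Tendsto a atTop (𝓝 0) := by
    refine ⟨fun n => 1 / ((n : ℝ) + 1), fun n => by positivity, fun n => ?_,
      tendsto_one_div_add_atTop_nhds_zero_nat⟩
    simp only
    rw [div_le_one (by positivity)]
    linarith [(Nat.cast_nonneg n : (0 : ℝ) ≤ n)]
  -- Dilated cutoffs: they tend pointwise to 1 and their gradients are bounded by `a n * C`, which
  -- tends to 0.
  set χ : ℕ → Space N → ℝ := fun n x => b (a n • x) with hχ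
  have hχs : ∀ n, ContDiff ℝ ∞ (χ n) := fun n => hbs.comp (contDiff_const_smul (a n))
  have hχ1 : ∀ n, ContDiff ℝ 1 (χ n) := fun n => (hχs n).of_le (by simp)
  have hχd : ∀ n x, fderiv ℝ (χ n) x = a n • fderiv ℝ b (a n • x) := by
    intro n x
    have h1 := ((hbs1.differentiable one_ne_zero) (a n • x)).hasFDerivAt.comp x
      ((hasFDerivAt_id x).const_smul (a n))
    refine (HasFDerivAt.fderiv h1).trans ?_
    ext v; simp
  have hχb : ∀ n x, |χ n x| ≤ 1 := fun n x => by
    rw [abs_of_nonneg b.nonneg]; exact b.le_one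
  have hχg : ∀ n x, ‖gradient (χ n) x‖ ≤ a n * C := fun n x => by
    rw [norm_gradient, hχd, norm_smul, Real.norm_of_nonneg (ha0 n).le]
    exact mul_le_mul_of_nonneg_left (hC _) (ha0 n).le
  have hχlim : ∀ x, Tendsto (fun n => χ n x) atTop (𝓝 1) := by
    intro x
    have h1 : Tendsto (fun n => a n • x) atTop (𝓝 ((0 : ℝ) • x)) := halim.smul_const x
    rw [zero_smul] at h1
    have h2 := (hbs.continuous.tendsto 0).comp h1
    rwa [b.one_of_mem_closedBall (by simp [b])] at h2
  set F : ℕ → Space N → ℝ := fun n x => χ n x * φ x with hF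
  set H : ℕ → Space N → Space N := fun n x => χ n x • G x + φ x • gradient (χ n) x with hH
  have hFm : ∀ n, MemLp (F n) 2 m := fun n =>
    hφ.of_le ((hχs n).continuous.aestronglyMeasurable.mul hφ.1) (Eventually.of_forall fun x => by
      rw [hF, norm_mul]
      exact mul_le_of_le_one_left (norm_nonneg _) (hχb n x))
  have hHm : ∀ n, MemLp (H n) 2 m := fun n => by
    refine MemLp.add ?_ ?_
    · exact hG.of_le ((hχs n).continuous.aestronglyMeasurable.smul hG.1)
        (Eventually.of_forall fun x => by
          rw [norm_smul]
          exact mul_le_of_le_one_left (norm_nonneg _) (hχb n x))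
    · refine (hφ.const_mul (a n * C)).of_le
        (hφ.1.smul (continuous_gradient (hχ1 n)).aestronglyMeasurable)
        (Eventually.of_forall fun x => ?_)
      rw [norm_smul, norm_mul, mul_comm, Real.norm_of_nonneg (mul_nonneg (ha0 n).le hC0)]
      exact mul_le_mul_of_nonneg_right (hχg n x) (norm_nonneg _)
  have hzero : ∀ n (x : Space N), 2 / a n < ‖x‖ → 2 < ‖a n • x‖ := by
    intro n x hx
    rw [norm_smul, Real.norm_of_nonneg (ha0 n).le]
    rwa [div_lt_iff₀' (ha0 n)] at hx
  have hF0 : ∀ n (x : Space N), 2 / a n < ‖x‖ → χ n x = 0 := by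
    intro n x hx
    exact b.zero_of_le_dist (by simpa [b] using (hzero n x hx).le)
  have hH0 : ∀ n (x : Space N), 2 / a n < ‖x‖ → H n x = 0 := by
    intro n x hx
    have h1 : fderiv ℝ b (a n • x) = 0 := by
      by_contra hcon
      have h2 := support_fderiv_subset ℝ (f := b) hcon
      rw [b.tsupport_eq, mem_closedBall_zero_iff] at h2
      exact absurd (hzero n x hx) (not_lt.2 h2)
    have h2 : gradient (χ n) x = 0 := by
      rw [← norm_eq_zero, norm_gradient, hχd, h1]
      simp
    simp [hH, h2, hF0 n x hx]
  have key : ∀ n, Integrable (fun x => F n x ^ 2 * Real.log (F n x ^ 2)) m ∧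
      entropy m (fun x => F n x ^ 2) ≤ K * ∫ x, ‖H n x‖ ^ 2 ∂m := fun n =>
    logSobolev_of_bounded_support hU hint hK0 hLS ⟨hw.mul_cutoff (hχs n), hFm n, hHm n⟩
      (R := 2 / a n) (fun x hx => by simp only [hF, hF0 n x hx, zero_mul]) (hH0 n)
  have hGsq : Integrable (fun x => ‖G x‖ ^ 2) m := hG.integrable_norm_pow two_ne_zero
  have lim1 : Tendsto (fun n => ∫ x, F n x ^ 2 ∂m) atTop (𝓝 (∫ x, φ x ^ 2 ∂m)) := by
    refine tendsto_integral_of_dominated_convergence (fun x => φ x ^ 2)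
      (fun n => ((hFm n).1.pow 2)) hφ.integrable_sq (fun n => Eventually.of_forall fun x => ?_)
      (Eventually.of_forall fun x => ?_)
    · rw [Real.norm_of_nonneg (sq_nonneg _), hF, mul_pow]
      refine mul_le_of_le_one_left (sq_nonneg _) ?_
      rw [← sq_abs]
      exact pow_le_one₀ (abs_nonneg _) (hχb n x)
    · have := ((hχlim x).mul_const (φ x)).pow 2
      simpa using this
  have hdom : Integrable (fun x => 2 * ‖G x‖ ^ 2 + 2 * C ^ 2 * φ x ^ 2) m := by
    have d1 : Integrable (fun x => 2 * ‖G x‖ ^ 2) m := hGsq.const_mul 2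
    have d2 : Integrable (fun x => 2 * C ^ 2 * φ x ^ 2) m := hφ.integrable_sq.const_mul (2 * C ^ 2)
    exact d1.add d2
  have hHsq : ∀ n, AEStronglyMeasurable (fun x => ‖H n x‖ ^ 2) m := fun n =>
    (hHm n).1.norm.pow 2
  have lim2 : Tendsto (fun n => ∫ x, ‖H n x‖ ^ 2 ∂m) atTop (𝓝 (∫ x, ‖G x‖ ^ 2 ∂m)) := by
    refine tendsto_integral_of_dominated_convergence
      (fun x => 2 * ‖G x‖ ^ 2 + 2 * C ^ 2 * φ x ^ 2)
      hHsq hdom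
      (fun n => Eventually.of_forall fun x => ?_) (Eventually.of_forall fun x => ?_)
    · rw [Real.norm_of_nonneg (sq_nonneg _)]
      have h1 : ‖H n x‖ ≤ ‖G x‖ + C * |φ x| := by
        refine (norm_add_le _ _).trans (add_le_add ?_ ?_)
        · rw [norm_smul]
          exact mul_le_of_le_one_left (norm_nonneg _) (hχb n x)
        · rw [norm_smul, mul_comm, Real.norm_eq_abs]
          refine mul_le_mul_of_nonneg_right ((hχg n x).trans ?_) (abs_nonneg _)
          exact mul_le_of_le_one_left hC0 (ha1 n)
      calc ‖H n x‖ ^ 2 ≤ (‖G x‖ + C * |φ x|) ^ 2 := pow_le_pow_left₀ (norm_nonneg _) h1 2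
        _ ≤ 2 * ‖G x‖ ^ 2 + 2 * (C * |φ x|) ^ 2 := by
          nlinarith [sq_nonneg (‖G x‖ - C * |φ x|)]
        _ = _ := by rw [mul_pow, sq_abs]; ring
    · have h1 : Tendsto (fun n => φ x • gradient (χ n) x) atTop (𝓝 0) := by
        refine squeeze_zero_norm (a := fun n => |φ x| * (a n * C)) (fun n => ?_) ?_
        · rw [norm_smul]
          exact mul_le_mul_of_nonneg_left (hχg n x) (abs_nonneg _)
        · have := (halim.mul_const C).const_mul |φ x|
          simpa using this
      have h2 := (((hχlim x).smul_const (G x)).add h1).norm.pow 2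
      simpa using h2
  exact entropy_le_of_tendsto hFm hφ (Eventually.of_forall fun x => by
    have := (hχlim x).mul_const (φ x)
    simpa using this) (fun n => le_rfl) lim1 (fun n => (key n).1) (fun n => (key n).2)
    (lim2.const_mul K)

theorem abs_log_one_add_sub_le {x : ℝ} (hx : |x| < 1) :
    |Real.log (1 + x) - x + x ^ 2 / 2| ≤ |x| ^ 3 / (1 - |x|) := by
  have h := Real.abs_log_sub_add_sum_range_le (x := -x) (by rwa [abs_neg]) 2
  rw [abs_neg] at h
  refine le_trans (le_of_eq ?_) h
  congr 1
  simp [Finset.sum_range_succ]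
  ring

/-- Second-order expansion at `t = y = 1`. The shift of `t` by `ε² v` contributes `ε² v - (1 + εu)²
log(1 + ε² v)`, which is `o(ε²)`, so `v` is absent from the limit. -/
theorem tendsto_entropyIntegrand_perturbation (u : ℝ) {v : ℝ} (hv : 0 ≤ v) {ε : ℕ → ℝ}
    (hε : ∀ n, 0 < ε n) (hlim : Tendsto ε atTop (𝓝 0)) :
    Tendsto (fun n => entropyIntegrand (1 + ε n ^ 2 * v) ((1 + ε n * u) ^ 2) / ε n ^ 2) atTop
      (𝓝 (2 * u ^ 2)) := by
  have A : Tendsto (fun n => entropyIntegrand 1 ((1 + ε n * u) ^ 2) / ε n ^ 2 - 2 * u ^ 2) atTop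
      (𝓝 0) := by
    have hsmall : ∀ᶠ n in atTop, |ε n * u| < 1 / 2 := by
      have : Tendsto (fun n => |ε n * u|) atTop (𝓝 |0 * u|) := (hlim.mul_const u).abs
      rw [zero_mul, abs_zero] at this
      exact this.eventually_lt_const (by norm_num)
    have hb : Tendsto (fun n => ε n * (10 * |u| ^ 3) + ε n ^ 2 * u ^ 4) atTop (𝓝 0) := by
      have := (hlim.mul_const (10 * |u| ^ 3)).add ((hlim.pow 2).mul_const (u ^ 4))
      simpa using this
    refine squeeze_zero_norm' ?_ hb
    filter_upwards [hsmall] with n hn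
    set x := ε n * u with hx
    have hε2 : 0 < ε n ^ 2 := by have := hε n; positivity
    have hl := abs_log_one_add_sub_le (hn.trans (by norm_num))
    have hx1 := abs_lt.1 hn
    have e1 : entropyIntegrand 1 ((1 + x) ^ 2) - 2 * x ^ 2
        = 2 * (1 + x) ^ 2 * (Real.log (1 + x) - x + x ^ 2 / 2) - x ^ 4 := by
      simp only [entropyIntegrand, Real.log_pow, Real.log_one]
      push_cast
      ring
    have e2 : entropyIntegrand 1 ((1 + x) ^ 2) / ε n ^ 2 - 2 * u ^ 2
        = (entropyIntegrand 1 ((1 + x) ^ 2) - 2 * x ^ 2) / ε n ^ 2 := by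
      have hne := (hε n).ne'
      rw [sub_div, hx]; congr 1; field_simp
    have h3 : |x| ^ 3 / (1 - |x|) ≤ 2 * |x| ^ 3 := by
      rw [div_le_iff₀ (by linarith)]
      have : 0 ≤ |x| ^ 3 := by positivity
      nlinarith
    have h4 : 2 * (1 + x) ^ 2 ≤ 5 := by nlinarith
    rw [e2, e1, Real.norm_eq_abs, abs_div, abs_of_pos hε2, div_le_iff₀ hε2]
    calc |2 * (1 + x) ^ 2 * (Real.log (1 + x) - x + x ^ 2 / 2) - x ^ 4|
        ≤ |2 * (1 + x) ^ 2 * (Real.log (1 + x) - x + x ^ 2 / 2)| + |x ^ 4| := abs_sub _ _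
      _ ≤ 5 * (2 * |x| ^ 3) + x ^ 4 := by
        rw [abs_mul, abs_of_nonneg (by positivity : (0 : ℝ) ≤ 2 * (1 + x) ^ 2),
          abs_of_nonneg (by positivity : (0 : ℝ) ≤ x ^ 4)]
        gcongr
        exact hl.trans h3
      _ = _ := by
        rw [hx, abs_mul, abs_of_pos (hε n)]
        ring
  have B : Tendsto (fun n => Real.log (1 + ε n ^ 2 * v) / ε n ^ 2) atTop (𝓝 v) := by
    have h1 : Tendsto (fun n => v / (1 + ε n ^ 2 * v)) atTop (𝓝 v) := by
      have : Tendsto (fun n => v / (1 + ε n ^ 2 * v)) atTop (𝓝 (v / (1 + 0 ^ 2 * v))) :=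
        tendsto_const_nhds.div (tendsto_const_nhds.add ((hlim.pow 2).mul_const v)) (by simp)
      simpa using this
    refine tendsto_of_tendsto_of_tendsto_of_le_of_le h1 tendsto_const_nhds (fun n => ?_)
      (fun n => ?_)
    · have hε2 : 0 < ε n ^ 2 := by have := hε n; positivity
      have h2 : 0 < 1 + ε n ^ 2 * v := by positivity
      have h3 := Real.one_sub_inv_le_log_of_pos h2
      simp only
      rw [div_le_div_iff₀ h2 hε2]
      have h4 : (1 - (1 + ε n ^ 2 * v)⁻¹) * (1 + ε n ^ 2 * v) = v * ε n ^ 2 := by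
        field_simp; ring
      nlinarith [mul_le_mul_of_nonneg_right h3 h2.le]
    · have hε2 : 0 < ε n ^ 2 := by have := hε n; positivity
      have h2 : 0 < 1 + ε n ^ 2 * v := by positivity
      have h3 := Real.log_le_sub_one_of_pos h2
      simp only
      rw [div_le_iff₀ hε2]
      linarith
  have D : Tendsto (fun n => v - (1 + ε n * u) ^ 2 * (Real.log (1 + ε n ^ 2 * v) / ε n ^ 2)) atTop
      (𝓝 0) := by
    have := (tendsto_const_nhds (x := v)).sub
      ((((tendsto_const_nhds (x := (1 : ℝ))).add (hlim.mul_const u)).pow 2).mul B)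
    have e : v - (1 + 0 * u) ^ 2 * v = 0 := by ring
    rwa [e] at this
  have E := (A.add D).add_const (2 * u ^ 2)
  simp only [zero_add] at E
  refine E.congr fun n => ?_
  have hε2 : ε n ≠ 0 := (hε n).ne'
  simp only [entropyIntegrand, Real.log_one]
  field_simp
  ring

/-- Linearization: a logarithmic Sobolev inequality implies the Poincaré inequality with the
same constant. -/
theorem variance_le_of_entropy_le {m : Measure (Space N)} [IsProbabilityMeasure m] {c E : ℝ}
    (hc : 0 < c) {φ : Space N → ℝ} (hφ : MemLp φ 2 m)
    (h : ∀ a b : ℝ, Integrable (fun x => (a + b * φ x) ^ 2 * Real.log ((a + b * φ x) ^ 2)) m ∧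
      c * entropy m (fun x => (a + b * φ x) ^ 2) ≤ 2 * (b ^ 2 * E)) :
    c * variance φ m ≤ E := by
  obtain ⟨M, hM⟩ : ∃ M, M = ∫ x, φ x ∂m := ⟨_, rfl⟩
  obtain ⟨v, hv⟩ : ∃ v, v = variance φ m := ⟨_, rfl⟩
  have hv0 : 0 ≤ v := hv ▸ variance_nonneg _ _
  have hint : Integrable φ m := hφ.integrable one_le_two
  have hu : MemLp (fun x => φ x - M) 2 m := hφ.sub (memLp_const M)
  have hvar : v = ∫ x, (φ x - M) ^ 2 ∂m := by
    rw [hv, hM, variance_eq_integral hφ.1.aemeasurable]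
  obtain ⟨ε, hε0, hεlim⟩ : ∃ ε : ℕ → ℝ, (∀ n, 0 < ε n) ∧ Tendsto ε atTop (𝓝 0) :=
    ⟨fun n => 1 / ((n : ℝ) + 1), fun n => by positivity, tendsto_one_div_add_atTop_nhds_zero_nat⟩
  have hform : ∀ n x, (1 + ε n * (φ x - M)) = (1 - ε n * M) + ε n * φ x := fun n x => by ring
  have hmem : ∀ n, MemLp (fun x => 1 + ε n * (φ x - M)) 2 m := fun n =>
    (memLp_const (1 : ℝ)).add (hu.const_mul (ε n))
  have hmean : ∀ r : ℝ, ∫ x, (1 + r * (φ x - M)) ^ 2 ∂m = 1 + r ^ 2 * v := by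
    intro r
    have i1 : Integrable (fun x => φ x - M) m := hint.sub (integrable_const M)
    have e1 : ∫ x, (φ x - M) ∂m = 0 := by
      rw [integral_sub hint (integrable_const M)]
      simp [hM]
    have i2 : Integrable (fun x => 1 + 2 * r * (φ x - M)) m :=
      (integrable_const 1).add (i1.const_mul _)
    have i3 : Integrable (fun x => r ^ 2 * (φ x - M) ^ 2) m := hu.integrable_sq.const_mul _
    calc ∫ x, (1 + r * (φ x - M)) ^ 2 ∂m
        = ∫ x, ((1 + 2 * r * (φ x - M)) + r ^ 2 * (φ x - M) ^ 2) ∂m := by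
          refine integral_congr_ae (Eventually.of_forall fun x => ?_)
          simp only
          ring
      _ = _ := by
        rw [integral_add i2 i3, integral_add (integrable_const 1) (i1.const_mul _),
          integral_const_mul, integral_const_mul, e1, ← hvar]
        simp
  have hlog : ∀ n, Integrable (fun x => (1 + ε n * (φ x - M)) ^ 2 *
      Real.log ((1 + ε n * (φ x - M)) ^ 2)) m := fun n => by
    simp only [hform]
    exact (h _ _).1
  have hent : ∀ n, c * entropy m (fun x => (1 + ε n * (φ x - M)) ^ 2) ≤ 2 * (ε n ^ 2 * E) :=
    fun n => by
      simp only [hform]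
      exact (h _ _).2
  -- Rescaled entropy densities of `(1 + ε(φ - M))²`. They are nonnegative and converge pointwise to
  -- `2 (φ - M)²`, so Fatou suffices and `φ` need only be square integrable.
  set F : ℕ → Space N → ℝ := fun n x =>
    entropyIntegrand (1 + ε n ^ 2 * v) ((1 + ε n * (φ x - M)) ^ 2) / ε n ^ 2 with hF
  have hFi : ∀ n, Integrable (F n) m := fun n =>
    (integrable_entropyIntegrand (hmem n).integrable_sq (hlog n) _).div_const _
  have hF0 : ∀ n x, 0 ≤ F n x := fun n x =>
    div_nonneg (entropyIntegrand_nonneg (by positivity) (sq_nonneg _)) (sq_nonneg _)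
  have hFle : ∀ n, ∫ x, F n x ∂m ≤ 2 * E / c := fun n => by
    have h1 := hent n
    rw [entropy_eq_integral (hmem n).integrable_sq (hlog n), hmean] at h1
    have h2 := hε0 n
    rw [hF, integral_div, div_le_div_iff₀ (by positivity) hc]
    linarith
  have hFlim : ∀ x, Tendsto (fun n => F n x) atTop (𝓝 (2 * (φ x - M) ^ 2)) := fun x =>
    tendsto_entropyIntegrand_perturbation _ hv0 hε0 hεlim
  have key := (integrable_and_integral_le_of_tendsto (Eventually.of_forall fun n => ⟨hFi n, hF0 n⟩)
    (fun x => by positivity) (hu.integrable_sq.const_mul 2).aestronglyMeasurable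
    (Eventually.of_forall hFlim) (Eventually.of_forall hFle) tendsto_const_nhds).2
  rw [integral_const_mul, ← hvar, le_div_iff₀ hc] at key
  rw [← hv]
  linarith

/-- A condition `c * a ≤ b` with `a ≥ 0` survives passage to the supremum in `c`. The predicate `Q'`
holds the side condition that does not depend on `c`, namely integrability in the logarithmic
Sobolev case. -/
theorem isGreatest_sSup_of_linear {ι : Type*} {P : ι → Prop} {a b : ι → ℝ} {Q' : ι → Prop}
    {S : Set ℝ} (hS : S = {c | ∀ i, P i → Q' i ∧ c * a i ≤ b i}) (ha : ∀ i, P i → Q' i → 0 ≤ a i)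
    (hne : S.Nonempty) (hbdd : BddAbove S) : IsGreatest S (sSup S) := by
  have hmem : ∀ c, c ∈ S ↔ ∀ i, P i → Q' i ∧ c * a i ≤ b i := fun c => by rw [hS]; rfl
  refine ⟨?_, fun c hc => le_csSup hbdd hc⟩
  obtain ⟨c0, hc0⟩ := hne
  refine (hmem _).2 fun i hi => ?_
  have h0 := (hmem c0).1 hc0 i hi
  refine ⟨h0.1, ?_⟩
  rcases (ha i hi h0.1).eq_or_lt with h | h
  · have := h0.2
    rw [← h, mul_zero] at this ⊢
    exact this
  · rw [← le_div_iff₀ h]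
    refine csSup_le ⟨c0, hc0⟩ fun c hc => ?_
    rw [le_div_iff₀ h]
    exact ((hmem c).1 hc i hi).2

end

/-! ### Convexified energy and the lower bound for the logarithmic Sobolev constant. -/

theorem continuous_V (μ : ℝ) (N : ℕ) : Continuous (V μ N) := by
  unfold V
  fun_prop

theorem V_neg (μ : ℝ) (N : ℕ) (x : Space N) : V μ N (-x) = V μ N x := by
  unfold V
  congr 2
  · refine Finset.sum_congr rfl fun k _ => ?_
    simp only [PiLp.neg_apply]
    ring
  · congr 1
    refine Finset.sum_congr rfl fun k _ => ?_
    simp only [PiLp.neg_apply]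
    ring

theorem interaction_nonneg {μ : ℝ} (hμ : 0 ≤ μ) (N : ℕ) (x : Space N) :
    0 ≤ μ * ∑ k : Fin N, (x k - x (finRotate N k)) ^ 2 / (8 * Real.sin (Real.pi / N) ^ 2) :=
  mul_nonneg hμ (Finset.sum_nonneg fun k _ => by positivity)

theorem le_V {μ : ℝ} (hμ : 0 ≤ μ) (N : ℕ) (x : Space N) :
    1 / 2 * ‖x‖ ^ 2 - 3 / 4 * N ≤ V μ N x := by
  have h1 : 1 / 2 * ‖x‖ ^ 2 - 3 / 4 * N = ∑ k : Fin N, (x k ^ 2 / 2 - 1) + N / 4 := by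
    rw [EuclideanSpace.real_norm_sq_eq, Finset.sum_sub_distrib, ← Finset.sum_div]
    simp
    ring
  have h2 : ∑ k : Fin N, (x k ^ 2 / 2 - 1) ≤ ∑ k : Fin N, (x k ^ 4 / 4 - x k ^ 2 / 2) :=
    Finset.sum_le_sum fun k _ => by nlinarith [sq_nonneg (x k ^ 2 / 2 - 1)]
  have h3 := interaction_nonneg hμ N x
  unfold V
  linarith

theorem integrable_rexp_neg_mul_sq_norm {b : ℝ} (hb : 0 < b) (N : ℕ) :
    Integrable fun x : Space N => Real.exp (-b * ‖x‖ ^ 2) := by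
  have h := (GaussianFourier.integrable_cexp_neg_mul_sq_norm_add (V := Space N) (b := (b : ℂ))
    (by simpa using hb) 0 0).norm
  refine h.congr (Eventually.of_forall fun x => ?_)
  simp only [Complex.norm_exp]
  congr 1
  simp [← Complex.ofReal_pow]

theorem integrable_exp_neg_V {μ h : ℝ} (hμ : 0 ≤ μ) (hh : 0 < h) {N : ℕ} (hN : 1 ≤ N) :
    Integrable fun x : Space N => Real.exp (-(V μ N x / (h * N))) := by
  have hN' : (0 : ℝ) < N := by exact_mod_cast hN
  have hc := continuous_V μ N
  refine ((integrable_rexp_neg_mul_sq_norm (b := 1 / (2 * (h * N))) (by positivity) N).const_mul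
    (Real.exp (3 / 4 * N / (h * N)))).mono' (by fun_prop) (Eventually.of_forall fun x => ?_)
  rw [Real.norm_of_nonneg (Real.exp_pos _).le, ← Real.exp_add]
  refine Real.exp_le_exp.2 ?_
  have h1 := div_le_div_of_nonneg_right (le_V hμ N x) (by positivity : (0 : ℝ) ≤ h * N)
  rw [sub_div] at h1
  have h2 : 1 / (2 * (h * N)) * ‖x‖ ^ 2 = 1 / 2 * ‖x‖ ^ 2 / (h * N) := by field_simp
  linarith

/-- The convexified single-site potential. -/
noncomputable def convexSite (y : ℝ) : ℝ := max (y ^ 2 - 4 / 3) 0 ^ 2 / 4 + y ^ 2 / 6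

theorem le_convexSite (y : ℝ) : y ^ 4 / 4 - y ^ 2 / 2 ≤ convexSite y := by
  unfold convexSite
  rcases le_total (y ^ 2 - 4 / 3) 0 with h | h
  · rw [max_eq_right h]
    nlinarith [sq_nonneg y]
  · rw [max_eq_left h]
    nlinarith

/-- The gap is `4/9 - (y² - 4/3)²/4` for `y² ≤ 4/3` and exactly `4/9` beyond. A threshold `a > 1`
instead of `4/3` would give the coefficient `(a - 1)/2` of `y²` and the gap `a²/4`; the value `4/3`
keeps the gap below `(9 + 2√2)/24`. -/
theorem convexSite_le (y : ℝ) : convexSite y ≤ y ^ 4 / 4 - y ^ 2 / 2 + 4 / 9 := by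
  unfold convexSite
  rcases le_total (y ^ 2 - 4 / 3) 0 with h | h
  · rw [max_eq_right h]
    nlinarith [sq_nonneg (y ^ 2 - 4 / 3)]
  · rw [max_eq_left h]
    nlinarith

/-- The square of a nonnegative convex function is convex. The remaining `y²/6` is the source of the
modulus `1/3`. -/
theorem convexOn_convexSite_sub : ConvexOn ℝ Set.univ fun y => convexSite y - y ^ 2 / 6 := by
  have h1 : ConvexOn ℝ Set.univ fun y : ℝ => y ^ 2 - 4 / 3 := by
    have := (even_two.convexOn_pow (𝕜 := ℝ)).add (convexOn_const (-(4 / 3 : ℝ)) convex_univ)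
    refine this.congr fun y _ => ?_
    simp [sub_eq_add_neg]
  have h2 : ConvexOn ℝ Set.univ fun y : ℝ => max (y ^ 2 - 4 / 3) 0 :=
    h1.sup (convexOn_const 0 convex_univ)
  have h3 := (h2.pow (fun y _ => le_max_right _ _) 2).smul (c := (1 / 4 : ℝ)) (by norm_num)
  refine h3.congr fun y _ => ?_
  simp only [convexSite, Pi.pow_apply, smul_eq_mul]
  ring

theorem continuous_convexSite : Continuous convexSite := by
  unfold convexSite
  fun_prop

theorem convexOn_sum {E ι : Type*} [AddCommGroup E] [Module ℝ E] (s : Finset ι) {f : ι → E → ℝ}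
    (h : ∀ i ∈ s, ConvexOn ℝ Set.univ (f i)) : ConvexOn ℝ Set.univ fun x => ∑ i ∈ s, f i x := by
  classical
  induction s using Finset.induction_on with
  | empty => simpa using convexOn_const (0 : ℝ) convex_univ
  | insert a s ha ih =>
    simp only [Finset.sum_insert ha]
    exact (h a (Finset.mem_insert_self _ _)).add
      (ih fun i hi => h i (Finset.mem_insert_of_mem hi))

/-- The convexified energy. -/
noncomputable def convexEnergy (μ : ℝ) (N : ℕ) (x : Space N) : ℝ :=
  ∑ k : Fin N, convexSite (x k)
    + μ * ∑ k : Fin N, (x k - x (finRotate N k)) ^ 2 / (8 * Real.sin (Real.pi / N) ^ 2)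
    + N / 4

theorem continuous_convexEnergy (μ : ℝ) (N : ℕ) : Continuous (convexEnergy μ N) := by
  unfold convexEnergy
  have := continuous_convexSite
  fun_prop

theorem V_le_convexEnergy (μ : ℝ) (N : ℕ) (x : Space N) : V μ N x ≤ convexEnergy μ N x := by
  unfold V convexEnergy
  have : ∑ k : Fin N, (x k ^ 4 / 4 - x k ^ 2 / 2) ≤ ∑ k : Fin N, convexSite (x k) :=
    Finset.sum_le_sum fun k _ => le_convexSite _
  linarith

theorem convexEnergy_le_V (μ : ℝ) (N : ℕ) (x : Space N) :
    convexEnergy μ N x ≤ V μ N x + 4 / 9 * N := by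
  unfold V convexEnergy
  have : ∑ k : Fin N, convexSite (x k) ≤ ∑ k : Fin N, (x k ^ 4 / 4 - x k ^ 2 / 2 + 4 / 9) :=
    Finset.sum_le_sum fun k _ => convexSite_le _
  rw [Finset.sum_add_distrib] at this
  simp only [Finset.sum_const, Finset.card_univ, Fintype.card_fin, nsmul_eq_mul] at this
  linarith

theorem strongConvexOn_convexEnergy {μ : ℝ} (hμ : 0 ≤ μ) (N : ℕ) {r : ℝ} (hr : 0 < r) :
    StrongConvexOn Set.univ (1 / (3 * r)) fun x : Space N => convexEnergy μ N x / r := by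
  rw [strongConvexOn_iff_convex]
  have h1 : ConvexOn ℝ Set.univ fun x : Space N => ∑ k : Fin N, (convexSite (x k) - x k ^ 2 / 6) :=
    convexOn_sum _ fun k _ =>
      convexOn_convexSite_sub.comp_linearMap (EuclideanSpace.proj (𝕜 := ℝ) k).toLinearMap
  have h2 : ConvexOn ℝ Set.univ fun x : Space N => ∑ k : Fin N, (x k - x (finRotate N k)) ^ 2 :=
    convexOn_sum _ fun k _ =>
      (even_two.convexOn_pow (𝕜 := ℝ)).comp_linearMap ((EuclideanSpace.proj (𝕜 := ℝ) k -
        EuclideanSpace.proj (𝕜 := ℝ) (finRotate N k) : Space N →L[ℝ] ℝ)).toLinearMap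
  have h3 := ((h1.add (h2.smul (c := μ / (8 * Real.sin (Real.pi / N) ^ 2)) (by positivity))).add
    (convexOn_const ((N : ℝ) / 4) convex_univ)).smul (c := 1 / r) (by positivity)
  refine h3.congr fun x _ => ?_
  simp only [convexEnergy, Pi.add_apply, smul_eq_mul, Finset.sum_sub_distrib]
  rw [EuclideanSpace.real_norm_sq_eq, ← Finset.sum_div, ← Finset.sum_div]
  field_simp
  ring

/-- The logarithmic Sobolev inequality for the equilibrium measure. -/
theorem mem_logSobolevConstants {μ h : ℝ} (hμ : 0 ≤ μ) (hh : 0 < h) {N : ℕ} (hN : 1 ≤ N) :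
    1 / 3 * Real.exp (-(4 / (9 * h))) ∈ logSobolevConstants μ h N := by
  have hN' : (0 : ℝ) < N := by exact_mod_cast hN
  intro φ G hφG
  have hr : 0 < h * N := by positivity
  have hU : Continuous fun x : Space N => V μ N x / (h * N) := (continuous_V μ N).div_const _
  have hU' : Continuous fun x : Space N => convexEnergy μ N x / (h * N) :=
    (continuous_convexEnergy μ N).div_const _
  have hint := integrable_exp_neg_V hμ hh hN
  have hle : ∀ x : Space N, V μ N x / (h * N) ≤ convexEnergy μ N x / (h * N) := fun x =>
    div_le_div_of_nonneg_right (V_le_convexEnergy μ N x) hr.le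
  have hle' : ∀ x : Space N,
      convexEnergy μ N x / (h * N) ≤ V μ N x / (h * N) + 4 / (9 * h) := fun x => by
    have h1 : V μ N x / (h * N) + 4 / (9 * h) = (V μ N x + 4 / 9 * N) / (h * N) := by
      field_simp
    rw [h1]
    exact div_le_div_of_nonneg_right (convexEnergy_le_V μ N x) hr.le
  have hint' : Integrable fun x : Space N => Real.exp (-(convexEnergy μ N x / (h * N))) := by
    refine hint.mono' (Real.continuous_exp.comp hU'.neg).aestronglyMeasurable
      (Eventually.of_forall fun x => ?_)
    rw [Real.norm_of_nonneg (Real.exp_pos _).le]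
    exact Real.exp_le_exp.2 (neg_le_neg (hle x))
  -- Holley–Stroock factor `exp(4/(9h))` times the Bakry–Émery constant `2/κ` with `κ = 1/(3hN)`.
  have key := logSobolev_of_memH1 hU hint
    (K := Real.exp (4 / (9 * h)) * (2 / (1 / (3 * (h * N))))) (by positivity)
    (fun f hf hfc => holleyStroock hU hU' hint hle hle' hf hfc (by positivity)
      (tilted_logSobolev (by positivity) hU' hint' (strongConvexOn_convexEnergy hμ N hr) hf hfc))
    hφG
  refine ⟨key.1, ?_⟩
  have h2 := mul_le_mul_of_nonneg_left key.2
    (by positivity : 0 ≤ 1 / 3 * Real.exp (-(4 / (9 * h))))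
  refine h2.trans (le_of_eq ?_)
  have h3 : Real.exp (-(4 / (9 * h))) * Real.exp (4 / (9 * h)) = 1 := by
    rw [← Real.exp_add]; simp
  change 1 / 3 * Real.exp (-(4 / (9 * h))) * (Real.exp (4 / (9 * h)) *
    (2 / (1 / (3 * (h * N)))) * ∫ x, ‖G x‖ ^ 2 ∂(gibbs μ h N)) = _
  calc _ = (Real.exp (-(4 / (9 * h))) * Real.exp (4 / (9 * h))) *
      (1 / 3 * (2 / (1 / (3 * (h * N)))) * ∫ x, ‖G x‖ ^ 2 ∂(gibbs μ h N)) := by ring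
    _ = _ := by rw [h3]; field_simp

theorem isProbabilityMeasure_gibbs {μ h : ℝ} (hμ : 0 ≤ μ) (hh : 0 < h) {N : ℕ} (hN : 1 ≤ N) :
    IsProbabilityMeasure (gibbs μ h N) :=
  isProbabilityMeasure_tilted (integrable_exp_neg_V hμ hh hN)

theorem logSobolevConstants_pos_subset {μ h : ℝ} (hμ : 0 ≤ μ) (hh : 0 < h) {N : ℕ} (hN : 1 ≤ N)
    {c : ℝ} (hc : 0 < c) (hmem : c ∈ logSobolevConstants μ h N) : c ∈ poincareConstants μ h N := by
  have := isProbabilityMeasure_gibbs hμ hh hN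
  intro φ G hφG
  refine variance_le_of_entropy_le hc hφG.2.1 fun a b => ?_
  have hH1 : MemH1 (gibbs μ h N) (fun x => a + b * φ x) (fun x => b • G x) :=
    ⟨hφG.1.affine a b, (memLp_const a).add (hφG.2.1.const_mul b), hφG.2.2.const_smul b⟩
  obtain ⟨h1, h2⟩ := hmem _ _ hH1
  refine ⟨h1, h2.trans (le_of_eq ?_)⟩
  simp only [norm_smul, mul_pow, Real.norm_eq_abs, sq_abs]
  rw [integral_const_mul]
  ring

/-- A single function of positive variance bounds the admissible Poincaré constants from above. Full
support of the measure turns almost-sure constancy of a bump into constancy. -/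
theorem exists_memH1_variance_pos {μ h : ℝ} (hμ : 0 ≤ μ) (hh : 0 < h) {N : ℕ} (hN : 1 ≤ N) :
    ∃ (φ : Space N → ℝ) (G : Space N → Space N), MemH1 (gibbs μ h N) φ G ∧
      0 < variance φ (gibbs μ h N) := by
  have := isProbabilityMeasure_gibbs hμ hh hN
  let b : ContDiffBump (0 : Space N) := ⟨1, 2, one_pos, one_lt_two⟩
  have hb1 : ContDiff ℝ 1 b := b.contDiff
  have hbm : MemLp b 2 (gibbs μ h N) := b.continuous.memLp_of_hasCompactSupport b.hasCompactSupport
  refine ⟨b, gradient b, ⟨isWeakGradient_of_contDiff hb1, hbm, ?_⟩, ?_⟩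
  · refine (continuous_gradient hb1).memLp_of_hasCompactSupport ?_
    exact (b.hasCompactSupport.fderiv ℝ).comp_left (g := (InnerProductSpace.toDual ℝ _).symm)
      (by simp)
  · refine lt_of_le_of_ne (variance_nonneg _ _) fun hv => ?_
    have h1 := ae_eq_integral_of_variance_eq_zero hbm hv.symm
    have h2 : b =ᵐ[volume] fun _ => ∫ x, b x ∂(gibbs μ h N) :=
      (absolutelyContinuous_tilted (integrable_exp_neg_V hμ hh hN)).ae_le h1
    have h3 := (Continuous.ae_eq_iff_eq volume b.continuous continuous_const).1 h2
    have h4 : b 0 = b (EuclideanSpace.single (⟨0, hN⟩ : Fin N) (3 : ℝ)) := by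
      rw [h3]
    rw [b.one_of_mem_closedBall (by simp [b]), b.zero_of_le_dist (by simp [b]; norm_num)] at h4
    exact one_ne_zero h4

theorem bddAbove_poincareConstants {μ h : ℝ} (hμ : 0 ≤ μ) (hh : 0 < h) {N : ℕ} (hN : 1 ≤ N) :
    BddAbove (poincareConstants μ h N) := by
  obtain ⟨φ, G, hφG, hv⟩ := exists_memH1_variance_pos hμ hh hN
  refine ⟨h * N * (∫ x, ‖G x‖ ^ 2 ∂(gibbs μ h N)) / variance φ (gibbs μ h N), fun c hc => ?_⟩
  rw [le_div_iff₀ hv]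
  exact hc φ G hφG

theorem bddAbove_logSobolevConstants {μ h : ℝ} (hμ : 0 ≤ μ) (hh : 0 < h) {N : ℕ} (hN : 1 ≤ N) :
    BddAbove (logSobolevConstants μ h N) := by
  obtain ⟨M, hM⟩ := bddAbove_poincareConstants hμ hh hN
  refine ⟨max M 0, fun c hc => ?_⟩
  rcases le_or_gt c 0 with h0 | h0
  · exact h0.trans (le_max_right _ _)
  · exact (hM (logSobolevConstants_pos_subset hμ hh hN h0 hc)).trans (le_max_left _ _)

theorem isGreatest_logSobolevConstant {μ h : ℝ} (hμ : 0 ≤ μ) (hh : 0 < h) {N : ℕ} (hN : 1 ≤ N) :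
    IsGreatest (logSobolevConstants μ h N) (logSobolevConstant μ h N) := by
  have := isProbabilityMeasure_gibbs hμ hh hN
  refine isGreatest_sSup_of_linear (ι := (Space N → ℝ) × (Space N → Space N))
    (P := fun p => MemH1 (gibbs μ h N) p.1 p.2)
    (Q' := fun p => Integrable (fun x => p.1 x ^ 2 * Real.log (p.1 x ^ 2)) (gibbs μ h N))
    (a := fun p => entropy (gibbs μ h N) fun x => p.1 x ^ 2)
    (b := fun p => 2 * (h * N) * ∫ x, ‖p.2 x‖ ^ 2 ∂(gibbs μ h N)) ?_ ?_
    ⟨_, mem_logSobolevConstants hμ hh hN⟩ (bddAbove_logSobolevConstants hμ hh hN)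
  · ext c
    simp only [logSobolevConstants, Set.mem_ofPred_eq, Prod.forall]
  · rintro ⟨φ, G⟩ hφ hi
    exact entropy_nonneg (fun _ => sq_nonneg _) hφ.2.1.integrable_sq hi

theorem isGreatest_poincareConstant {μ h : ℝ} (hμ : 0 ≤ μ) (hh : 0 < h) {N : ℕ} (hN : 1 ≤ N) :
    IsGreatest (poincareConstants μ h N) (poincareConstant μ h N) := by
  refine isGreatest_sSup_of_linear (ι := (Space N → ℝ) × (Space N → Space N))
    (P := fun p => MemH1 (gibbs μ h N) p.1 p.2) (Q' := fun _ => True)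
    (a := fun p => variance p.1 (gibbs μ h N))
    (b := fun p => h * N * ∫ x, ‖p.2 x‖ ^ 2 ∂(gibbs μ h N)) ?_ ?_
    ⟨_, logSobolevConstants_pos_subset hμ hh hN (by positivity)
      (mem_logSobolevConstants hμ hh hN)⟩ (bddAbove_poincareConstants hμ hh hN)
  · ext c
    simp only [poincareConstants, Set.mem_ofPred_eq, Prod.forall, true_and]
  · exact fun p _ _ => variance_nonneg _ _

theorem le_logSobolevConstant {μ h : ℝ} (hμ : 0 ≤ μ) (hh : 0 < h) {N : ℕ} (hN : 1 ≤ N) :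
    1 / 3 * Real.exp (-(4 / (9 * h))) ≤ logSobolevConstant μ h N :=
  (isGreatest_logSobolevConstant hμ hh hN).2 (mem_logSobolevConstants hμ hh hN)

theorem logSobolevConstant_le_poincareConstant {μ h : ℝ} (hμ : 0 ≤ μ) (hh : 0 < h) {N : ℕ}
    (hN : 1 ≤ N) : logSobolevConstant μ h N ≤ poincareConstant μ h N :=
  (isGreatest_poincareConstant hμ hh hN).2 (logSobolevConstants_pos_subset hμ hh hN
    (lt_of_lt_of_le (by positivity) (le_logSobolevConstant hμ hh hN))
    (isGreatest_logSobolevConstant hμ hh hN).1)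

theorem exp_le_logSobolevConstant {μ h δ : ℝ} (hμ : 0 ≤ μ) (hh : 0 < h) (hδ : 0 < δ) {N : ℕ}
    (hN : 1 ≤ N) :
    1 / 3 * Real.exp (-((3 + 2 * Real.sqrt 2 + δ) / (24 * h))) * Real.exp (-(1 / (4 * h)))
      ≤ logSobolevConstant μ h N := by
  refine le_trans ?_ (le_logSobolevConstant hμ hh hN)
  rw [mul_assoc, ← Real.exp_add]
  refine mul_le_mul_of_nonneg_left (Real.exp_le_exp.2 ?_) (by norm_num)
  -- The comparison is `9 + 2√2 + δ ≥ 24 · 4/9 = 32/3`, for which `√2 ≥ 1` is enough.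
  have h2 : (1 : ℝ) ≤ Real.sqrt 2 := Real.one_le_sqrt.2 (by norm_num)
  have h3 : -((3 + 2 * Real.sqrt 2 + δ) / (24 * h)) + -(1 / (4 * h)) - -(4 / (9 * h))
      = -((9 + 2 * Real.sqrt 2 + δ - 32 / 3) / (24 * h)) := by
    field_simp
    ring
  have h4 : 0 ≤ (9 + 2 * Real.sqrt 2 + δ - 32 / 3) / (24 * h) :=
    div_nonneg (by linarith) (by positivity)
  linarith

/-! ### Determinants of the cyclic shift and of the periodic Laplacian. -/

section CyclicShift

open Matrix

/-- The matrix of the cyclic shift `(w_k) ↦ (w_{k+1})`. -/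
def shiftMatrix (R : Type*) [Zero R] [One R] (N : ℕ) : Matrix (Fin N) (Fin N) R :=
  (finRotate N).permMatrix R

theorem shiftMatrix_mulVec {R : Type*} [CommRing R] {N : ℕ} (v : Fin N → R) (k : Fin N) :
    (shiftMatrix R N *ᵥ v) k = v (finRotate N k) := by
  rw [shiftMatrix, permMatrix_mulVec]; rfl

theorem shiftMatrix_mul_transpose (R : Type*) [CommRing R] (N : ℕ) :
    shiftMatrix R N * (shiftMatrix R N)ᵀ = 1 := by
  rw [shiftMatrix, transpose_permMatrix, ← permMatrix_mul]
  simp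

theorem transpose_mul_shiftMatrix (R : Type*) [CommRing R] (N : ℕ) :
    (shiftMatrix R N)ᵀ * shiftMatrix R N = 1 := by
  rw [shiftMatrix, transpose_permMatrix, ← permMatrix_mul]
  simp

/-- Both polynomials are monic of degree `N` and vanish at the `N` roots of unity `ζ`, the vector
`(ζ^k)` being an eigenvector. -/
theorem charpoly_shiftMatrix {N : ℕ} (hN : 1 ≤ N) :
    (shiftMatrix ℂ N).charpoly = Polynomial.X ^ N - 1 := by
  obtain ⟨n, rfl⟩ : ∃ n, N = n + 1 := ⟨N - 1, by omega⟩
  have hprim := Complex.isPrimitiveRoot_exp (n + 1) n.succ_ne_zero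
  have hdeg : ((Polynomial.X : Polynomial ℂ) ^ (n + 1) - 1).natDegree = n + 1 :=
    Polynomial.natDegree_X_pow_sub_C (r := (1 : ℂ))
  have hmonic : ((Polynomial.X : Polynomial ℂ) ^ (n + 1) - 1).Monic :=
    Polynomial.monic_X_pow_sub_C (1 : ℂ) n.succ_ne_zero
  refine Polynomial.eq_of_degree_sub_lt_of_eval_finset_eq
    (Polynomial.nthRootsFinset (n + 1) (1 : ℂ)) ?_ ?_
  · rw [hprim.card_nthRootsFinset]
    refine (Polynomial.degree_sub_lt_left ?_ (charpoly_monic _).ne_zero ?_).trans_le ?_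
    · rw [charpoly_degree_eq_dim, Polynomial.degree_eq_natDegree hmonic.ne_zero, hdeg,
        Fintype.card_fin]
    · rw [(charpoly_monic _).leadingCoeff, hmonic.leadingCoeff]
    · rw [charpoly_degree_eq_dim, Fintype.card_fin]
  · intro ζ hζ
    rw [Polynomial.mem_nthRootsFinset n.succ_pos] at hζ
    have h0 : ζ ≠ 0 := by
      rintro rfl
      simp at hζ
    rw [eval_charpoly]
    simp only [Polynomial.eval_sub, Polynomial.eval_pow, Polynomial.eval_X, Polynomial.eval_one,
      hζ, sub_self]
    refine exists_mulVec_eq_zero_iff.1 ⟨fun k => ζ ^ (k : ℕ), fun h => ?_, ?_⟩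
    · simpa using congr_fun h 0
    · ext k
      rw [sub_mulVec, Pi.sub_apply, shiftMatrix_mulVec]
      simp only [scalar_apply, mulVec_diagonal, Pi.zero_apply, coe_finRotate]
      split_ifs with hk
      · subst hk
        simp [← pow_succ', hζ]
      · ring

theorem det_smul_sub_shiftMatrix {N : ℕ} (hN : 1 ≤ N) (z : ℂ) :
    (z • (1 : Matrix (Fin N) (Fin N) ℂ) - shiftMatrix ℂ N).det = z ^ N - 1 := by
  have := eval_charpoly (shiftMatrix ℂ N) z
  rw [charpoly_shiftMatrix hN] at this
  simpa [smul_one_eq_diagonal] using this.symm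

/-- The periodic second difference `w ↦ 2 w_k - w_{k+1} - w_{k-1}`. -/
def cyclicLaplacian (R : Type*) [CommRing R] (N : ℕ) : Matrix (Fin N) (Fin N) R :=
  (1 - shiftMatrix R N)ᵀ * (1 - shiftMatrix R N)

/-- For the shift `S`, the identity `S Sᵀ = 1` factors the matrix as `z⁻¹ (z - S)(z - S)ᵀ`. -/
theorem det_smul_add_cyclicLaplacian {N : ℕ} (hN : 1 ≤ N) {z : ℂ} (hz : z ≠ 0) :
    ((z + z⁻¹ - 2) • (1 : Matrix (Fin N) (Fin N) ℂ) + cyclicLaplacian ℂ N).det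
      = z ^ N + (z ^ N)⁻¹ - 2 := by
  have h1 : (z + z⁻¹ - 2) • (1 : Matrix (Fin N) (Fin N) ℂ) + cyclicLaplacian ℂ N
      = z⁻¹ • ((z • (1 : Matrix (Fin N) (Fin N) ℂ) - shiftMatrix ℂ N) *
          (z • (1 : Matrix (Fin N) (Fin N) ℂ) - shiftMatrix ℂ N)ᵀ) := by
    rw [cyclicLaplacian]
    simp only [transpose_sub, transpose_one, transpose_smul, sub_mul, mul_sub, one_mul, mul_one,
      transpose_mul_shiftMatrix, shiftMatrix_mul_transpose, smul_mul_assoc, mul_smul_comm,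
      smul_sub, smul_smul, inv_mul_cancel₀ hz, one_smul]
    rw [show z⁻¹ * (z * z) = z by field_simp]
    module
  rw [h1, det_smul, det_mul, det_transpose, det_smul_sub_shiftMatrix hN, Fintype.card_fin, inv_pow]
  field_simp
  ring

theorem cyclicLaplacian_map (N : ℕ) :
    (cyclicLaplacian ℝ N).map (algebraMap ℝ ℂ) = cyclicLaplacian ℂ N := by
  have h : (shiftMatrix ℝ N).map (algebraMap ℝ ℂ) = shiftMatrix ℂ N := by
    ext i j
    simp [shiftMatrix, Equiv.Perm.permMatrix, PEquiv.toMatrix_apply, apply_ite Complex.ofReal]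
  have h' : (1 - shiftMatrix ℝ N).map (algebraMap ℝ ℂ) = 1 - shiftMatrix ℂ N := by
    rw [Matrix.map_sub _ (map_sub _), h, Matrix.map_one _ (map_zero _) (map_one _)]
  rw [cyclicLaplacian, Matrix.map_mul, transpose_map, h', cyclicLaplacian]

theorem ofReal_det_smul_add_cyclicLaplacian (N : ℕ) (c : ℝ) :
    ((c • (1 : Matrix (Fin N) (Fin N) ℝ) + cyclicLaplacian ℝ N).det : ℂ)
      = ((c : ℂ) • (1 : Matrix (Fin N) (Fin N) ℂ) + cyclicLaplacian ℂ N).det := by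
  have := RingHom.map_det (algebraMap ℝ ℂ) (c • (1 : Matrix (Fin N) (Fin N) ℝ) + cyclicLaplacian ℝ N)
  rw [Complex.coe_algebraMap] at this
  rw [this, map_add, ← cyclicLaplacian_map]
  congr 2
  ext i j
  simp [Matrix.one_apply, apply_ite Complex.ofReal]

/-- The case `z = e^{2iα}` of the complex determinant formula; `z = e^{2α}` gives the hyperbolic
counterpart. -/
theorem det_sub_sin_sq {N : ℕ} (hN : 1 ≤ N) (α : ℝ) :
    (-(4 * Real.sin α ^ 2) • (1 : Matrix (Fin N) (Fin N) ℝ) + cyclicLaplacian ℝ N).det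
      = -(4 * Real.sin (N * α) ^ 2) := by
  have key : ∀ β : ℝ, ((-(4 * Real.sin β ^ 2) : ℝ) : ℂ)
      = Complex.exp (2 * β * Complex.I) + (Complex.exp (2 * β * Complex.I))⁻¹ - 2 := by
    intro β
    have h1 : Complex.exp (2 * β * Complex.I) = Complex.exp (β * Complex.I) ^ 2 := by
      rw [← Complex.exp_nat_mul]; congr 1; push_cast; ring
    push_cast
    rw [Complex.sin, h1, neg_mul, Complex.exp_neg]
    have := Complex.exp_ne_zero (β * Complex.I)
    field_simp
    rw [Complex.I_sq]
    ring
  apply Complex.ofReal_injective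
  rw [ofReal_det_smul_add_cyclicLaplacian, key, key,
    det_smul_add_cyclicLaplacian hN (Complex.exp_ne_zero _), ← Complex.exp_nat_mul]
  push_cast
  ring_nf

theorem det_add_sinh_sq {N : ℕ} (hN : 1 ≤ N) (α : ℝ) :
    ((4 * Real.sinh α ^ 2) • (1 : Matrix (Fin N) (Fin N) ℝ) + cyclicLaplacian ℝ N).det
      = 4 * Real.sinh (N * α) ^ 2 := by
  have key : ∀ β : ℝ, ((4 * Real.sinh β ^ 2 : ℝ) : ℂ)
      = Complex.exp (2 * β) + (Complex.exp (2 * β))⁻¹ - 2 := by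
    intro β
    have h1 : Complex.exp (2 * β) = Complex.exp β ^ 2 := by
      rw [← Complex.exp_nat_mul]; congr 1
    push_cast
    rw [Complex.sinh, h1, Complex.exp_neg]
    have := Complex.exp_ne_zero β
    field_simp
    ring
  apply Complex.ofReal_injective
  rw [ofReal_det_smul_add_cyclicLaplacian, key, key,
    det_smul_add_cyclicLaplacian hN (Complex.exp_ne_zero _), ← Complex.exp_nat_mul]
  push_cast
  ring_nf

end CyclicShift

/-! ### Quadratic forms at the critical points and the discrete Wirtinger inequality. -/

section Quadratic

open Matrix

/-- The coupling constant `μ / (4 sin²(π/N))` between neighbouring sites. -/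
noncomputable def coupling (μ : ℝ) (N : ℕ) : ℝ := μ / (4 * Real.sin (Real.pi / N) ^ 2)

theorem coupling_nonneg {μ : ℝ} (hμ : 0 ≤ μ) (N : ℕ) : 0 ≤ coupling μ N := by
  unfold coupling; positivity

/-- The Hessian of `V` at a constant configuration `a` with `c = 3 a ^ 2 - 1`. -/
noncomputable def quadraticMatrix (μ c : ℝ) (N : ℕ) : Matrix (Fin N) (Fin N) ℝ :=
  c • 1 + coupling μ N • cyclicLaplacian ℝ N

theorem dotProduct_cyclicLaplacian_mulVec {N : ℕ} (u v : Fin N → ℝ) :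
    u ⬝ᵥ (cyclicLaplacian ℝ N *ᵥ v)
      = ∑ k, (u k - u (finRotate N k)) * (v k - v (finRotate N k)) := by
  rw [cyclicLaplacian, ← mulVec_mulVec, dotProduct_mulVec, vecMul_transpose, sub_mulVec, sub_mulVec,
    one_mulVec, one_mulVec, dotProduct]
  simp [shiftMatrix_mulVec]

theorem dotProduct_quadraticMatrix_mulVec (μ c : ℝ) {N : ℕ} (u v : Fin N → ℝ) :
    u ⬝ᵥ (quadraticMatrix μ c N *ᵥ v) = c * ∑ k, u k * v k
      + coupling μ N * ∑ k, (u k - u (finRotate N k)) * (v k - v (finRotate N k)) := by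
  rw [quadraticMatrix, add_mulVec, dotProduct_add, smul_mulVec, smul_mulVec, dotProduct_smul,
    dotProduct_smul, dotProduct_cyclicLaplacian_mulVec, one_mulVec, dotProduct]
  simp

theorem cyclicLaplacian_mulVec_const {N : ℕ} (a : ℝ) :
    cyclicLaplacian ℝ N *ᵥ (fun _ => a) = 0 := by
  rw [cyclicLaplacian, ← mulVec_mulVec]
  have : (1 - shiftMatrix ℝ N) *ᵥ (fun _ => a) = 0 := by
    ext k
    rw [sub_mulVec, Pi.sub_apply, shiftMatrix_mulVec, one_mulVec]
    simp
  rw [this, mulVec_zero]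

theorem isSymm_cyclicLaplacian (N : ℕ) : (cyclicLaplacian ℝ N)ᵀ = cyclicLaplacian ℝ N := by
  rw [cyclicLaplacian, transpose_mul, transpose_transpose]

theorem transpose_quadraticMatrix (μ c : ℝ) (N : ℕ) :
    (quadraticMatrix μ c N)ᵀ = quadraticMatrix μ c N := by
  rw [quadraticMatrix, transpose_add, transpose_smul, transpose_smul, transpose_one,
    isSymm_cyclicLaplacian]

theorem posDef_quadraticMatrix {μ c : ℝ} (hμ : 0 ≤ μ) (hc : 0 < c) (N : ℕ) :
    (quadraticMatrix μ c N).PosDef := by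
  refine PosDef.of_dotProduct_mulVec_pos ?_ fun x hx => ?_
  · rw [IsHermitian, conjTranspose_eq_transpose_of_trivial, transpose_quadraticMatrix]
  · rw [star_trivial, dotProduct_quadraticMatrix_mulVec]
    have h1 : 0 < ∑ k, x k * x k := by
      obtain ⟨k, hk⟩ := Function.ne_iff.1 hx
      exact Finset.sum_pos' (fun i _ => mul_self_nonneg _) ⟨k, Finset.mem_univ _, mul_self_pos.2 hk⟩
    have h2 : 0 ≤ ∑ k, (x k - x (finRotate N k)) * (x k - x (finRotate N k)) :=
      Finset.sum_nonneg fun i _ => mul_self_nonneg _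
    have := mul_nonneg (coupling_nonneg hμ N) h2
    positivity

theorem eq_of_forall_finRotate {n : ℕ} {v : Fin (n + 1) → ℝ} (h : ∀ k, v k = v (finRotate _ k))
    (k : Fin (n + 1)) : v k = v 0 := by
  induction k using Fin.induction with
  | zero => rfl
  | succ i ih => rw [← ih, h i.castSucc, finRotate_apply, Fin.coeSucc_eq_succ]

/-- The Hessian of `V` at the saddle point `0`, with the sign of the unstable direction flipped. -/
noncomputable def saddleMatrix (μ : ℝ) (N : ℕ) : Matrix (Fin N) (Fin N) ℝ :=
  quadraticMatrix μ (-1) N + (2 / N : ℝ) • vecMulVec 1 1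

theorem dotProduct_saddleMatrix_mulVec (μ : ℝ) {N : ℕ} (u v : Fin N → ℝ) :
    u ⬝ᵥ (saddleMatrix μ N *ᵥ v)
      = u ⬝ᵥ (quadraticMatrix μ (-1) N *ᵥ v) + 2 / N * ((∑ k, u k) * ∑ k, v k) := by
  rw [saddleMatrix, add_mulVec, dotProduct_add, smul_mulVec, dotProduct_smul, vecMulVec_mulVec,
    dotProduct_smul]
  simp [dotProduct, mul_comm]

/-- Constants are eigenvectors of the Hessian with eigenvalue -1, so the rank-one correction amounts
to composing with the reflection in the hyperplane of mean-zero vectors, of determinant -1. -/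
theorem det_saddleMatrix (μ : ℝ) {N : ℕ} (hN : 1 ≤ N) :
    (saddleMatrix μ N).det = -(quadraticMatrix μ (-1) N).det := by
  have hN' : (N : ℝ) ≠ 0 := by positivity
  have h0 : (1 : Fin N → ℝ) ᵥ* quadraticMatrix μ (-1) N = fun _ => -1 := by
    rw [← mulVec_transpose, transpose_quadraticMatrix, quadraticMatrix, add_mulVec, smul_mulVec,
      smul_mulVec, one_mulVec]
    have := cyclicLaplacian_mulVec_const (N := N) 1
    rw [show (1 : Fin N → ℝ) = fun _ => 1 from rfl, this]
    ext; simp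
  have h1 : saddleMatrix μ N
      = (1 - (2 / N : ℝ) • vecMulVec 1 1) * quadraticMatrix μ (-1) N := by
    rw [sub_mul, one_mul, saddleMatrix, smul_mul_assoc, vecMulVec_mul, h0, sub_eq_add_neg]
    congr 1
    ext i j
    simp
  have h2 : (1 - (2 / N : ℝ) • vecMulVec (1 : Fin N → ℝ) 1).det = -1 := by
    have := det_one_add_replicateCol_mul_replicateRow (ι := Unit) (fun _ : Fin N => -(2 / N : ℝ)) 1
    rw [← vecMulVec_eq] at this
    rw [show 1 - (2 / N : ℝ) • vecMulVec (1 : Fin N → ℝ) 1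
      = 1 + vecMulVec (fun _ : Fin N => -(2 / N : ℝ)) 1 by
        ext i j; simp [sub_eq_add_neg], this]
    simp [dotProduct]
    field_simp
    norm_num
  rw [h1, det_mul, h2]
  ring

theorem sin_pi_div_pos {N : ℕ} (hN : 2 ≤ N) : 0 < Real.sin (Real.pi / N) := by
  have h2 : (2 : ℝ) ≤ N := by exact_mod_cast hN
  refine Real.sin_pos_of_pos_of_lt_pi (by positivity) ?_
  rw [div_lt_iff₀ (by linarith)]
  nlinarith [Real.pi_pos]

theorem mul_arcsin_lt_pi {N : ℕ} (hN : 2 ≤ N) {y : ℝ} (hy : y < Real.sin (Real.pi / N)) :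
    N * Real.arcsin y < Real.pi := by
  have h2 : (2 : ℝ) ≤ N := by exact_mod_cast hN
  have h3 : Real.pi / N ≤ Real.pi / 2 :=
    div_le_div_of_nonneg_left Real.pi_pos.le (by norm_num) h2
  have h4 : 0 < Real.pi / N := by positivity
  have h5 := (Real.arcsin_lt_iff_lt_sin' ⟨by linarith [Real.pi_pos], h3⟩).2 hy
  rw [lt_div_iff₀ (by linarith)] at h5
  linarith

/-- The discrete Wirtinger inequality, as an exclusion of eigenvalues. -/
theorem eq_zero_of_cyclicLaplacian_mulVec {N : ℕ} (hN : 2 ≤ N) {t : ℝ}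
    (ht : t < 4 * Real.sin (Real.pi / N) ^ 2) {v : Fin N → ℝ} (hsum : ∑ k, v k = 0)
    (hv : cyclicLaplacian ℝ N *ᵥ v = t • v) : v = 0 := by
  obtain ⟨n, rfl⟩ : ∃ n, N = n + 1 := ⟨N - 1, by omega⟩
  by_contra hv0
  have hs := sin_pi_div_pos hN
  have hquad := dotProduct_cyclicLaplacian_mulVec v v
  rw [hv, dotProduct_smul, smul_eq_mul] at hquad
  have hpos : 0 < v ⬝ᵥ v := by
    have := dotProduct_star_self_pos_iff.2 hv0
    simpa using this
  have ht0 : 0 ≤ t := by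
    have h2 : 0 ≤ ∑ k, (v k - v (finRotate _ k)) * (v k - v (finRotate _ k)) :=
      Finset.sum_nonneg fun i _ => mul_self_nonneg _
    rw [← hquad] at h2
    exact nonneg_of_mul_nonneg_left h2 hpos
  -- Put `t = 4 sin² α`; then `Nα < π`. A kernel vector forces `sin(Nα) = 0`, hence `α = 0`, and an
  -- eigenvector for 0 is constant, thus zero since its mean vanishes.
  set y := Real.sqrt t / 2 with hy
  have hy0 : 0 ≤ y := by positivity
  have hty : t = 4 * y ^ 2 := by rw [hy, div_pow, Real.sq_sqrt ht0]; ring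
  have hys : y < Real.sin (Real.pi / (n + 1 : ℕ)) := by
    refine lt_of_pow_lt_pow_left₀ 2 hs.le ?_
    linarith
  have hsin : Real.sin (Real.arcsin y) = y :=
    Real.sin_arcsin (by linarith) (hys.le.trans (Real.sin_le_one _))
  have hdet := det_sub_sin_sq (N := n + 1) (by omega) (Real.arcsin y)
  have hdet0 : (-(4 * Real.sin (Real.arcsin y) ^ 2) • (1 : Matrix (Fin (n + 1)) (Fin (n + 1)) ℝ)
      + cyclicLaplacian ℝ (n + 1)).det = 0 := by
    refine exists_mulVec_eq_zero_iff.1 ⟨v, hv0, ?_⟩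
    rw [hsin, ← hty, add_mulVec, hv, smul_mulVec, one_mulVec, neg_smul, neg_add_cancel]
  rw [hdet0] at hdet
  have h0 : Real.sin ((n + 1 : ℕ) * Real.arcsin y) = 0 := by nlinarith
  have h1 : Real.arcsin y = 0 := by
    by_contra h
    have h2 : 0 < Real.arcsin y := lt_of_le_of_ne (Real.arcsin_nonneg.2 hy0) (Ne.symm h)
    exact (Real.sin_pos_of_pos_of_lt_pi (by positivity) (mul_arcsin_lt_pi hN hys)).ne' h0
  have hy00 : y = 0 := by rw [← hsin, h1, Real.sin_zero]
  have ht00 : t = 0 := by rw [hty, hy00]; ring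
  rw [ht00, zero_mul] at hquad
  have hD := (Finset.sum_eq_zero_iff_of_nonneg fun i _ => mul_self_nonneg _).1 hquad.symm
  have hconst := eq_of_forall_finRotate (v := v) fun k => by
    have := mul_self_eq_zero.1 (hD k (Finset.mem_univ _))
    linarith
  rw [Finset.sum_congr rfl fun k _ => hconst k, Finset.sum_const, Finset.card_univ,
    Fintype.card_fin, nsmul_eq_mul] at hsum
  have hv00 : v 0 = 0 := by
    rcases mul_eq_zero.1 hsum with h | h
    · exact absurd h (by positivity)
    · exact h
  exact hv0 (funext fun k => by rw [hconst k, hv00]; rfl)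

/-- An eigenvector with eigenvalue `l ≤ 0` has mean zero, because constants have eigenvalue +1. It
is then an eigenvector of the Laplacian for `(1 + l)/coupling ≤ 4 sin²(π/N)/μ`, which `μ > 1` puts
below the Wirtinger threshold. For `N = 1` mean zero already means zero. -/
theorem posDef_saddleMatrix {μ : ℝ} (hμ : 1 < μ) {N : ℕ} (hN : 1 ≤ N) :
    (saddleMatrix μ N).PosDef := by
  have hN' : (N : ℝ) ≠ 0 := by positivity
  have hH : (saddleMatrix μ N).IsHermitian := by
    rw [IsHermitian, conjTranspose_eq_transpose_of_trivial, saddleMatrix, transpose_add,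
      transpose_quadraticMatrix, transpose_smul, transpose_vecMulVec]
  refine hH.posDef_iff_eigenvalues_pos.2 fun i => ?_
  by_contra! hle
  set l := hH.eigenvalues i
  set v : Fin N → ℝ := ⇑(hH.eigenvectorBasis i) with hvdef
  have hv : saddleMatrix μ N *ᵥ v = l • v := hH.mulVec_eigenvectorBasis i
  have hv0 : v ≠ 0 := fun h => by
    have h1 : hH.eigenvectorBasis i = 0 := by ext k; exact congr_fun h k
    exact hH.eigenvectorBasis.orthonormal.ne_zero i h1
  have hsum : ∑ k, v k = 0 := by
    have h1 : (fun _ => 1) ⬝ᵥ (saddleMatrix μ N *ᵥ v) = ∑ k, v k := by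
      rw [dotProduct_saddleMatrix_mulVec, dotProduct_quadraticMatrix_mulVec]
      simp
      field_simp
      ring
    rw [hv, dotProduct_smul, smul_eq_mul] at h1
    have h2 : (fun _ => (1 : ℝ)) ⬝ᵥ v = ∑ k, v k := by simp [dotProduct]
    rw [h2] at h1
    nlinarith
  rcases hN.lt_or_eq with hN2 | rfl
  · have hs := sin_pi_div_pos hN2
    have hc : 0 < coupling μ N := by unfold coupling; positivity
    refine hv0 (eq_zero_of_cyclicLaplacian_mulVec hN2 (t := (1 + l) / coupling μ N) ?_ hsum ?_)
    · rw [div_lt_iff₀ hc, coupling]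
      field_simp
      linarith
    · have h1 : saddleMatrix μ N *ᵥ v = -v + coupling μ N • (cyclicLaplacian ℝ N *ᵥ v) := by
        rw [saddleMatrix, add_mulVec, smul_mulVec, vecMulVec_mulVec, quadraticMatrix, add_mulVec,
          smul_mulVec, smul_mulVec, one_mulVec]
        have : (1 : Fin N → ℝ) ⬝ᵥ v = 0 := by simpa [dotProduct] using hsum
        rw [this]
        simp
      rw [hv] at h1
      ext k
      have h2 := congr_fun h1 k
      simp only [Pi.smul_apply, Pi.add_apply, Pi.neg_apply, smul_eq_mul] at h2 ⊢
      field_simp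
      linarith
  · refine hv0 (funext fun k => ?_)
    rw [Subsingleton.elim k 0]
    simpa using hsum

end Quadratic

/-! ### Hessians of the energy, the explicit prefactor and its limit. -/

section Hessian

theorem hasFDerivAt_apply {N : ℕ} (k : Fin N) (x : Space N) :
    HasFDerivAt (fun y : Space N => y k) (EuclideanSpace.proj k : Space N →L[ℝ] ℝ) x :=
  (EuclideanSpace.proj k : Space N →L[ℝ] ℝ).hasFDerivAt

theorem fderiv_V_apply (μ : ℝ) {N : ℕ} (x v : Space N) :
    fderiv ℝ (V μ N) x v = ∑ k, (x k ^ 3 - x k) * v k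
      + coupling μ N * ∑ k, (x k - x (finRotate N k)) * (v k - v (finRotate N k)) := by
  have h1 : HasFDerivAt (fun y : Space N => ∑ k : Fin N, (y k ^ 4 / 4 - y k ^ 2 / 2)) _ x :=
    HasFDerivAt.fun_sum fun k _ => (((hasFDerivAt_apply k x).pow 4).mul_const (4 : ℝ)⁻¹).sub
      (((hasFDerivAt_apply k x).pow 2).mul_const (2 : ℝ)⁻¹)
  have h2 : HasFDerivAt (fun y : Space N => ∑ k : Fin N,
      (y k - y (finRotate N k)) ^ 2 / (8 * Real.sin (Real.pi / N) ^ 2)) _ x :=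
    HasFDerivAt.fun_sum fun k _ => (((hasFDerivAt_apply k x).sub
      (hasFDerivAt_apply (finRotate N k) x)).pow 2).mul_const (8 * Real.sin (Real.pi / N) ^ 2)⁻¹
  have h3 : HasFDerivAt (V μ N) _ x := (h1.add (h2.const_mul μ)).add_const (N / 4 : ℝ)
  rw [h3.fderiv]
  simp only [_root_.add_apply, _root_.sum_apply,
    _root_.sub_apply, _root_.smul_apply, PiLp.proj_apply,
    smul_eq_mul, Finset.mul_sum]
  congr 1
  · refine Finset.sum_congr rfl fun k _ => ?_
    simp
    ring
  · refine Finset.sum_congr rfl fun k _ => ?_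
    simp [coupling]
    ring

theorem hessian_V (μ : ℝ) {N : ℕ} (a : ℝ) :
    hessian (V μ N) (WithLp.toLp 2 fun _ => a) = quadraticMatrix μ (3 * a ^ 2 - 1) N := by
  ext i j
  rw [hessian, Matrix.of_apply]
  simp only [fderiv_V_apply]
  set x : Space N := WithLp.toLp 2 fun _ => a with hx
  set e := EuclideanSpace.single j (1 : ℝ) with he
  have h1 : HasFDerivAt (fun y : Space N => ∑ k : Fin N, (y k ^ 3 - y k) * e k) _ x :=
    HasFDerivAt.fun_sum fun k _ => (((hasFDerivAt_apply k x).pow 3).sub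
      (hasFDerivAt_apply k x)).mul_const (e k)
  have h2 : HasFDerivAt (fun y : Space N => ∑ k : Fin N,
      (y k - y (finRotate N k)) * (e k - e (finRotate N k))) _ x :=
    HasFDerivAt.fun_sum fun k _ => ((hasFDerivAt_apply k x).sub
      (hasFDerivAt_apply (finRotate N k) x)).mul_const _
  have h3 := h1.add (h2.const_mul (coupling μ N))
  have h4 := dotProduct_quadraticMatrix_mulVec μ (3 * a ^ 2 - 1) (Pi.single i 1) (Pi.single j 1)
    (N := N)
  rw [Matrix.mulVec_single_one, single_one_dotProduct, Matrix.col_apply] at h4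
  erw [h3.fderiv]
  rw [h4]
  simp only [_root_.add_apply, _root_.sum_apply,
    _root_.sub_apply, _root_.smul_apply, PiLp.proj_apply,
    smul_eq_mul, Finset.mul_sum]
  congr 1
  · refine Finset.sum_congr rfl fun k _ => ?_
    simp [he, hx, Pi.single_apply]
    split_ifs <;> simp
  · refine Finset.sum_congr rfl fun k _ => ?_
    simp only [he, PiLp.single_apply, Pi.single_apply]
    ring

theorem hessian_V_Iminus (μ : ℝ) (N : ℕ) :
    hessian (V μ N) (Iminus N) = quadraticMatrix μ 2 N := by
  rw [Iminus, hessian_V]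
  norm_num

theorem hessian_V_zero (μ : ℝ) (N : ℕ) :
    hessian (V μ N) 0 = quadraticMatrix μ (-1) N := by
  have := hessian_V μ (N := N) 0
  rw [show WithLp.toLp 2 (fun _ => (0 : ℝ)) = (0 : Space N) from rfl] at this
  rw [this]
  norm_num

theorem prefactor_eq {μ : ℝ} (hμ : 1 < μ) {N : ℕ} (hN : 1 ≤ N) :
    prefactor μ N
      = 1 / Real.pi * Real.sqrt ((quadraticMatrix μ 2 N).det / (saddleMatrix μ N).det) := by
  rw [prefactor, hessian_V_Iminus, hessian_V_zero, det_saddleMatrix μ hN]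
  have h1 := (posDef_saddleMatrix hμ hN).det_pos
  rw [det_saddleMatrix μ hN] at h1
  have h2 := (posDef_quadraticMatrix (zero_le_one.trans hμ.le) two_pos N).det_pos
  rw [abs_div, abs_of_pos h2, abs_of_neg (by linarith)]

theorem prefactor_pos {μ : ℝ} (hμ : 1 < μ) {N : ℕ} (hN : 1 ≤ N) : 0 < prefactor μ N := by
  rw [prefactor_eq hμ hN]
  have h1 := (posDef_saddleMatrix hμ hN).det_pos
  have h2 := (posDef_quadraticMatrix (zero_le_one.trans hμ.le) two_pos N).det_pos
  have := Real.pi_pos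
  positivity

/-- Factoring out the coupling leaves the shifts `2/coupling` and `-1/coupling`, of the forms `4
sinh²` and `-4 sin²`; the common power of the coupling cancels in the quotient. -/
theorem prefactor_eq_sinh_div_sin {μ : ℝ} (hμ : 1 < μ) {N : ℕ} (hN : 2 ≤ N) :
    prefactor μ N = 1 / Real.pi *
      |Real.sinh (N * Real.arsinh (Real.sqrt (2 / μ) * Real.sin (Real.pi / N)))
        / Real.sin (N * Real.arcsin (Real.sqrt (1 / μ) * Real.sin (Real.pi / N)))| := by
  have hμ0 : 0 < μ := by linarith
  have hs := sin_pi_div_pos hN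
  have hc : 0 < coupling μ N := by unfold coupling; positivity
  set s := Real.sin (Real.pi / N) with hs_def
  have hdet : ∀ c : ℝ, (quadraticMatrix μ c N).det = coupling μ N ^ N *
      ((c / coupling μ N) • (1 : Matrix (Fin N) (Fin N) ℝ) + cyclicLaplacian ℝ N).det := by
    intro c
    have : quadraticMatrix μ c N = coupling μ N •
        ((c / coupling μ N) • (1 : Matrix (Fin N) (Fin N) ℝ) + cyclicLaplacian ℝ N) := by
      rw [quadraticMatrix, smul_add, smul_smul, mul_div_cancel₀ _ hc.ne']
    rw [this, Matrix.det_smul, Fintype.card_fin]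
  have e1 : 2 / coupling μ N = 4 * Real.sinh (Real.arsinh (Real.sqrt (2 / μ) * s)) ^ 2 := by
    rw [Real.sinh_arsinh, mul_pow, Real.sq_sqrt (by positivity), coupling, ← hs_def]
    field_simp
  have e2 : -1 / coupling μ N = -(4 * Real.sin (Real.arcsin (Real.sqrt (1 / μ) * s)) ^ 2) := by
    have h1 : Real.sqrt (1 / μ) ≤ 1 := Real.sqrt_le_one.2 (by rw [div_le_one hμ0]; exact hμ.le)
    have h2 : Real.sqrt (1 / μ) * s ≤ 1 := mul_le_one₀ h1 hs.le (Real.sin_le_one _)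
    have h3 : 0 ≤ Real.sqrt (1 / μ) * s := by positivity
    rw [Real.sin_arcsin (by linarith) h2, mul_pow, Real.sq_sqrt (by positivity), coupling, ← hs_def]
    field_simp
  rw [prefactor, hessian_V_Iminus, hessian_V_zero, hdet, hdet, e1, e2,
    det_sub_sin_sq (by omega), det_add_sinh_sq (by omega)]
  rw [mul_div_mul_left _ _ (pow_ne_zero _ hc.ne'), div_neg, abs_neg,
    mul_div_mul_left _ _ (by norm_num : (4 : ℝ) ≠ 0), ← div_pow, abs_pow, Real.sqrt_sq_eq_abs,
    abs_abs]

theorem tendsto_natCast_mul_of_hasDerivAt {f : ℝ → ℝ} {f' : ℝ} (hf : HasDerivAt f f' 0)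
    (h0 : f 0 = 0) : Tendsto (fun N : ℕ => (N : ℝ) * f (1 / N)) atTop (𝓝 f') := by
  have h1 : Tendsto (fun N : ℕ => (1 / N : ℝ)) atTop (𝓝[≠] 0) := by
    refine tendsto_nhdsWithin_iff.2 ⟨tendsto_one_div_atTop_nhds_zero_nat, ?_⟩
    filter_upwards [eventually_gt_atTop 0] with N hN
    simp [hN.ne']
  have h2 := (hasDerivAt_iff_tendsto_slope_zero.1 hf).comp h1
  refine h2.congr fun N => ?_
  simp [h0]

theorem tendsto_prefactor {μ : ℝ} (hμ : 1 < μ) :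
    Tendsto (fun N : ℕ => prefactor μ N) atTop
      (𝓝 (Real.sinh (Real.pi * Real.sqrt (2 / μ)) /
        (Real.pi * Real.sin (Real.pi / Real.sqrt μ)))) := by
  have hμ0 : 0 < μ := by linarith
  have hsin : ∀ b : ℝ, HasDerivAt (fun y => b * Real.sin (Real.pi * y)) (b * Real.pi) 0 := by
    intro b
    have h1 : HasDerivAt (fun y : ℝ => Real.pi * y) Real.pi 0 := by
      simpa using (hasDerivAt_id (0 : ℝ)).const_mul Real.pi
    simpa using (h1.sin).const_mul b
  -- `N f(1/N)` tends to `f'(0)`; here `f` is `arsinh` composed with a multiple of `sin(π y)`, and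
  -- below `arcsin`.
  have t1 : Tendsto (fun N : ℕ =>
      (N : ℝ) * Real.arsinh (Real.sqrt (2 / μ) * Real.sin (Real.pi / N))) atTop
      (𝓝 (Real.pi * Real.sqrt (2 / μ))) := by
    have h1 := (hsin (Real.sqrt (2 / μ))).arsinh
    simp only [mul_zero, Real.sin_zero] at h1
    have h2 := tendsto_natCast_mul_of_hasDerivAt h1 (by simp)
    simp only [mul_one_div] at h2
    convert h2 using 2
    simp [mul_comm]
  have t2 : Tendsto (fun N : ℕ =>
      (N : ℝ) * Real.arcsin (Real.sqrt (1 / μ) * Real.sin (Real.pi / N))) atTop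
      (𝓝 (Real.pi / Real.sqrt μ)) := by
    have h0 : HasDerivAt Real.arcsin 1 (Real.sqrt (1 / μ) * Real.sin (Real.pi * 0)) := by
      simpa using Real.hasDerivAt_arcsin (x := 0) (by norm_num) (by norm_num)
    have h1 := h0.comp (0 : ℝ) (hsin (Real.sqrt (1 / μ)))
    have h2 := tendsto_natCast_mul_of_hasDerivAt h1 (by simp)
    simp only [Function.comp, mul_one_div] at h2
    convert h2 using 2
    rw [Real.sqrt_div zero_le_one, Real.sqrt_one]
    ring
  have hpos : 0 < Real.sin (Real.pi / Real.sqrt μ) := by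
    have h1 : 1 < Real.sqrt μ := by
      rw [Real.lt_sqrt zero_le_one]; simpa using hμ
    refine Real.sin_pos_of_pos_of_lt_pi (by have := Real.pi_pos; positivity) ?_
    rw [div_lt_iff₀ (by linarith)]
    nlinarith [Real.pi_pos]
  have hpos' : 0 ≤ Real.sinh (Real.pi * Real.sqrt (2 / μ)) :=
    Real.sinh_nonneg_iff.2 (by have := Real.pi_pos; positivity)
  have t3 := ((((Real.continuous_sinh.tendsto _).comp t1).div
    ((Real.continuous_sin.tendsto _).comp t2) hpos.ne').abs).const_mul (1 / Real.pi)
  rw [abs_of_nonneg (div_nonneg hpos' hpos.le)] at t3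
  have hval : 1 / Real.pi * (Real.sinh (Real.pi * Real.sqrt (2 / μ))
      / Real.sin (Real.pi / Real.sqrt μ)) = Real.sinh (Real.pi * Real.sqrt (2 / μ)) /
        (Real.pi * Real.sin (Real.pi / Real.sqrt μ)) := by
    field_simp
  rw [hval] at t3
  refine t3.congr' ?_
  filter_upwards [eventually_ge_atTop 2] with N hN
  rw [prefactor_eq_sinh_div_sin hμ hN]
  rfl

end Hessian

/-! ### Gaussian integrals, exponential moments and tails of linear forms. -/

section Gaussian

open Matrix
open scoped MatrixOrder

variable {N : ℕ}

/-- The quadratic form `(x, M x)`. -/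
noncomputable def quadForm (M : Matrix (Fin N) (Fin N) ℝ) (x : Space N) : ℝ :=
  x.ofLp ⬝ᵥ (M *ᵥ x.ofLp)

theorem continuous_quadForm (M : Matrix (Fin N) (Fin N) ℝ) : Continuous (quadForm M) := by
  unfold quadForm dotProduct mulVec dotProduct
  fun_prop

theorem quadForm_neg (M : Matrix (Fin N) (Fin N) ℝ) (x : Space N) :
    quadForm M (-x) = quadForm M x := by
  simp [quadForm, mulVec_neg]

theorem quadForm_sub {M : Matrix (Fin N) (Fin N) ℝ} (hM : Mᵀ = M) (x a : Space N) :
    quadForm M (x - a) = quadForm M x - 2 * ((M *ᵥ a.ofLp) ⬝ᵥ x.ofLp) + quadForm M a := by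
  have h : a.ofLp ⬝ᵥ (M *ᵥ x.ofLp) = (M *ᵥ a.ofLp) ⬝ᵥ x.ofLp := by
    rw [dotProduct_mulVec, ← mulVec_transpose, hM]
  simp only [quadForm, WithLp.ofLp_sub, mulVec_sub, dotProduct_sub, sub_dotProduct]
  rw [h, dotProduct_comm x.ofLp (M *ᵥ a.ofLp)]
  ring

/-- Factor `M = Bᵀ B`; the linear change of variables `B` reduces Gaussian integrals to the
isotropic one. -/
theorem exists_quadForm_eq_norm_sq {M : Matrix (Fin N) (Fin N) ℝ} (hM : M.PosDef) :
    ∃ L : Space N →ₗ[ℝ] Space N, LinearMap.det L ≠ 0 ∧ LinearMap.det L ^ 2 = M.det ∧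
      ∀ x, quadForm M x = ‖L x‖ ^ 2 := by
  obtain ⟨B, hB⟩ := CStarAlgebra.nonneg_iff_eq_star_mul_self.mp hM.posSemidef.nonneg
  have hdet : LinearMap.det (toEuclideanLin B) ^ 2 = M.det := by
    have h1 : LinearMap.det (toEuclideanLin B) = B.det := LinearMap.det_toLpLin 2 B
    rw [h1, hB, det_mul, star_eq_conjTranspose, det_conjTranspose, star_trivial, sq]
  refine ⟨toEuclideanLin B, fun h => ?_, hdet, fun x => ?_⟩
  · have := hM.det_pos
    rw [← hdet, h] at this
    simp at this
  · have h2 : quadForm M x = (B *ᵥ x.ofLp) ⬝ᵥ (B *ᵥ x.ofLp) := by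
      rw [quadForm, hB, star_eq_conjTranspose, conjTranspose_eq_transpose_of_trivial,
        ← mulVec_mulVec, dotProduct_mulVec, vecMul_transpose]
    rw [h2, EuclideanSpace.real_norm_sq_eq, dotProduct]
    refine Finset.sum_congr rfl fun k _ => ?_
    rw [sq]
    rfl

theorem integrable_and_integral_exp_quadForm {M : Matrix (Fin N) (Fin N) ℝ} (hM : M.PosDef)
    {c : ℝ} (hc : 0 < c) :
    Integrable (fun x : Space N => Real.exp (-c * quadForm M x)) ∧
      ∫ x : Space N, Real.exp (-c * quadForm M x)
        = (∫ x : Space N, Real.exp (-c * ‖x‖ ^ 2)) / Real.sqrt M.det := by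
  obtain ⟨L, hL, hdet, hq⟩ := exists_quadForm_eq_norm_sq hM
  have hcont : Continuous L := L.continuous_of_finiteDimensional
  have hg : Continuous fun x : Space N => Real.exp (-c * ‖x‖ ^ 2) := by fun_prop
  have hmap := Measure.map_linearMap_addHaar_eq_smul_addHaar (volume : Measure (Space N)) hL
  have hint : Integrable (fun x : Space N => Real.exp (-c * ‖x‖ ^ 2)) (Measure.map L volume) := by
    rw [hmap]
    exact (integrable_rexp_neg_mul_sq_norm hc N).smul_measure ENNReal.ofReal_ne_top
  simp only [hq]
  refine ⟨(integrable_map_measure hg.aestronglyMeasurable hcont.aemeasurable).1 hint, ?_⟩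
  have h1 := integral_map (μ := volume) hcont.aemeasurable
    (hg.aestronglyMeasurable (μ := Measure.map L volume))
  rw [← h1, hmap, integral_smul_measure, ENNReal.toReal_ofReal (abs_nonneg _), ← hdet,
    Real.sqrt_sq_eq_abs, abs_inv, smul_eq_mul]
  ring

theorem integral_exp_quadForm_pos {M : Matrix (Fin N) (Fin N) ℝ} (hM : M.PosDef)
    {c : ℝ} (hc : 0 < c) : 0 < ∫ x : Space N, Real.exp (-c * quadForm M x) :=
  integral_exp_pos (integrable_and_integral_exp_quadForm hM hc).1

theorem integral_exp_quadForm_eq {M M' : Matrix (Fin N) (Fin N) ℝ} (hM : M.PosDef)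
    (hM' : M'.PosDef) {c : ℝ} (hc : 0 < c) :
    ∫ x : Space N, Real.exp (-c * quadForm M x)
      = Real.sqrt (M'.det / M.det) * ∫ x : Space N, Real.exp (-c * quadForm M' x) := by
  rw [(integrable_and_integral_exp_quadForm hM hc).2,
    (integrable_and_integral_exp_quadForm hM' hc).2, Real.sqrt_div hM'.det_pos.le]
  have := Real.sqrt_pos.2 hM.det_pos
  have := Real.sqrt_pos.2 hM'.det_pos
  field_simp

/-- Exponential moments of a Gaussian measure. -/
theorem integrable_and_integral_exp_dotProduct {M : Matrix (Fin N) (Fin N) ℝ} (hM : M.PosDef)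
    {c : ℝ} (hc : 0 < c) (a : Space N) :
    Integrable (fun x : Space N => Real.exp (2 * c * ((M *ᵥ a.ofLp) ⬝ᵥ x.ofLp))
        * Real.exp (-c * quadForm M x)) ∧
      ∫ x : Space N, Real.exp (2 * c * ((M *ᵥ a.ofLp) ⬝ᵥ x.ofLp)) * Real.exp (-c * quadForm M x)
        = Real.exp (c * quadForm M a) * ∫ x : Space N, Real.exp (-c * quadForm M x) := by
  have hT : Mᵀ = M := by
    have := hM.isHermitian
    rwa [IsHermitian, conjTranspose_eq_transpose_of_trivial] at this
  have h : (fun x : Space N => Real.exp (2 * c * ((M *ᵥ a.ofLp) ⬝ᵥ x.ofLp))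
      * Real.exp (-c * quadForm M x))
      = fun x => Real.exp (c * quadForm M a) * Real.exp (-c * quadForm M (x - a)) := by
    ext x
    rw [← Real.exp_add, ← Real.exp_add, quadForm_sub hT]
    ring_nf
  rw [h]
  have h1 := (integrable_and_integral_exp_quadForm hM hc).1
  refine ⟨(h1.comp_sub_right a).const_mul _, ?_⟩
  rw [integral_const_mul, integral_sub_right_eq_self (fun x => Real.exp (-c * quadForm M x))]

theorem exists_mulVec_eq {M : Matrix (Fin N) (Fin N) ℝ} (hM : M.PosDef) (v : Fin N → ℝ) :
    ∃ a : Space N, M *ᵥ a.ofLp = v := by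
  refine ⟨WithLp.toLp 2 (M⁻¹ *ᵥ v), ?_⟩
  rw [mulVec_mulVec, mul_nonsing_inv _ ((isUnit_iff_isUnit_det M).1 hM.isUnit), one_mulVec]

/-- If a linear form is controlled by the quadratic form, its exponential moments are controlled. -/
theorem integrable_and_integral_exp_le {M : Matrix (Fin N) (Fin N) ℝ} (hM : M.PosDef)
    {c K : ℝ} (hc : 0 < c) (hK0 : 0 ≤ K) {v : Fin N → ℝ}
    (hK : ∀ x : Space N, (v ⬝ᵥ x.ofLp) ^ 2 ≤ K * quadForm M x) (α : ℝ) :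
    Integrable (fun x : Space N => Real.exp (α * (v ⬝ᵥ x.ofLp)) * Real.exp (-c * quadForm M x)) ∧
      ∫ x : Space N, Real.exp (α * (v ⬝ᵥ x.ofLp)) * Real.exp (-c * quadForm M x)
        ≤ Real.exp (α ^ 2 * K / (4 * c)) * ∫ x : Space N, Real.exp (-c * quadForm M x) := by
  obtain ⟨a, ha⟩ := exists_mulVec_eq hM ((α / (2 * c)) • v)
  have hdot : ∀ x : Space N, 2 * c * ((M *ᵥ a.ofLp) ⬝ᵥ x.ofLp) = α * (v ⬝ᵥ x.ofLp) := by
    intro x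
    rw [ha, smul_dotProduct, smul_eq_mul]
    field_simp
  have hq : quadForm M a = α / (2 * c) * (v ⬝ᵥ a.ofLp) := by
    rw [quadForm, ha, dotProduct_smul, smul_eq_mul, dotProduct_comm]
  obtain ⟨h1, h2⟩ := integrable_and_integral_exp_dotProduct hM hc a
  simp only [hdot] at h1 h2
  refine ⟨h1, h2.trans_le (mul_le_mul_of_nonneg_right (Real.exp_le_exp.2 ?_)
    (integral_exp_quadForm_pos hM hc).le)⟩
  -- Here `v ⬝ᵥ a` is `α/(2c)` times `vᵀ M⁻¹ v`. Applying the hypothesis at `a` itself bounds that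
  -- dual form by `K`.
  have h3 := hK a
  set y := v ⬝ᵥ a.ofLp
  have h4 : y ^ 2 * (4 * c ^ 2) ≤ K * α * (2 * c) * y := by
    rw [hq] at h3
    calc y ^ 2 * (4 * c ^ 2) ≤ K * (α / (2 * c) * y) * (4 * c ^ 2) := by gcongr
      _ = _ := by field_simp; ring
  rw [hq, le_div_iff₀ (by positivity)]
  have h5 : c * (α / (2 * c) * y) * (4 * c) = α * (2 * c) * y := by field_simp; ring
  rw [h5]
  have h6 : (y * (2 * c)) ^ 2 ≤ (K * α) * (y * (2 * c)) := by linarith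
  by_contra! h7
  have h8 : 0 < α * (2 * c) * y := lt_of_le_of_lt (by positivity) h7
  have h9 := mul_le_mul_of_nonneg_left h6 (sq_nonneg α)
  have h10 := mul_lt_mul_of_pos_right h7 h8
  nlinarith

theorem pow_four_le_exp (y : ℝ) : y ^ 4 ≤ 24 * (Real.exp y + Real.exp (-y)) := by
  have h := Real.pow_div_factorial_le_exp _ (abs_nonneg y) 4
  have h1 : |y| ^ 4 = y ^ 4 := by rw [show (4 : ℕ) = 2 * 2 from rfl, pow_mul, sq_abs, ← pow_mul]
  have h2 : Real.exp |y| ≤ Real.exp y + Real.exp (-y) := by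
    rcases abs_choice y with h | h <;> rw [h] <;> have := Real.exp_pos y <;>
      have := Real.exp_pos (-y) <;> linarith
  rw [h1] at h
  norm_num [Nat.factorial] at h
  linarith

theorem two_add_sq_le_exp (y : ℝ) : 2 + y ^ 2 ≤ Real.exp y + Real.exp (-y) := by
  obtain ⟨z, rfl⟩ : ∃ z, y = 2 * z := ⟨y / 2, by ring⟩
  have h1 : Real.exp (2 * z) + Real.exp (-(2 * z)) = 2 + 4 * Real.sinh z ^ 2 := by
    rw [Real.sinh_eq, two_mul, neg_add, Real.exp_add, Real.exp_add]
    have h : Real.exp z * Real.exp (-z) = 1 := by rw [← Real.exp_add]; simp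
    linear_combination 2 * h
  have h2 : z ^ 2 ≤ Real.sinh z ^ 2 := by
    rcases le_total 0 z with h | h
    · have := Real.self_le_sinh_iff.2 h
      nlinarith
    · have := Real.sinh_le_self_iff.2 h
      nlinarith
  rw [h1]
  nlinarith

theorem integrable_and_integral_pow_four_le {M : Matrix (Fin N) (Fin N) ℝ} (hM : M.PosDef)
    {c K : ℝ} (hc : 0 < c) (hK0 : 0 < K) {v : Fin N → ℝ}
    (hK : ∀ x : Space N, (v ⬝ᵥ x.ofLp) ^ 2 ≤ K * quadForm M x) :
    Integrable (fun x : Space N => (v ⬝ᵥ x.ofLp) ^ 4 * Real.exp (-c * quadForm M x)) ∧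
      ∫ x : Space N, (v ⬝ᵥ x.ofLp) ^ 4 * Real.exp (-c * quadForm M x)
        ≤ 9 * (K / c) ^ 2 * ∫ x : Space N, Real.exp (-c * quadForm M x) := by
  -- This choice makes the exponent `α² K/(4c)` equal to 1. With `e < 3` the constant is `24 · 6/16
  -- = 9`.
  set α := Real.sqrt (4 * c / K) with hα_def
  have hα : 0 < α := Real.sqrt_pos.2 (by positivity)
  have hα2 : α ^ 2 = 4 * c / K := Real.sq_sqrt (by positivity)
  have hα4 : α ^ 4 = 16 * (c / K) ^ 2 := by
    rw [show (4 : ℕ) = 2 * 2 from rfl, pow_mul, hα2]; ring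
  obtain ⟨i1, b1⟩ := integrable_and_integral_exp_le hM hc hK0.le hK α
  obtain ⟨i2, b2⟩ := integrable_and_integral_exp_le hM hc hK0.le hK (-α)
  have hexp : α ^ 2 * K / (4 * c) = 1 := by rw [hα2]; field_simp
  rw [hexp] at b1
  rw [neg_sq, hexp] at b2
  set Z := ∫ x : Space N, Real.exp (-c * quadForm M x)
  have hZ : 0 < Z := integral_exp_quadForm_pos hM hc
  have hle : ∀ x : Space N, (v ⬝ᵥ x.ofLp) ^ 4 * Real.exp (-c * quadForm M x)
      ≤ 24 / α ^ 4 * (Real.exp (α * (v ⬝ᵥ x.ofLp)) * Real.exp (-c * quadForm M x)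
        + Real.exp (-α * (v ⬝ᵥ x.ofLp)) * Real.exp (-c * quadForm M x)) := by
    intro x
    have h1 := pow_four_le_exp (α * (v ⬝ᵥ x.ofLp))
    rw [mul_pow, ← neg_mul] at h1
    rw [← add_mul, ← mul_assoc]
    refine mul_le_mul_of_nonneg_right ?_ (Real.exp_pos _).le
    rw [div_mul_eq_mul_div, le_div_iff₀ (by positivity)]
    linarith
  have hint := (i1.add i2).const_mul (24 / α ^ 4)
  have hcont : Continuous fun x : Space N =>
      (v ⬝ᵥ x.ofLp) ^ 4 * Real.exp (-c * quadForm M x) := by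
    have := continuous_quadForm M
    unfold dotProduct
    fun_prop
  have hI : Integrable (fun x : Space N => (v ⬝ᵥ x.ofLp) ^ 4 * Real.exp (-c * quadForm M x)) := by
    refine hint.mono' hcont.aestronglyMeasurable (Eventually.of_forall fun x => ?_)
    rw [Real.norm_of_nonneg (by positivity)]
    exact hle x
  refine ⟨hI, (integral_mono hI hint hle).trans ?_⟩
  rw [integral_const_mul, integral_add' i1 i2, hα4]
  have he : Real.exp 1 < 3 := Real.exp_one_lt_d9.trans (by norm_num)
  calc 24 / (16 * (c / K) ^ 2) * _ ≤ 24 / (16 * (c / K) ^ 2) * (3 * Z + 3 * Z) := by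
        refine mul_le_mul_of_nonneg_left ?_ (by positivity)
        nlinarith
    _ = 9 * (K / c) ^ 2 * Z := by field_simp; ring

/-- Chebyshev's inequality for a linear form with small variance. -/
theorem le_integral_indicator {M : Matrix (Fin N) (Fin N) ℝ} (hM : M.PosDef)
    {c K : ℝ} (hc : 0 < c) (hK0 : 0 < K) {v : Fin N → ℝ}
    (hK : ∀ x : Space N, (v ⬝ᵥ x.ofLp) ^ 2 ≤ K * quadForm M x) (hKc : K / c ≤ 1) :
    (1 - 17 / 18 * (K / c)) * ∫ x : Space N, Real.exp (-c * quadForm M x)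
      ≤ ∫ x in {x : Space N | |v ⬝ᵥ x.ofLp| < 3 / 4}, Real.exp (-c * quadForm M x) := by
  obtain ⟨i1, b1⟩ := integrable_and_integral_exp_le hM hc hK0.le hK (1 / 2)
  obtain ⟨i2, b2⟩ := integrable_and_integral_exp_le hM hc hK0.le hK (-(1 / 2))
  have i0 := (integrable_and_integral_exp_quadForm hM hc).1
  rw [neg_sq] at b2
  have hpos : 0 < K / c := by positivity
  -- For `|y| ≥ 3/4`, `(64/9)(e^{y/2} + e^{-y/2} - 2) ≥ 1`; the exponential moments then give
  -- `(64/9) · 2 · 17/256 = 17/18`, with `17/256 = 1/16 + 1/16²`.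
  have he : Real.exp ((1 / 2) ^ 2 * K / (4 * c)) ≤ 1 + 17 / 256 * (K / c) := by
    rw [show (1 / 2) ^ 2 * K / (4 * c) = K / c / 16 by field_simp; norm_num]
    have h1 := Real.abs_exp_sub_one_sub_id_le (x := K / c / 16) (by
      rw [abs_of_pos (by positivity)]; linarith)
    have h2 := (abs_le.1 h1).2
    nlinarith
  set Z := ∫ x : Space N, Real.exp (-c * quadForm M x)
  have hZ : 0 < Z := integral_exp_quadForm_pos hM hc
  have hcv : Continuous fun x : Space N => |v ⬝ᵥ x.ofLp| := by
    unfold dotProduct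
    fun_prop
  have hB : MeasurableSet {x : Space N | |v ⬝ᵥ x.ofLp| < 3 / 4} :=
    (isOpen_lt hcv continuous_const).measurableSet
  have iB := i0.indicator hB
  have iS := ((i1.add i2).sub (i0.const_mul 2)).const_mul (64 / 9)
  have hmono := integral_mono i0 (iB.add iS) fun x => by
    simp only [Pi.add_apply, Pi.sub_apply]
    have hq := Real.exp_pos (-c * quadForm M x)
    have h2 := two_add_sq_le_exp (1 / 2 * (v ⬝ᵥ x.ofLp))
    rw [← neg_mul] at h2
    by_cases hx : |v ⬝ᵥ x.ofLp| < 3 / 4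
    · rw [Set.indicator_of_mem (show x ∈ {x : Space N | |v ⬝ᵥ x.ofLp| < 3 / 4} from hx)]
      have : 0 ≤ (Real.exp (1 / 2 * (v ⬝ᵥ x.ofLp)) + Real.exp (-(1 / 2) * (v ⬝ᵥ x.ofLp)) - 2)
        * Real.exp (-c * quadForm M x) := mul_nonneg (by nlinarith) hq.le
      linarith
    · rw [Set.indicator_of_notMem (show x ∉ {x : Space N | |v ⬝ᵥ x.ofLp| < 3 / 4} from hx)]
      have h3 : (3 / 4 : ℝ) ^ 2 ≤ (v ⬝ᵥ x.ofLp) ^ 2 := by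
        rw [← sq_abs (v ⬝ᵥ x.ofLp)]
        exact pow_le_pow_left₀ (by norm_num) (not_lt.1 hx) 2
      have : 9 / 64 * Real.exp (-c * quadForm M x)
          ≤ (Real.exp (1 / 2 * (v ⬝ᵥ x.ofLp)) + Real.exp (-(1 / 2) * (v ⬝ᵥ x.ofLp)) - 2)
        * Real.exp (-c * quadForm M x) := mul_le_mul_of_nonneg_right (by nlinarith) hq.le
      linarith
  have e1 : ∫ x, ((fun x : Space N => Set.indicator {x : Space N | |v ⬝ᵥ x.ofLp| < 3 / 4}
      (fun x => Real.exp (-c * quadForm M x)) x)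
      + fun x => 64 / 9 * (((fun x : Space N => Real.exp (1 / 2 * (v ⬝ᵥ x.ofLp))
        * Real.exp (-c * quadForm M x)) + fun x => Real.exp (-(1 / 2) * (v ⬝ᵥ x.ofLp))
        * Real.exp (-c * quadForm M x)) - fun x => 2 * Real.exp (-c * quadForm M x)) x) x
      = _ := integral_add' iB iS
  rw [e1, integral_indicator hB, integral_const_mul, integral_sub' (i1.add i2) (i0.const_mul 2),
    integral_add' i1 i2, integral_const_mul] at hmono
  change Z ≤ _ + 64 / 9 * (_ + _ - 2 * Z) at hmono
  have h3 := mul_le_mul_of_nonneg_right he hZ.le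
  linarith

end Gaussian

/-! ### Discrete Sobolev inequality and expansions of the energy. -/

section Expansion

open Matrix

variable {N : ℕ}

theorem quadForm_quadraticMatrix (μ c : ℝ) (w : Space N) :
    quadForm (quadraticMatrix μ c N) w
      = c * ∑ k, w k ^ 2 + coupling μ N * ∑ k, (w k - w (finRotate N k)) ^ 2 := by
  rw [quadForm, dotProduct_quadraticMatrix_mulVec]
  simp only [sq]

/-- Telescoping along the arc from 0 to `k`, then enlarging to the whole cycle. -/
theorem abs_sub_le_sum_abs_sub {n : ℕ} (w : Fin (n + 1) → ℝ) (k : Fin (n + 1)) :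
    |w 0 - w k| ≤ ∑ i, |w i - w (finRotate _ i)| := by
  have hsucc : ∀ m : ℕ, Fin.ofNat (n + 1) (m + 1) = finRotate _ (Fin.ofNat (n + 1) m) := by
    intro m
    rw [finRotate_apply]
    ext
    simp [Fin.add_def]
  have h := dist_le_range_sum_dist (fun m => w (Fin.ofNat (n + 1) m)) k
  simp only [Real.dist_eq, hsucc] at h
  have h0 : Fin.ofNat (n + 1) 0 = 0 := rfl
  have hk : Fin.ofNat (n + 1) (k : ℕ) = k := by
    ext
    simp
  rw [h0, hk] at h
  refine h.trans ((Finset.sum_le_sum_of_subset_of_nonneg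
    (Finset.range_subset_range.2 k.2.le) fun _ _ _ => abs_nonneg _).trans (le_of_eq ?_))
  rw [← Fin.sum_univ_eq_sum_range
    (fun m => |w (Fin.ofNat (n + 1) m) - w (finRotate _ (Fin.ofNat (n + 1) m))|)]
  refine Finset.sum_congr rfl fun i _ => ?_
  have hi : Fin.ofNat (n + 1) (i : ℕ) = i := by
    ext
    simp
  rw [hi]

/-- The discrete Sobolev inequality on the cycle. -/
theorem sq_apply_le (hN : 1 ≤ N) (w : Fin N → ℝ) (k : Fin N) :
    w k ^ 2 ≤ 2 / N * ∑ j, w j ^ 2 + 8 * N * ∑ j, (w j - w (finRotate N j)) ^ 2 := by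
  obtain ⟨n, rfl⟩ : ∃ n, N = n + 1 := ⟨N - 1, by omega⟩
  set S := ∑ i, |w i - w (finRotate _ i)| with hS
  have hN' : (0 : ℝ) < (n + 1 : ℕ) := by positivity
  have hS2 : S ^ 2 ≤ (n + 1 : ℕ) * ∑ j, (w j - w (finRotate _ j)) ^ 2 := by
    have := sq_sum_le_card_mul_sum_sq (s := Finset.univ) (f := fun i => |w i - w (finRotate _ i)|)
    simpa [hS] using this
  have h1 : ∀ j, w k ^ 2 ≤ 2 * w j ^ 2 + 8 * S ^ 2 := by
    intro j
    have h2 := abs_le.1 (abs_sub_le_sum_abs_sub w k)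
    have h3 := abs_le.1 (abs_sub_le_sum_abs_sub w j)
    rw [← hS] at h2 h3
    have h4 : (w k - w j) ^ 2 ≤ (2 * S) ^ 2 := sq_le_sq' (by linarith) (by linarith)
    nlinarith [sq_nonneg (w k - 2 * w j)]
  have h5 := Finset.sum_le_sum fun j (_ : j ∈ Finset.univ) => h1 j
  rw [Finset.sum_const, Finset.sum_add_distrib, Finset.sum_const, ← Finset.mul_sum,
    Finset.card_univ, Fintype.card_fin, nsmul_eq_mul, nsmul_eq_mul] at h5
  have h6 : w k ^ 2 ≤ 2 / (n + 1 : ℕ) * ∑ j, w j ^ 2 + 8 * S ^ 2 := by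
    rw [div_mul_eq_mul_div, ← sub_le_iff_le_add, le_div_iff₀ hN']
    nlinarith
  nlinarith

theorem sq_le_coupling {μ : ℝ} (hμ : 1 ≤ μ) (hN : 2 ≤ N) : (N : ℝ) ^ 2 / 40 ≤ coupling μ N := by
  have hs := sin_pi_div_pos hN
  have hN' : (0 : ℝ) < N := by positivity
  have h1 : Real.sin (Real.pi / N) ≤ Real.pi / N := Real.sin_le (by positivity)
  have h2 : Real.sin (Real.pi / N) * N ≤ Real.pi := by rwa [le_div_iff₀ hN'] at h1
  have h3 : (Real.sin (Real.pi / N) * N) ^ 2 ≤ 10 :=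
    (pow_le_pow_left₀ (by positivity) (h2.trans Real.pi_lt_d2.le) 2).trans (by norm_num)
  rw [coupling, le_div_iff₀ (by positivity)]
  nlinarith

/-- The source of uniformity in `N`: since the coupling is at least `N²/40`, the factor `8N` in the
Sobolev inequality becomes `320/N` times the coupling. Coordinates then have variance `O(h)` under
the Gaussian approximation. For `N = 1` the difference term vanishes. -/
theorem sq_apply_le_quadForm {μ : ℝ} (hμ : 1 ≤ μ) (hN : 1 ≤ N) (k : Fin N) (w : Space N) :
    w k ^ 2 ≤ 320 / N * quadForm (quadraticMatrix μ 2 N) w := by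
  have hN' : (0 : ℝ) < N := by positivity
  have h1 := sq_apply_le hN w k
  rw [quadForm_quadraticMatrix]
  have hA : 0 ≤ ∑ j, w j ^ 2 := Finset.sum_nonneg fun _ _ => sq_nonneg _
  have hB : 0 ≤ ∑ j, (w j - w (finRotate N j)) ^ 2 := Finset.sum_nonneg fun _ _ => sq_nonneg _
  have h2 : 8 * N * ∑ j, (w j - w (finRotate N j)) ^ 2
      ≤ 320 / N * (coupling μ N * ∑ j, (w j - w (finRotate N j)) ^ 2) := by
    rcases hN.lt_or_eq with hN2 | rfl
    · have h3 := sq_le_coupling hμ hN2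
      calc 8 * N * ∑ j, (w j - w (finRotate N j)) ^ 2
          = 320 / N * ((N : ℝ) ^ 2 / 40 * ∑ j, (w j - w (finRotate N j)) ^ 2) := by
            field_simp; ring
        _ ≤ _ := by gcongr
    · simp
  have h4 : 2 / (N : ℝ) * ∑ j, w j ^ 2 ≤ 320 / N * (2 * ∑ j, w j ^ 2) := by
    rw [← mul_assoc]
    refine mul_le_mul_of_nonneg_right ?_ hA
    rw [div_mul_eq_mul_div]
    gcongr
    norm_num
  rw [mul_add]
  linarith

/-- The mean of the coordinates. -/
noncomputable def mean (N : ℕ) : Space N →L[ℝ] ℝ := (N : ℝ)⁻¹ • ∑ k, EuclideanSpace.proj k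

theorem mean_apply (x : Space N) : mean N x = (N : ℝ)⁻¹ * ∑ k, x k := by
  simp [mean]

theorem mean_eq_dotProduct (x : Space N) : mean N x = (fun _ => (N : ℝ)⁻¹) ⬝ᵥ x.ofLp := by
  rw [mean_apply, dotProduct, Finset.mul_sum]

theorem sq_mean_le_quadForm {μ : ℝ} (hμ : 0 ≤ μ) (hN : 1 ≤ N) (w : Space N) :
    mean N w ^ 2 ≤ 1 / (2 * N) * quadForm (quadraticMatrix μ 2 N) w := by
  have hN' : (0 : ℝ) < N := by positivity
  have h1 := sq_sum_le_card_mul_sum_sq (s := Finset.univ) (f := fun i => w i)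
  rw [Finset.card_univ, Fintype.card_fin] at h1
  have hB : 0 ≤ ∑ j, (w j - w (finRotate N j)) ^ 2 := Finset.sum_nonneg fun _ _ => sq_nonneg _
  have h2 := mul_nonneg (coupling_nonneg hμ N) hB
  rw [mean_apply, quadForm_quadraticMatrix, mul_pow]
  calc (N : ℝ)⁻¹ ^ 2 * (∑ k, w k) ^ 2 ≤ (N : ℝ)⁻¹ ^ 2 * (N * ∑ k, w k ^ 2) := by gcongr
    _ = 1 / (2 * N) * (2 * ∑ k, w k ^ 2 + 0) := by field_simp; ring
    _ ≤ _ := by gcongr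

theorem V_eq (μ : ℝ) (x : Space N) :
    V μ N x = ∑ k, (x k ^ 4 / 4 - x k ^ 2 / 2)
      + coupling μ N / 2 * ∑ k, (x k - x (finRotate N k)) ^ 2 + N / 4 := by
  rw [V, ← Finset.sum_div, coupling]
  ring

/-- The constant state `(1, …, 1)`. -/
noncomputable def onesVector (N : ℕ) : Space N := WithLp.toLp 2 fun _ => 1

theorem V_add_onesVector (μ : ℝ) (w : Space N) :
    V μ N (w + onesVector N)
      = 1 / 2 * quadForm (quadraticMatrix μ 2 N) w + ∑ k, (w k ^ 3 + w k ^ 4 / 4) := by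
  have h : ∑ k, ((w k + 1) ^ 4 / 4 - (w k + 1) ^ 2 / 2) + N / 4
      = ∑ k, w k ^ 2 + ∑ k, (w k ^ 3 + w k ^ 4 / 4) := by
    have h1 : (N / 4 : ℝ) = ∑ _k : Fin N, (1 / 4 : ℝ) := by simp; ring
    rw [h1, ← Finset.sum_add_distrib, ← Finset.sum_add_distrib]
    refine Finset.sum_congr rfl fun k _ => ?_
    ring
  rw [V_eq, quadForm_quadraticMatrix]
  simp only [onesVector, PiLp.add_apply, add_sub_add_right_eq_sub]
  linear_combination h

/-- Adding `N m²`, with `m` the mean, flips the unstable direction of the Hessian at 0; only the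
nonnegative quartic term is dropped. -/
theorem saddle_le_V (μ : ℝ) (hN : 1 ≤ N) (x : Space N) :
    N / 4 + 1 / 2 * quadForm (saddleMatrix μ N) x ≤ V μ N x + N * mean N x ^ 2 := by
  have hN' : (0 : ℝ) < N := by positivity
  have h0 : 0 ≤ ∑ k, x k ^ 4 := Finset.sum_nonneg fun k _ => by positivity
  have h1 : quadForm (saddleMatrix μ N) x = quadForm (quadraticMatrix μ (-1) N) x
      + 2 * (N * mean N x ^ 2) := by
    rw [quadForm, dotProduct_saddleMatrix_mulVec, quadForm, mean_apply]
    field_simp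
  rw [h1, quadForm_quadraticMatrix, V_eq, Finset.sum_sub_distrib, ← Finset.sum_div,
    ← Finset.sum_div]
  linarith

theorem mean_onesVector (hN : 1 ≤ N) : mean N (onesVector N) = 1 := by
  have hN' : (N : ℝ) ≠ 0 := by positivity
  simp [mean_apply, onesVector, hN']

end Expansion

/-! ### Mass of one well, uniformly in the dimension. -/

section Well

open Matrix

variable {N : ℕ}

theorem integral_eq_zero_of_odd {g : Space N → ℝ} (hg : ∀ x, g (-x) = -g x) : ∫ x, g x = 0 := by
  have h := integral_neg_eq_self g (volume : Measure (Space N))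
  simp only [hg, integral_neg] at h
  linarith

theorem integrable_and_integral_sum_pow_four_le {μ h : ℝ} (hμ : 1 ≤ μ) (hh : 0 < h) (hN : 1 ≤ N) :
    (∀ k, Integrable fun w : Space N =>
      w k ^ 4 * Real.exp (-(1 / (2 * (h * N))) * quadForm (quadraticMatrix μ 2 N) w)) ∧
    ∫ w : Space N, (∑ k, w k ^ 4) / (4 * (h * N))
        * Real.exp (-(1 / (2 * (h * N))) * quadForm (quadraticMatrix μ 2 N) w)
      ≤ 921600 * h
        * ∫ w : Space N, Real.exp (-(1 / (2 * (h * N))) * quadForm (quadraticMatrix μ 2 N) w) := by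
  have hN' : (0 : ℝ) < N := by positivity
  have hM := posDef_quadraticMatrix (zero_le_one.trans hμ) two_pos N
  have hsingle : ∀ (k : Fin N) (w : Space N), Pi.single k (1 : ℝ) ⬝ᵥ w.ofLp = w k := fun k w => by
    rw [single_dotProduct, one_mul]
  have key := fun k : Fin N => integrable_and_integral_pow_four_le hM
    (c := 1 / (2 * (h * N))) (K := 320 / N) (by positivity) (by positivity) (v := Pi.single k 1)
    (fun x => by rw [hsingle]; exact sq_apply_le_quadForm hμ hN k x)
  simp only [hsingle] at key
  refine ⟨fun k => (key k).1, ?_⟩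
  set Z := ∫ w : Space N, Real.exp (-(1 / (2 * (h * N))) * quadForm (quadraticMatrix μ 2 N) w)
  have h1 : ∀ w : Space N, (∑ k, w k ^ 4) / (4 * (h * N))
        * Real.exp (-(1 / (2 * (h * N))) * quadForm (quadraticMatrix μ 2 N) w)
      = 1 / (4 * (h * N)) * ∑ k, w k ^ 4
        * Real.exp (-(1 / (2 * (h * N))) * quadForm (quadraticMatrix μ 2 N) w) := fun w => by
    rw [← Finset.sum_mul]; ring
  simp only [h1]
  rw [integral_const_mul, integral_finsetSum _ fun k _ => (key k).1]
  -- Here `K/c = 640 h`, so the total is `N · 9 · (640 h)²/(4hN) = 921600 h`.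
  calc _ ≤ 1 / (4 * (h * N)) * ∑ _k : Fin N, 9 * (320 / N / (1 / (2 * (h * N)))) ^ 2 * Z := by
        refine mul_le_mul_of_nonneg_left (Finset.sum_le_sum fun k _ => (key k).2) (by positivity)
    _ = 921600 * h * Z := by
        rw [Finset.sum_const, Finset.card_univ, Fintype.card_fin, nsmul_eq_mul]
        field_simp
        ring

/-- The mass of a well, compared with the mass of its Gaussian approximation. -/
theorem le_integral_well {μ h : ℝ} (hμ : 1 ≤ μ) (hh : 0 < h) (h1 : h ≤ 1) (hN : 1 ≤ N) :
    Real.exp (-(16588800 * h)) * ((1 - 17 / 18 * h)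
        * ∫ w : Space N, Real.exp (-(1 / (2 * (h * N))) * quadForm (quadraticMatrix μ 2 N) w))
      ≤ ∫ w in {w : Space N | |mean N w| < 3 / 4},
          Real.exp (-(V μ N (w + onesVector N) / (h * N))) := by
  have hN' : (0 : ℝ) < N := by positivity
  have hμ0 : 0 ≤ μ := zero_le_one.trans hμ
  have hM := posDef_quadraticMatrix hμ0 two_pos N
  obtain ⟨i4, b4⟩ := integrable_and_integral_sum_pow_four_le hμ hh hN
  have hKc : 1 / (2 * (N : ℝ)) / (1 / (2 * (h * N))) = h := by field_simp
  have hP := le_integral_indicator hM (c := 1 / (2 * (h * N))) (K := 1 / (2 * N)) (by positivity)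
    (by positivity) (v := fun _ => (N : ℝ)⁻¹)
    (fun x => by rw [← mean_eq_dotProduct]; exact sq_mean_le_quadForm hμ0 hN x) (by rwa [hKc])
  simp only [← mean_eq_dotProduct] at hP
  rw [hKc] at hP
  have i0 := (integrable_and_integral_exp_quadForm hM (c := 1 / (2 * (h * N))) (by positivity)).1
  have hZ := integral_exp_quadForm_pos hM (c := 1 / (2 * (h * N))) (by positivity)
  set q := fun w : Space N => Real.exp (-(1 / (2 * (h * N))) * quadForm (quadraticMatrix μ 2 N) w)
    with hq
  have hqc : Continuous q := by
    have := continuous_quadForm (quadraticMatrix μ 2 N)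
    fun_prop
  have hqpos : ∀ w, 0 < q w := fun w => Real.exp_pos _
  set Z := ∫ w : Space N, q w with hZdef
  set B := {w : Space N | |mean N w| < 3 / 4} with hBdef
  have hB : MeasurableSet B :=
    (isOpen_lt (mean N).continuous.abs continuous_const).measurableSet
  set P := ∫ w in B, q w with hPdef
  set T := fun w : Space N => (∑ k, w k ^ 3) / (h * N) with hT
  set F := fun w : Space N => (∑ k, w k ^ 4) / (4 * (h * N)) with hF
  have iF : Integrable fun w => F w * q w := by
    have := (integrable_finsetSum Finset.univ fun k _ => i4 k).const_mul (1 / (4 * (h * N)))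
    refine this.congr (Eventually.of_forall fun w => ?_)
    simp only [hF, hq, ← Finset.sum_mul]
    ring
  have iT : Integrable fun w => T w * q w := by
    have i3 : ∀ k : Fin N, Integrable fun w : Space N => w k ^ 3 * q w := by
      intro k
      refine (i0.add (i4 k)).mono' (by fun_prop) (Eventually.of_forall fun w => ?_)
      rw [Real.norm_eq_abs, abs_mul, abs_of_pos (hqpos w)]
      have h3 : |w k ^ 3| ≤ 1 + w k ^ 4 := by
        rw [abs_le]
        constructor <;> nlinarith [sq_nonneg (w k ^ 2 - w k), sq_nonneg (w k ^ 2 + w k),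
          sq_nonneg (w k ^ 2 - 1), sq_nonneg (w k)]
      calc |w k ^ 3| * q w ≤ (1 + w k ^ 4) * q w :=
            mul_le_mul_of_nonneg_right h3 (hqpos w).le
        _ = _ := by rw [add_mul, one_mul]; rfl
    have := (integrable_finsetSum Finset.univ fun k _ => i3 k).const_mul (1 / (h * N))
    refine this.congr (Eventually.of_forall fun w => ?_)
    simp only [hT, ← Finset.sum_mul]
    ring
  -- The cubic term is odd, and the well has been cut by a condition on the mean that is symmetric
  -- about its centre.
  have hTB : ∫ w in B, T w * q w = 0 := by
    rw [← integral_indicator hB]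
    refine integral_eq_zero_of_odd fun w => ?_
    have hTn : T (-w) = -T w := by
      simp only [hT, PiLp.neg_apply, Odd.neg_pow (by decide : Odd 3), Finset.sum_neg_distrib,
        neg_div]
    have hqn : q (-w) = q w := by simp only [hq, quadForm_neg]
    have hmem : -w ∈ B ↔ w ∈ B := by simp [hBdef]
    by_cases hw : w ∈ B
    · rw [Set.indicator_of_mem (hmem.2 hw), Set.indicator_of_mem hw, hTn, hqn, neg_mul]
    · rw [Set.indicator_of_notMem (mt hmem.1 hw), Set.indicator_of_notMem hw, neg_zero]
  have hFB : ∫ w in B, F w * q w ≤ 921600 * h * Z := by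
    refine le_trans (setIntegral_le_integral iF (Eventually.of_forall fun w => ?_)) b4
    have := hqpos w
    have : 0 ≤ F w := div_nonneg (Finset.sum_nonneg fun k _ => by positivity) (by positivity)
    simp only [Pi.zero_apply]
    positivity
  -- `r = 18 · 921600 h`. In `e^{-T-F} ≥ e^{-r}(1 + r - T - F)` the term `r P` absorbs the quartic
  -- integral because `P ≥ Z/18`. The resulting loss is a positive factor `e^{-r}`, valid up to `h =
  -- 1`.
  set r := 16588800 * h with hr
  have iV : Integrable fun w : Space N => Real.exp (-(V μ N (w + onesVector N) / (h * N))) :=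
    (integrable_exp_neg_V hμ0 hh hN).comp_add_right (onesVector N)
  have i0' := i0.const_mul (1 + r)
  have iL : Integrable fun w => Real.exp (-r) * ((1 + r) * q w - T w * q w - F w * q w) :=
    ((i0'.sub iT).sub iF).const_mul _
  have hmono : ∫ w in B, Real.exp (-r) * ((1 + r) * q w - T w * q w - F w * q w)
      ≤ ∫ w in B, Real.exp (-(V μ N (w + onesVector N) / (h * N))) := by
    refine integral_mono iL.integrableOn iV.integrableOn fun w => ?_
    have hV : -(V μ N (w + onesVector N) / (h * N))
        = -r + (r - T w - F w)
          + (-(1 / (2 * (h * N))) * quadForm (quadraticMatrix μ 2 N) w) := by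
      rw [V_add_onesVector, Finset.sum_add_distrib, ← Finset.sum_div]
      simp only [hT, hF]
      field_simp
      ring
    have h2 := Real.add_one_le_exp (r - T w - F w)
    simp only
    rw [hV, Real.exp_add, Real.exp_add, mul_assoc]
    refine mul_le_mul_of_nonneg_left ?_ (Real.exp_pos _).le
    calc (1 + r) * q w - T w * q w - F w * q w = (r - T w - F w + 1) * q w := by ring
      _ ≤ _ := mul_le_mul_of_nonneg_right h2 (hqpos w).le
  have hval : ∫ w in B, Real.exp (-r) * ((1 + r) * q w - T w * q w - F w * q w)
      = Real.exp (-r) * ((1 + r) * P - ∫ w in B, F w * q w) := by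
    have e1 := integral_sub (i0'.sub iT).integrableOn.integrable (iF.integrableOn (s := B)).integrable
    have e2 := integral_sub (i0'.integrableOn (s := B)).integrable
      (iT.integrableOn (s := B)).integrable
    simp only [Pi.sub_apply] at e1
    rw [integral_const_mul, e1, e2, integral_const_mul, hTB, sub_zero]
  rw [hval] at hmono
  refine le_trans (mul_le_mul_of_nonneg_left ?_ (Real.exp_pos _).le) hmono
  have hPZ : Z / 18 ≤ P := by nlinarith
  have hr0 : 0 ≤ r := by positivity
  have h5 := mul_le_mul_of_nonneg_left hPZ hr0
  have h6 : r * (Z / 18) = 921600 * h * Z := by rw [hr]; ring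
  linarith

end Well

/-! ### The transition profile and its Gaussian tail. -/

section TestFunction

/-- The one-dimensional transition profile through the saddle. -/
noncomputable def profile (h t : ℝ) : ℝ := ∫ s in (0 : ℝ)..t, Real.exp (-(s ^ 2 / (2 * h)))

theorem continuous_profile_integrand (h : ℝ) :
    Continuous fun s : ℝ => Real.exp (-(s ^ 2 / (2 * h))) := by
  fun_prop

theorem hasDerivAt_profile (h t : ℝ) :
    HasDerivAt (profile h) (Real.exp (-(t ^ 2 / (2 * h)))) t :=
  ((continuous_profile_integrand h).integral_hasStrictDerivAt 0 t).hasDerivAt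

theorem contDiff_profile (h : ℝ) : ContDiff ℝ 1 (profile h) := by
  rw [contDiff_one_iff_deriv]
  refine ⟨fun t => (hasDerivAt_profile h t).differentiableAt, ?_⟩
  rw [show deriv (profile h) = fun t => Real.exp (-(t ^ 2 / (2 * h))) from
    funext fun t => (hasDerivAt_profile h t).deriv]
  exact continuous_profile_integrand h

theorem profile_neg (h t : ℝ) : profile h (-t) = -profile h t := by
  have h1 := intervalIntegral.integral_comp_neg (a := 0) (b := t)
    (fun s : ℝ => Real.exp (-(s ^ 2 / (2 * h))))
  simp only [neg_sq, neg_zero] at h1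
  rw [profile, profile, h1, intervalIntegral.integral_symm]

theorem monotone_profile (h : ℝ) : Monotone (profile h) :=
  monotone_of_deriv_nonneg (contDiff_profile h).differentiable_one fun t => by
    rw [(hasDerivAt_profile h t).deriv]
    exact (Real.exp_pos _).le

theorem profile_nonneg (h : ℝ) {t : ℝ} (ht : 0 ≤ t) : 0 ≤ profile h t := by
  have := monotone_profile h ht
  simpa [profile] using this

theorem integrable_profile_integrand {h : ℝ} (hh : 0 < h) :
    Integrable fun s : ℝ => Real.exp (-(s ^ 2 / (2 * h))) := by
  have := integrable_exp_neg_mul_sq (b := 1 / (2 * h)) (by positivity)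
  refine this.congr (Eventually.of_forall fun s => ?_)
  simp only
  congr 1
  ring

theorem integral_Ioi_profile_integrand (h : ℝ) :
    ∫ s in Set.Ioi (0 : ℝ), Real.exp (-(s ^ 2 / (2 * h))) = Real.sqrt (Real.pi * h / 2) := by
  have := integral_gaussian_Ioi (1 / (2 * h))
  rw [show (fun s : ℝ => Real.exp (-(s ^ 2 / (2 * h))))
    = fun s => Real.exp (-(1 / (2 * h)) * s ^ 2) by ext s; congr 1; ring, this]
  rw [show Real.pi * h / 2 = Real.pi / (1 / (2 * h)) / 2 ^ 2 by
    rw [div_div_eq_mul_div, div_one]; ring, Real.sqrt_div' (Real.pi / (1 / (2 * h))) (by norm_num),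
    Real.sqrt_sq (by norm_num)]

theorem profile_eq_sub {h : ℝ} (hh : 0 < h) {t : ℝ} (ht : 0 ≤ t) :
    profile h t = Real.sqrt (Real.pi * h / 2)
      - ∫ s in Set.Ioi t, Real.exp (-(s ^ 2 / (2 * h))) := by
  have hi := integrable_profile_integrand hh
  rw [profile, intervalIntegral.integral_of_le ht, ← integral_Ioi_profile_integrand,
    ← Set.Ioc_union_Ioi_eq_Ioi ht, setIntegral_union (Set.Ioc_disjoint_Ioi le_rfl)
      measurableSet_Ioi hi.integrableOn hi.integrableOn]
  ring

theorem abs_profile_le {h : ℝ} (hh : 0 < h) (t : ℝ) :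
    |profile h t| ≤ Real.sqrt (Real.pi * h / 2) := by
  have h1 : ∀ t, 0 ≤ t → |profile h t| ≤ Real.sqrt (Real.pi * h / 2) := by
    intro t ht
    rw [abs_of_nonneg (profile_nonneg h ht), profile_eq_sub hh ht]
    have : 0 ≤ ∫ s in Set.Ioi t, Real.exp (-(s ^ 2 / (2 * h))) :=
      integral_nonneg fun s => (Real.exp_pos _).le
    linarith
  rcases le_total 0 t with ht | ht
  · exact h1 t ht
  · have := h1 (-t) (by linarith)
    rwa [profile_neg, abs_neg] at this

/-- The truncated Gaussian integral is close to the full one. -/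
theorem le_profile {h : ℝ} (hh : 0 < h) {t : ℝ} (ht : 0 ≤ t) :
    Real.sqrt (Real.pi * h / 2) * (1 - Real.exp (-(t ^ 2 / (2 * h)))) ≤ profile h t := by
  have hi := integrable_profile_integrand hh
  have h1 := (measurePreserving_add_right volume t).setIntegral_preimage_emb
    (measurableEmbedding_addRight t) (fun s : ℝ => Real.exp (-(s ^ 2 / (2 * h)))) (Set.Ioi t)
  have h2 : (fun s : ℝ => s + t) ⁻¹' Set.Ioi t = Set.Ioi 0 := by
    ext s; simp
  rw [h2] at h1
  -- The tail beyond `t` is translated to the origin, and `(s + t)² ≥ s² + t²` for `s, t ≥ 0`.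
  have h3 : ∫ s in Set.Ioi (0 : ℝ), Real.exp (-((s + t) ^ 2 / (2 * h)))
      ≤ ∫ s in Set.Ioi (0 : ℝ), Real.exp (-(t ^ 2 / (2 * h))) * Real.exp (-(s ^ 2 / (2 * h))) := by
    refine setIntegral_mono_on (hi.comp_add_right t).integrableOn (hi.const_mul _).integrableOn
      measurableSet_Ioi fun s hs => ?_
    rw [← Real.exp_add]
    refine Real.exp_le_exp.2 ?_
    rw [← neg_add, neg_le_neg_iff, ← add_div]
    have : 0 ≤ s * t := mul_nonneg (le_of_lt hs) ht
    gcongr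
    nlinarith
  rw [integral_const_mul, integral_Ioi_profile_integrand, h1] at h3
  rw [profile_eq_sub hh ht]
  linarith

end TestFunction

/-! ### Rayleigh quotient of the transition function and the upper bound for the Poincaré constant.
-/

section UpperBound

variable {N : ℕ}

/-- The test function: the transition profile of the mean. -/
noncomputable def transition (h : ℝ) (N : ℕ) (x : Space N) : ℝ := profile h (mean N x)

theorem contDiff_transition (h : ℝ) (N : ℕ) : ContDiff ℝ 1 (transition h N) :=
  (contDiff_profile h).comp (mean N).contDiff

theorem transition_neg (h : ℝ) (x : Space N) : transition h N (-x) = -transition h N x := by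
  rw [transition, transition, map_neg, profile_neg]

/-- The gradient of the mean has squared norm `1/N`, which cancels the `N` in the factor `hN` of the
Dirichlet form. -/
theorem norm_gradient_transition_sq (h : ℝ) (hN : 1 ≤ N) (x : Space N) :
    ‖gradient (transition h N) x‖ ^ 2 = Real.exp (-(mean N x ^ 2 / h)) / N := by
  have hN' : (0 : ℝ) < N := by positivity
  have hd : HasFDerivAt (transition h N)
      (Real.exp (-(mean N x ^ 2 / (2 * h))) • (mean N : Space N →L[ℝ] ℝ)) x :=
    (hasDerivAt_profile h (mean N x)).comp_hasFDerivAt x (mean N).hasFDerivAt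
  have hm : ∀ i : Fin N, mean N (EuclideanSpace.single i 1) = (N : ℝ)⁻¹ := by
    intro i
    simp [mean_apply]
  rw [EuclideanSpace.real_norm_sq_eq]
  simp only [gradient_apply, hd.fderiv, _root_.smul_apply, hm, smul_eq_mul]
  rw [Finset.sum_const, Finset.card_univ, Fintype.card_fin, nsmul_eq_mul, mul_pow,
    ← Real.exp_nat_mul]
  have : ((2 : ℕ) : ℝ) * -(mean N x ^ 2 / (2 * h)) = -(mean N x ^ 2 / h) := by
    push_cast; ring
  rw [this]
  field_simp

theorem memH1_transition {μ h : ℝ} (hμ : 0 ≤ μ) (hh : 0 < h) (hN : 1 ≤ N) :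
    MemH1 (gibbs μ h N) (transition h N) (gradient (transition h N)) := by
  have := isProbabilityMeasure_gibbs hμ hh hN
  have hN' : (1 : ℝ) ≤ N := by exact_mod_cast hN
  refine ⟨isWeakGradient_of_contDiff (contDiff_transition h N), ?_, ?_⟩
  · exact MemLp.of_bound (contDiff_transition h N).continuous.aestronglyMeasurable
      (Real.sqrt (Real.pi * h / 2)) (Eventually.of_forall fun x => abs_profile_le hh _)
  · refine MemLp.of_bound (continuous_gradient (contDiff_transition h N)).aestronglyMeasurable
      1 (Eventually.of_forall fun x => ?_)
    refine le_of_sq_le_sq ?_ zero_le_one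
    rw [norm_gradient_transition_sq h hN, one_pow, div_le_one (by linarith)]
    refine le_trans (Real.exp_le_one_iff.2 ?_) hN'
    have : 0 ≤ mean N x ^ 2 / h := by positivity
    linarith

/-- The Rayleigh quotient bound, written with the unnormalized Gibbs weight. -/
theorem poincareConstant_mul_integral_le {μ h : ℝ} (hμ : 0 ≤ μ) (hh : 0 < h) (hN : 1 ≤ N) :
    poincareConstant μ h N
        * ∫ x : Space N, Real.exp (-(V μ N x / (h * N))) * transition h N x ^ 2
      ≤ h * ∫ x : Space N, Real.exp (-(V μ N x / (h * N))) * Real.exp (-(mean N x ^ 2 / h)) := by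
  have := isProbabilityMeasure_gibbs hμ hh hN
  have hN' : (0 : ℝ) < N := by positivity
  have hmem := memH1_transition hμ hh hN
  have hP := (isGreatest_poincareConstant hμ hh hN).1 _ _ hmem
  have hZ : 0 < ∫ x : Space N, Real.exp (-(V μ N x / (h * N))) :=
    integral_exp_pos (integrable_exp_neg_V hμ hh hN)
  have hmean : ∫ x, transition h N x ∂(gibbs μ h N) = 0 := by
    rw [gibbs, integral_tilted_neg]
    rw [integral_eq_zero_of_odd fun x => ?_, zero_div]
    rw [V_neg, transition_neg, mul_neg]
  rw [variance_of_integral_eq_zero hmem.2.1.1.aemeasurable hmean] at hP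
  simp only [norm_gradient_transition_sq h hN] at hP
  rw [gibbs, integral_tilted_neg, integral_tilted_neg, ← mul_div_assoc, ← mul_div_assoc,
    div_le_div_iff_of_pos_right hZ] at hP
  refine hP.trans (le_of_eq ?_)
  simp only [← mul_div_assoc]
  rw [integral_div]
  field_simp

theorem integral_saddle_le {μ h : ℝ} (hμ : 1 < μ) (hh : 0 < h) (hN : 1 ≤ N) :
    ∫ x : Space N, Real.exp (-(V μ N x / (h * N))) * Real.exp (-(mean N x ^ 2 / h))
      ≤ Real.exp (-(1 / (4 * h)))
        * ∫ x : Space N, Real.exp (-(1 / (2 * (h * N))) * quadForm (saddleMatrix μ N) x) := by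
  have hN' : (0 : ℝ) < N := by positivity
  have i1 := (integrable_and_integral_exp_quadForm (posDef_saddleMatrix hμ hN)
    (c := 1 / (2 * (h * N))) (by positivity)).1
  rw [← integral_const_mul]
  refine integral_mono_of_nonneg (Eventually.of_forall fun x => by positivity)
    (i1.const_mul _) (Eventually.of_forall fun x => ?_)
  simp only
  rw [← Real.exp_add, ← Real.exp_add]
  refine Real.exp_le_exp.2 ?_
  have h1 := saddle_le_V μ hN x
  have h2 : -(V μ N x / (h * N)) + -(mean N x ^ 2 / h)
      = -((V μ N x + N * mean N x ^ 2) / (h * N)) := by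
    field_simp
    ring
  have h3 : -(1 / (4 * h)) + -(1 / (2 * (h * N))) * quadForm (saddleMatrix μ N) x
      = -((N / 4 + 1 / 2 * quadForm (saddleMatrix μ N) x) / (h * N)) := by
    field_simp
    ring
  rw [h2, h3, neg_le_neg_iff]
  gcongr

/-- The sets where the mean is within `3/4` of `1` and of `-1` are disjoint and exchanged by `x ↦
-x`. On both, the mean has modulus at least `1/4`, whence the factor `2 profile(1/4)²`. -/
theorem le_integral_transition_sq {μ h : ℝ} (hμ : 0 ≤ μ) (hh : 0 < h) (hN : 1 ≤ N) :
    2 * profile h (1 / 4) ^ 2 * ∫ w in {w : Space N | |mean N w| < 3 / 4},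
        Real.exp (-(V μ N (w + onesVector N) / (h * N)))
      ≤ ∫ x : Space N, Real.exp (-(V μ N x / (h * N))) * transition h N x ^ 2 := by
  set a := profile h (1 / 4) with ha
  have ha0 : 0 ≤ a := profile_nonneg h (by norm_num)
  set f := fun x : Space N => Real.exp (-(V μ N x / (h * N))) with hf
  have hfpos : ∀ x, 0 < f x := fun x => Real.exp_pos _
  have hfi : Integrable f := integrable_exp_neg_V hμ hh hN
  have hfneg : ∀ x, f (-x) = f x := fun x => by simp only [hf, V_neg]
  set B := {w : Space N | |mean N w| < 3 / 4} with hBdef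
  have hB : MeasurableSet B :=
    (isOpen_lt (mean N).continuous.abs continuous_const).measurableSet
  set g := fun x : Space N => B.indicator (fun w => f (w + onesVector N)) (x - onesVector N) with hg
  have hgi : Integrable g :=
    ((hfi.comp_add_right (onesVector N)).indicator hB).comp_sub_right (onesVector N)
  have hgint : ∫ x, g x = ∫ w in B, f (w + onesVector N) := by
    rw [hg, integral_sub_right_eq_self (fun x => B.indicator (fun w => f (w + onesVector N)) x),
      integral_indicator hB]
  have hgneg : ∫ x, g (-x) = ∫ x, g x := integral_neg_eq_self g volume
  have hmem : ∀ x : Space N, x - onesVector N ∈ B ↔ |mean N x - 1| < 3 / 4 := fun x => by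
    rw [hBdef, Set.mem_ofPred_eq, map_sub, mean_onesVector hN]
  have hpt : ∀ x, a ^ 2 * (g x + g (-x)) ≤ f x * transition h N x ^ 2 := by
    intro x
    have hnn : 0 ≤ f x * transition h N x ^ 2 := mul_nonneg (hfpos x).le (sq_nonneg _)
    have hsq : ∀ y : Space N, |mean N y - 1| < 3 / 4 → a ^ 2 ≤ transition h N y ^ 2 := by
      intro y hy
      refine pow_le_pow_left₀ ha0 (monotone_profile h ?_) 2
      have := (abs_lt.1 hy).1
      linarith
    by_cases h1 : x - onesVector N ∈ B
    · have h2 : -x - onesVector N ∉ B := by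
        rw [hmem] at h1 ⊢
        rw [map_neg]
        intro h3
        have := (abs_lt.1 h1).1
        have := (abs_lt.1 h3).1
        linarith
      simp only [hg, Set.indicator_of_mem h1, Set.indicator_of_notMem h2, add_zero,
        sub_add_cancel]
      rw [mul_comm]
      exact mul_le_mul_of_nonneg_left (hsq x ((hmem x).1 h1)) (hfpos x).le
    · by_cases h2 : -x - onesVector N ∈ B
      · simp only [hg, Set.indicator_of_mem h2, Set.indicator_of_notMem h1, zero_add,
          sub_add_cancel, hfneg]
        rw [mul_comm]
        refine mul_le_mul_of_nonneg_left ?_ (hfpos x).le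
        have := hsq (-x) ((hmem (-x)).1 h2)
        rwa [transition_neg, neg_sq] at this
      · simp only [hg, Set.indicator_of_notMem h1, Set.indicator_of_notMem h2, add_zero, mul_zero]
        exact hnn
  have hi : Integrable fun x => f x * transition h N x ^ 2 := by
    refine (hfi.mul_const (Real.sqrt (Real.pi * h / 2) ^ 2)).mono' ?_
      (Eventually.of_forall fun x => ?_)
    · exact hfi.1.mul ((contDiff_transition h N).continuous.pow 2).aestronglyMeasurable
    · rw [Real.norm_of_nonneg (mul_nonneg (hfpos x).le (sq_nonneg _))]
      refine mul_le_mul_of_nonneg_left ?_ (hfpos x).le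
      rw [← sq_abs (transition h N x)]
      exact pow_le_pow_left₀ (abs_nonneg _) (abs_profile_le hh _) 2
  have hmono := integral_mono ((hgi.add hgi.comp_neg).const_mul (a ^ 2)) hi hpt
  rw [integral_const_mul] at hmono
  have hadd := integral_add hgi hgi.comp_neg
  simp only [Pi.add_apply] at hmono
  rw [hadd, hgneg, hgint] at hmono
  linarith

/-- The error factor in the upper bound. -/
theorem error_factor_le {h : ℝ} (hh : 0 < h) (h1 : h ≤ 1) {a E C : ℝ} (hC : 0 ≤ C)
    (ha : Real.sqrt (Real.pi * h / 2) * (1 - Real.exp (-(1 / (32 * h)))) ≤ a)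
    (hE : E = Real.exp (-(C * h)) * (1 - 17 / 18 * h)) :
    Real.pi * h ≤ (2 * a ^ 2 * E) *
      (1 + (33 ^ 2 * 18 * Real.exp C) * h) := by
  have hπh : 0 < Real.pi * h := mul_pos Real.pi_pos hh
  set y := 1 / (32 * h) with hy
  have hy0 : 0 < y := by positivity
  have hyh : y * (32 * h) = 1 := by rw [hy]; field_simp
  -- From `(1 + y) e^{-y} ≤ 1`: the profile defect `e^{-1/(32h)}` costs at most a factor `1 + 32h`.
  have hexp : (1 + 32 * h) * Real.exp (-y) ≤ 32 * h := by
    have h2 : (1 + y) * Real.exp (-y) ≤ 1 := by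
      calc (1 + y) * Real.exp (-y) ≤ Real.exp y * Real.exp (-y) :=
            mul_le_mul_of_nonneg_right (by linarith [Real.add_one_le_exp y]) (Real.exp_pos _).le
        _ = 1 := by rw [← Real.exp_add]; simp
    calc (1 + 32 * h) * Real.exp (-y) = 32 * h * ((1 + y) * Real.exp (-y)) := by
          linear_combination -Real.exp (-y) * hyh
      _ ≤ 32 * h * 1 := by gcongr
      _ = 32 * h := mul_one _
  have hb : 1 ≤ (1 + 32 * h) * (1 - Real.exp (-y)) := by linarith
  have ha2 : Real.pi * h ≤ 2 * a ^ 2 * (1 + 32 * h) ^ 2 := by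
    have hs : 0 < Real.sqrt (Real.pi * h / 2) := Real.sqrt_pos.2 (by positivity)
    have h2 : Real.sqrt (Real.pi * h / 2) ≤ a * (1 + 32 * h) := by
      calc Real.sqrt (Real.pi * h / 2)
          ≤ Real.sqrt (Real.pi * h / 2) * ((1 + 32 * h) * (1 - Real.exp (-y))) :=
            le_mul_of_one_le_right hs.le hb
        _ = Real.sqrt (Real.pi * h / 2) * (1 - Real.exp (-y)) * (1 + 32 * h) := by ring
        _ ≤ a * (1 + 32 * h) := by gcongr
    have h3 := pow_le_pow_left₀ hs.le h2 2
    rw [Real.sq_sqrt (by positivity), mul_pow] at h3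
    linarith
  -- `(1 - 17h/18)(1 + 17h) = 1 + (289/18) h (1 - h)`, which is at least 1 for `0 < h ≤ 1`.
  have hE1 : 1 ≤ E * ((1 + 17 * h) * Real.exp (C * h)) := by
    have h2 : Real.exp (-(C * h)) * Real.exp (C * h) = 1 := by rw [← Real.exp_add]; simp
    have h3 : E * ((1 + 17 * h) * Real.exp (C * h)) = (1 - 17 / 18 * h) * (1 + 17 * h) := by
      rw [hE]
      linear_combination (1 - 17 / 18 * h) * (1 + 17 * h) * h2
    rw [h3]
    nlinarith [mul_nonneg hh.le (sub_nonneg.2 h1)]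
  have hconv : Real.exp (C * h) ≤ 1 + (Real.exp C - 1) * h := by
    have := convexOn_exp.2 (Set.mem_univ C) (Set.mem_univ 0) hh.le (sub_nonneg.2 h1) (by ring)
    simp only [smul_eq_mul, mul_zero, add_zero, Real.exp_zero, mul_one] at this
    rw [mul_comm C h]
    linarith
  -- For `h ≤ 1`, factors `1 + bh` and `1 + ch` multiply to at most `1 + ((1 + b)(1 + c) - 1) h`.
  -- Taking `b = 32` twice, `17` and `e^C - 1` gives `33² · 18 · e^C`.
  have hprod : ∀ {u v b c : ℝ}, 0 ≤ u → 0 ≤ v → 0 ≤ b → 0 ≤ c → u ≤ 1 + b * h → v ≤ 1 + c * h →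
      u * v ≤ 1 + ((1 + b) * (1 + c) - 1) * h := by
    intro u v b c hu hv hb hc hub hvc
    have h2 : u * v ≤ (1 + b * h) * (1 + c * h) := mul_le_mul hub hvc hv (by positivity)
    have h3 : b * c * (h * h) ≤ b * c * (h * 1) := by gcongr
    nlinarith
  have hC1 : 1 ≤ Real.exp C := Real.one_le_exp hC
  have hfac : (1 + 32 * h) ^ 2 * ((1 + 17 * h) * Real.exp (C * h))
      ≤ 1 + 33 ^ 2 * 18 * Real.exp C * h := by
    have h2 := hprod (by positivity) (by positivity) (by norm_num) (by linarith)
      (le_refl (1 + 17 * h)) hconv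
    have h3 := hprod (by positivity) (by positivity) (by norm_num) (by norm_num)
      (le_refl (1 + 32 * h)) (le_refl (1 + 32 * h))
    rw [← sq] at h3
    have h4 := hprod (by positivity) (by positivity) (by norm_num) (by linarith) h3 h2
    refine h4.trans ?_
    nlinarith
  have hE0 : 0 ≤ E := by
    rw [hE]
    exact mul_nonneg (Real.exp_pos _).le (by linarith)
  calc Real.pi * h = Real.pi * h * 1 := (mul_one _).symm
    _ ≤ 2 * a ^ 2 * (1 + 32 * h) ^ 2 * (E * ((1 + 17 * h) * Real.exp (C * h))) :=
        mul_le_mul ha2 hE1 zero_le_one (by positivity)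
    _ = 2 * a ^ 2 * E * ((1 + 32 * h) ^ 2 * ((1 + 17 * h) * Real.exp (C * h))) := by ring
    _ ≤ _ := mul_le_mul_of_nonneg_left hfac (by positivity)

/-- The saddle Gaussian equals `π p(N)` times the well Gaussian `Z`, so `Z` cancels from the
Rayleigh quotient; the profile and well corrections remain in the factor bounded by
`error_factor_le`. -/
theorem poincareConstant_le {μ h : ℝ} (hμ : 1 < μ) (hh : 0 < h) (h1 : h ≤ 1) (hN : 1 ≤ N) :
    poincareConstant μ h N ≤ prefactor μ N * Real.exp (-(1 / (4 * h)))
      * (1 + 33 ^ 2 * 18 * Real.exp 16588800 * h) := by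
  have hμ0 : 0 ≤ μ := by linarith
  have hN' : (0 : ℝ) < N := by positivity
  have hc : 0 < 1 / (2 * (h * N)) := by positivity
  have hA := posDef_saddleMatrix hμ hN
  have hM := posDef_quadraticMatrix hμ0 two_pos N
  set Z := ∫ w : Space N, Real.exp (-(1 / (2 * (h * N))) * quadForm (quadraticMatrix μ 2 N) w)
    with hZdef
  have hZ : 0 < Z := integral_exp_quadForm_pos hM hc
  set E := Real.exp (-(16588800 * h)) * (1 - 17 / 18 * h) with hE
  have hEpos : 0 < E := mul_pos (Real.exp_pos _) (by linarith)
  set a := profile h (1 / 4) with ha_def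
  have hale := le_profile hh (t := 1 / 4) (by norm_num)
  rw [show (1 / 4 : ℝ) ^ 2 / (2 * h) = 1 / (32 * h) by field_simp; norm_num, ← ha_def] at hale
  have hapos : 0 < a := by
    refine lt_of_lt_of_le (mul_pos (Real.sqrt_pos.2 (by have := Real.pi_pos; positivity)) ?_) hale
    have : Real.exp (-(1 / (32 * h))) < 1 := Real.exp_lt_one_iff.2 (by
      have : 0 < 1 / (32 * h) := by positivity
      linarith)
    linarith
  have hlam : 0 ≤ poincareConstant μ h N :=
    (isGreatest_poincareConstant hμ0 hh hN).2 fun φ G _ => by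
      rw [zero_mul]
      exact mul_nonneg (by positivity) (integral_nonneg fun x => sq_nonneg _)
  have hden : 2 * a ^ 2 * (E * Z)
      ≤ ∫ x : Space N, Real.exp (-(V μ N x / (h * N))) * transition h N x ^ 2 := by
    refine le_trans (mul_le_mul_of_nonneg_left ?_ (by positivity))
      (le_integral_transition_sq hμ0 hh hN)
    have := le_integral_well hμ.le hh h1 hN
    rwa [← mul_assoc] at this
  have hnum := mul_le_mul_of_nonneg_left (integral_saddle_le hμ hh hN) hh.le
  rw [integral_exp_quadForm_eq hA hM hc, ← hZdef] at hnum
  have hall := ((mul_le_mul_of_nonneg_left hden hlam).trans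
    (poincareConstant_mul_integral_le hμ0 hh hN)).trans hnum
  have hp : Real.sqrt ((quadraticMatrix μ 2 N).det / (saddleMatrix μ N).det)
      = Real.pi * prefactor μ N := by
    rw [prefactor_eq hμ hN]
    field_simp
  rw [hp] at hall
  have hfac := error_factor_le hh h1 (by norm_num : (0 : ℝ) ≤ 16588800) hale hE
  have hpp := prefactor_pos hμ hN
  have hD : 0 < 2 * a ^ 2 * E := by positivity
  refine le_of_mul_le_mul_right ?_ (mul_pos hD hZ)
  calc poincareConstant μ h N * (2 * a ^ 2 * E * Z)
      = poincareConstant μ h N * (2 * a ^ 2 * (E * Z)) := by ring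
    _ ≤ _ := hall
    _ = prefactor μ N * Real.exp (-(1 / (4 * h))) * Z * (Real.pi * h) := by ring
    _ ≤ prefactor μ N * Real.exp (-(1 / (4 * h))) * Z
        * ((2 * a ^ 2 * E) * (1 + (33 ^ 2 * 18 * Real.exp 16588800) * h)) := by gcongr
    _ = _ := by ring

end UpperBound

end AllenCahn

theorem theorem1 (μ : ℝ) (hμ : 1 < μ) :
    (∀ h : ℝ, 0 < h → ∀ N : ℕ, 1 ≤ N →
      IsGreatest (AllenCahn.logSobolevConstants μ h N) (AllenCahn.logSobolevConstant μ h N) ∧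
      IsGreatest (AllenCahn.poincareConstants μ h N) (AllenCahn.poincareConstant μ h N)) ∧
    (∃ ε : ℝ → ℕ → ℝ,
      (∃ C : ℝ, 0 < C ∧ ∀ h : ℝ, 0 < h → h ≤ 1 → ∀ N : ℕ, 1 ≤ N → |ε h N| ≤ C * h) ∧
      ∀ δ : ℝ, 0 < δ → ∃ Cδ : ℝ, 0 < Cδ ∧ ∀ h : ℝ, 0 < h → ∀ N : ℕ, 1 ≤ N →
        Cδ * Real.exp (-((3 + 2 * Real.sqrt 2 + δ) / (24 * h))) * Real.exp (-(1 / (4 * h)))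
          ≤ AllenCahn.logSobolevConstant μ h N ∧
        AllenCahn.logSobolevConstant μ h N ≤ AllenCahn.poincareConstant μ h N ∧
        AllenCahn.poincareConstant μ h N
          ≤ AllenCahn.prefactor μ N * Real.exp (-(1 / (4 * h))) * (1 + ε h N)) ∧
    Tendsto (fun N : ℕ => AllenCahn.prefactor μ N) atTop
      (𝓝 (Real.sinh (Real.pi * Real.sqrt (2 / μ)) /
        (Real.pi * Real.sin (Real.pi / Real.sqrt μ)))) := by
  have hμ0 : 0 ≤ μ := by linarith
  refine ⟨fun h hh N hN => ⟨AllenCahn.isGreatest_logSobolevConstant hμ0 hh hN,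
    AllenCahn.isGreatest_poincareConstant hμ0 hh hN⟩, ?_, AllenCahn.tendsto_prefactor hμ⟩
  -- For `h > 1` no bound on `ε` is required, and `ε` is defined so that the upper bound is an
  -- equality. The constant `1/3` serves as `C_δ` for every `δ`.
  refine ⟨fun h N => if h ≤ 1 then 33 ^ 2 * 18 * Real.exp 16588800 * h
    else AllenCahn.poincareConstant μ h N
      / (AllenCahn.prefactor μ N * Real.exp (-(1 / (4 * h)))) - 1,
    ⟨33 ^ 2 * 18 * Real.exp 16588800, by positivity, fun h hh h1 N _ => ?_⟩,
    fun δ hδ => ⟨1 / 3, by norm_num, fun h hh N hN =>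
      ⟨AllenCahn.exp_le_logSobolevConstant hμ0 hh hδ hN,
        AllenCahn.logSobolevConstant_le_poincareConstant hμ0 hh hN, ?_⟩⟩⟩
  · simp only [if_pos h1]
    rw [abs_of_nonneg (by positivity)]
  · by_cases h1 : h ≤ 1
    · simp only [if_pos h1]
      exact AllenCahn.poincareConstant_le hμ hh h1 hN
    · simp only [if_neg h1]
      have := AllenCahn.prefactor_pos hμ hN
      rw [add_sub_cancel, mul_div_cancel₀ _ (by positivity)]
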